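/- Let $n\ge 1$, let $\Sigma$ be one of $\mathbb{E}^{n+1}$, $\mathbb{S}^{n+1}$, $\mathbb{H}^{n+1}$ (Euclidean, spherical, hyperbolic space of sectional curvature $0,1,-1$), and let $\lambda>0$. A set $K\subset\Sigma$ is called $\lambda$-convex if for every $p\in\partial K$ there is a complete (connected) totally umbilic hypersurface $S\ni p$ of $\Sigma$, all of whose principal curvatures equal $\lambda$, such that a neighbourhood of $p$ in $K$ lies in the closed side of $S$ into which the mean curvature vector of $S$ points. A $\lambda$-convex body is a compact $\lambda$-convex set with nonempty interior; it is nontrivial if it is not itself the full closed mean curvature side of such a hypersurface $S$. Let $K\subset\Sigma$ be a connected, nontrivial $\lambda$-convex body, $K\neq\Sigma$, whose boundary $\partial K$ is a hypersurface of class $C^2$, and let principal curvatures of $\partial K$ be taken with respect to the inward unit normal (so that those of a geodesic ball of small radius are positive). Then there exists $p\in\partial K$ at which the smallest principal curvature of $\partial K$ is larger than $\lambda$. In particular, $\partial K$ contains a strictly $\lambda$-convex hypersurface, i.e. there is a nonempty relatively open subset $M\subset\partial K$, which is a $C^2$ hypersurface, such that at every point of $M$ the smallest principal curvature is larger than $\lambda$.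 -/

import Mathlib

open Set Filter Topology
open scoped ContDiff

/-- The three simply connected space forms, of sectional curvature `0`, `1` and `-1`. -/
inductive SpaceForm where
  | euclidean
  | spherical
  | hyperbolic

namespace SpaceForm

/-- The ambient vector space `ℝ^{n+2}` of the models; the distinguished coordinate is `x 0`. -/
abbrev Ambient (n : ℕ) : Type := EuclideanSpace ℝ (Fin (n + 2))

/-- The ambient bilinear form which induces the Riemannian metric of the model: the Euclidean inner
product, respectively the Lorentzian form `-x₀ y₀ + x₁ y₁ + ⋯ + x_{n+1} y_{n+1}`. -/
def form (S : SpaceForm) {n : ℕ} (x y : Ambient n) : ℝ :=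
  match S with
  | euclidean => ∑ i, x i * y i
  | spherical => ∑ i, x i * y i
  | hyperbolic => -(x 0 * y 0) + ∑ i : Fin (n + 1), x i.succ * y i.succ

/-- The underlying set of the `(n+1)`-dimensional model: the affine hyperplane `x₀ = 1` (a copy of
`ℝ^{n+1}`), the unit sphere, the upper sheet of the two-sheeted hyperboloid. -/
def carrier (S : SpaceForm) (n : ℕ) : Set (Ambient n) :=
  match S with
  | euclidean => {x | x 0 = 1}
  | spherical => {x | form spherical x x = 1}
  | hyperbolic => {x | form hyperbolic x x = -1 ∧ 0 < x 0}

/-- The space form of dimension `n + 1`, as a topological space. -/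
abbrev Space (S : SpaceForm) (n : ℕ) : Type := ↥(carrier S n)

variable {S : SpaceForm} {n : ℕ}

/-- `X` is tangent to `M` at `p`: it is the velocity of a curve in `M` through `p`. For `M = univ`
these are the tangent vectors of the space form, for a hypersurface those of the hypersurface. -/
def IsTangent (M : Set (Space S n)) (p : Space S n) (X : Ambient n) : Prop :=
  ∃ γ : ℝ → Space S n, γ 0 = p ∧ HasDerivAt (fun t => (γ t : Ambient n)) X 0 ∧
    ∀ᶠ t in 𝓝 (0 : ℝ), γ t ∈ M

/-- `M` is an embedded hypersurface of class `C^k` of the space form: locally it is the zero set of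
a `C^k` function whose differential does not vanish on the tangent space of the space form. -/
def IsHypersurface (k : WithTop ℕ∞) (M : Set (Space S n)) : Prop :=
  ∀ p ∈ M, ∃ f : Ambient n → ℝ, ContDiffAt ℝ k f (p : Ambient n) ∧
    (∀ᶠ x : Space S n in 𝓝 p, x ∈ M ↔ f x = 0) ∧
    ∃ X, IsTangent univ p X ∧ fderiv ℝ f (p : Ambient n) X ≠ 0

/-- `ν` is a unit normal field along the hypersurface `M` (its values off `M` are irrelevant). -/
def IsUnitNormal (M : Set (Space S n)) (ν : Space S n → Ambient n) : Prop :=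
  ∀ p ∈ M, IsTangent univ p (ν p) ∧ form S (ν p) (ν p) = 1 ∧
    ∀ X, IsTangent M p X → form S (ν p) X = 0

/-- `Y = A X` for the Weingarten map `A = -Dν` of `M` at `p` with respect to the unit normal `ν`.
The field `ν` is extended to a `C¹` map near `p` in the ambient vector space. Its ambient derivative
in a direction `X` tangent to `M` is automatically tangent to `M`, so it is the covariant
derivative `D_X ν` in the space form. -/
def IsWeingarten (M : Set (Space S n)) (ν : Space S n → Ambient n) (p : Space S n)
    (X Y : Ambient n) : Prop :=
  IsTangent M p X ∧ ∃ N : Ambient n → Ambient n, ContDiffAt ℝ 1 N (p : Ambient n) ∧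
    (∀ᶠ q : Space S n in 𝓝[M] p, N q = ν q) ∧ Y = -(fderiv ℝ N (p : Ambient n) X)

/-- The principal curvatures of `M` at `p` with respect to `ν`: the eigenvalues of the
Weingarten map. -/
def principalCurvatures (M : Set (Space S n)) (ν : Space S n → Ambient n) (p : Space S n) :
    Set ℝ :=
  {κ | ∃ X, X ≠ 0 ∧ IsWeingarten M ν p X (κ • X)}

/-- `ν` is the inward unit normal field along the boundary of `K`: at every boundary point it is a
unit normal and the initial velocity of a curve that moves into `K`. -/
def IsInwardUnitNormal (K : Set (Space S n)) (ν : Space S n → Ambient n) : Prop :=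
  IsUnitNormal (frontier K) ν ∧
    ∀ p ∈ frontier K, ∃ γ : ℝ → Space S n, γ 0 = p ∧
      HasDerivAt (fun t => (γ t : Ambient n)) (ν p) 0 ∧ ∀ᶠ t in 𝓝[>] (0 : ℝ), γ t ∈ K

/-- `D` is the (closed) mean curvature side of a complete, totally umbilic hypersurface of
curvature `lam`: the hypersurface is `frontier D`; it is connected, smooth and closed in the space
form, and its Weingarten map with respect to the normal pointing into `D` is `lam` times the
identity. -/
def IsUmbilicSide (lam : ℝ) (D : Set (Space S n)) : Prop :=
  IsClosed D ∧ IsConnected (frontier D) ∧ IsHypersurface ∞ (frontier D) ∧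
    ∃ ν, IsInwardUnitNormal D ν ∧
      ∀ p ∈ frontier D, ∀ X, IsTangent (frontier D) p X →
        IsWeingarten (frontier D) ν p X (lam • X)

/-- `K` is `lam`-convex: near each of its boundary points `p`, it lies in the mean curvature side of
a complete totally umbilic hypersurface of curvature `lam` through `p`. -/
def IsLambdaConvex (lam : ℝ) (K : Set (Space S n)) : Prop :=
  ∀ p ∈ frontier K, ∃ D : Set (Space S n), IsUmbilicSide lam D ∧ p ∈ frontier D ∧
    ∀ᶠ x in 𝓝[K] p, x ∈ D

/-- A `lam`-convex body: a compact `lam`-convex set with nonempty interior. -/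
def IsLambdaConvexBody (lam : ℝ) (K : Set (Space S n)) : Prop :=
  IsCompact K ∧ IsLambdaConvex lam K ∧ (interior K).Nonempty

/-- `K` is nontrivial: it is not the full side of a totally umbilic hypersurface of
curvature `lam`. -/
def IsNontrivial (lam : ℝ) (K : Set (Space S n)) : Prop :=
  ¬ IsUmbilicSide lam K

/-- The hypersurface `M` (of class `C²`), oriented by the unit normal `ν`, is strictly `lam`-convex:
at each of its points the smallest principal curvature is larger than `lam`. -/
def IsStrictlyLambdaConvex (lam : ℝ) (M : Set (Space S n)) (ν : Space S n → Ambient n) : Prop :=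
  IsHypersurface 2 M ∧ IsUnitNormal M ν ∧
    ∀ p ∈ M, ∃ κ, IsLeast (principalCurvatures M ν p) κ ∧ lam < κ

end SpaceForm

/-! The three space forms are treated together, inside a vector space carrying the bilinear form
`bil`. Along a totally umbilic hypersurface of curvature `lam` the vector `ν + lam • x` is locally
constant, equal to some `c`, so the hypersurface lies in a quadric `bil (c - lam • x) (c - lam • x)
= 1`, and its mean curvature side is described near `p` by `0 ≤ gap S lam v p x`, where `v` is the
normal at `p`.

Comparison with these sides makes the normal curvatures of the boundary at least `lam` and makes `K`
locally strictly convex (`IsDefFun.lambdaConvex`). As in the Tietze–Nakajima theorem, local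
convexity of a connected set becomes global: the points of `K` visible from an interior point form
an open and closed subset (`bil_sub_nonneg`). On the sphere this fails at the antipode of the
interior point, and `K ≠ univ` is what excludes antipodes (`not_antipodal_interior`). Convexity and
the curvature bound give a form of Blaschke's rolling theorem (`gap_nonneg`): all of `K`, not just a
neighbourhood of `p`, lies in the quadric side tangent to the boundary at `p`.

Three cases remain. If `lam ^ 2 + curv S ≤ 0`, the space is hyperbolic and `lam ≤ 1`. At the point
of `K` farthest from a fixed point, `K` is touched from outside by a geodesic sphere, whose
curvature exceeds 1 (`exists_lt_shape_hyperbolic`). Otherwise the tangent quadrics are geodesic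
spheres of one radius. If two of them have different centres, `K` lies in the intersection of two
distinct balls, hence in a smaller ball about the midpoint of the centres; at the point of `K`
farthest from this midpoint all principal curvatures exceed `lam` (`exists_lt_shape_of_center_ne`).
If all centres agree, `K` is the ball itself (`isUmbilicSide_of_center_eq`), contrary to
nontriviality. The strict inequality at one point persists nearby because the Weingarten map of a
`C²` boundary is continuous (`exists_isStrictlyLambdaConvex`). -/

namespace SpaceForm

/-! ### Linear algebra of the ambient form. -/

/-- The curvature of the space form. -/
def curv (S : SpaceForm) : ℝ :=
  match S with
  | euclidean => 0
  | spherical => 1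
  | hyperbolic => -1

/-- The distinguished basis vector, a point of all three models. -/
noncomputable def basePoint (n : ℕ) : Ambient n := EuclideanSpace.single 0 1

/-- The symmetry of the ambient space which relates `form` to the Euclidean inner product. -/
noncomputable def refl (S : SpaceForm) (n : ℕ) : Ambient n →L[ℝ] Ambient n :=
  match S with
  | euclidean => ContinuousLinearMap.id ℝ _
  | spherical => ContinuousLinearMap.id ℝ _
  | hyperbolic => ContinuousLinearMap.id ℝ _ -
      (2 : ℝ) • (EuclideanSpace.proj (0 : Fin (n + 2))).smulRight (basePoint n)

/-- `form` as a continuous bilinear form. -/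
noncomputable def bil (S : SpaceForm) {n : ℕ} : Ambient n →L[ℝ] Ambient n →L[ℝ] ℝ :=
  (innerSL ℝ).comp (refl S n)

/-- The functional whose kernel is the tangent space of the model at `p`. -/
noncomputable def rad (S : SpaceForm) {n : ℕ} (p : Ambient n) : Ambient n →L[ℝ] ℝ :=
  match S with
  | euclidean => EuclideanSpace.proj (0 : Fin (n + 2))
  | spherical => bil spherical p
  | hyperbolic => bil hyperbolic p

variable {S : SpaceForm} {n : ℕ}

@[simp] lemma basePoint_zero : basePoint n 0 = 1 := by simp [basePoint]

@[simp] lemma basePoint_succ (i : Fin (n + 1)) : basePoint n i.succ = 0 := by simp [basePoint]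

lemma inner_ambient (x y : Ambient n) : inner ℝ x y = ∑ i, x i * y i := by
  simp [PiLp.inner_apply, mul_comm]

lemma bil_apply (x y : Ambient n) : bil S x y = form S x y := by
  cases S
  · simp [bil, refl, form, innerSL_apply_apply ℝ, inner_ambient]
  · simp [bil, refl, form, innerSL_apply_apply ℝ, inner_ambient]
  · simp only [bil, refl, form, ContinuousLinearMap.comp_apply, innerSL_apply_apply]
    rw [inner_ambient, Fin.sum_univ_succ]
    simp
    ring

lemma form_eq (x y : Ambient n) : form S x y = bil S x y := (bil_apply x y).symm

lemma bil_smul_left (c : ℝ) (x y : Ambient n) : bil S (c • x) y = c * bil S x y := by simp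

lemma bil_add_left (x y z : Ambient n) : bil S (x + y) z = bil S x z + bil S y z := by simp

lemma bil_sub_left (x y z : Ambient n) : bil S (x - y) z = bil S x z - bil S y z := by simp

lemma bil_smul_right (c : ℝ) (x y : Ambient n) : bil S x (c • y) = c * bil S x y := by simp

lemma bil_add_right (x y z : Ambient n) : bil S x (y + z) = bil S x y + bil S x z := by simp

lemma bil_sub_right (x y z : Ambient n) : bil S x (y - z) = bil S x y - bil S x z := by simp

lemma bil_symm (x y : Ambient n) : bil S x y = bil S y x := by
  rw [bil_apply, bil_apply]
  cases S <;> simp only [form, mul_comm]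

lemma bil_euclidean (x y : Ambient n) : bil euclidean x y = inner ℝ x y := by
  rw [bil_apply, inner_ambient]; rfl

lemma bil_spherical (x y : Ambient n) : bil spherical x y = inner ℝ x y := by
  rw [bil_apply, inner_ambient]; rfl

lemma bil_hyperbolic (x y : Ambient n) :
    bil hyperbolic x y = -(x 0 * y 0) + ∑ i : Fin (n + 1), x i.succ * y i.succ := bil_apply x y

lemma refl_refl (x : Ambient n) : refl S n (refl S n x) = x := by
  cases S
  · simp [refl]
  · simp [refl]
  · simp [refl]
    module

/-- The `bil`-gradient represents the differential. -/
lemma bil_refl_gradient (f : Ambient n → ℝ) (y Z : Ambient n) :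
    bil S (refl S n ((InnerProductSpace.toDual ℝ (Ambient n)).symm (fderiv ℝ f y))) Z =
      fderiv ℝ f y Z := by
  simp only [bil, ContinuousLinearMap.comp_apply, refl_refl, innerSL_apply_apply]
  simp

/-- The factor `curv S` makes one identity serve all models: in the Euclidean model `bil S p p` is
not constant, but it is multiplied by zero. -/
lemma curv_mul_bil_self {p : Ambient n} (hp : p ∈ carrier S n) :
    curv S * bil S p p = curv S ^ 2 := by
  cases S
  · simp [curv]
  · have : bil spherical p p = 1 := by rw [bil_apply]; exact hp
    simp [curv, this]
  · have : bil hyperbolic p p = -1 := by rw [bil_apply]; exact hp.1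
    simp [curv, this]

lemma curv_mul_bil_eq_zero {p X : Ambient n} (h : rad S p X = 0) : curv S * bil S p X = 0 := by
  cases S
  · simp [curv]
  · simp [curv]; exact h
  · simp [curv]; exact h

lemma rad_self_ne_zero {p : Ambient n} (hp : p ∈ carrier S n) : rad S p p ≠ 0 := by
  cases S
  · have : p 0 = 1 := hp
    simp [rad, this]
  · have : bil spherical p p = 1 := by rw [bil_apply]; exact hp
    simp [rad, this]
  · have : bil hyperbolic p p = -1 := by rw [bil_apply]; exact hp.1
    simp [rad, this]

/-- On the two quadrics `bil p (x - p) = -bil (x - p) (x - p) / 2`, so the added multiple of `p`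
removes exactly the normal part of the chord. -/
lemma rad_sub_add {x p : Ambient n} (hx : x ∈ carrier S n) (hp : p ∈ carrier S n) :
    rad S p (x - p + (curv S * (bil S (x - p) (x - p) / 2)) • p) = 0 := by
  cases S
  · have h1 : x 0 = 1 := hx
    have h2 : p 0 = 1 := hp
    simp [rad, curv, h1, h2]
  · have h1 : bil spherical x x = 1 := by rw [bil_apply]; exact hx
    have h2 : bil spherical p p = 1 := by rw [bil_apply]; exact hp
    simp [rad, curv, h1, h2, bil_symm x p]
    ring
  · have h1 : bil hyperbolic x x = -1 := by rw [bil_apply]; exact hx.1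
    have h2 : bil hyperbolic p p = -1 := by rw [bil_apply]; exact hp.1
    simp [rad, curv, h1, h2, bil_symm x p]
    ring

/-- Vectors `bil`-orthogonal to a future timelike vector are spacelike. -/
lemma bil_self_pos_of_timelike {p X : Ambient n} (hp : bil hyperbolic p p < 0)
    (h : bil hyperbolic p X = 0) (hX : X ≠ 0) : 0 < bil hyperbolic X X := by
  rw [bil_hyperbolic] at *
  have hcs := Finset.sum_mul_sq_le_sq_mul_sq Finset.univ (fun i : Fin (n + 1) => p i.succ)
    (fun i => X i.succ)
  have e1 : ∑ i : Fin (n + 1), p i.succ * X i.succ = p 0 * X 0 := by linarith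
  rw [e1] at hcs
  simp only [← sq] at *
  set a := ∑ i : Fin (n + 1), p i.succ ^ 2
  set b := ∑ i : Fin (n + 1), X i.succ ^ 2 with hb
  have ha0 : 0 ≤ a := Finset.sum_nonneg fun i _ => sq_nonneg _
  have hb0 : 0 ≤ b := Finset.sum_nonneg fun i _ => sq_nonneg _
  rcases hb0.eq_or_lt with h0 | h0
  · exfalso
    apply hX
    have hz : ∀ i : Fin (n + 1), X i.succ = 0 := by
      intro i
      have := (Finset.sum_eq_zero_iff_of_nonneg (fun i _ => sq_nonneg (X (Fin.succ i)))).1 h0.symm i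
        (Finset.mem_univ _)
      simpa using this
    have hp0 : p 0 ≠ 0 := by
      intro h3
      rw [h3] at hp
      nlinarith
    have : X 0 = 0 := by
      have h4 : p 0 * X 0 = 0 := by rw [← e1]; simp [hz]
      exact (mul_eq_zero.1 h4).resolve_left hp0
    ext i
    refine Fin.cases ?_ ?_ i
    · simpa using this
    · intro j; simpa using hz j
  · have hpp : 0 < p 0 ^ 2 := by nlinarith
    have : p 0 ^ 2 * X 0 ^ 2 < p 0 ^ 2 * b := by nlinarith
    have := lt_of_mul_lt_mul_left this hpp.le
    linarith

lemma bil_self_pos {p X : Ambient n} (hp : p ∈ carrier S n) (h : rad S p X = 0) (hX : X ≠ 0) :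
    0 < bil S X X := by
  cases S
  · rw [bil_euclidean]; exact real_inner_self_pos.2 hX
  · rw [bil_spherical]; exact real_inner_self_pos.2 hX
  · exact bil_self_pos_of_timelike (by rw [bil_apply, hp.1]; norm_num) h hX

/-- Two future timelike vectors have negative `bil`-product. -/
lemma bil_neg_of_timelike {p q : Ambient n} (hp : bil hyperbolic p p < 0) (hp0 : 0 < p 0)
    (hq : bil hyperbolic q q < 0) (hq0 : 0 < q 0) : bil hyperbolic p q < 0 := by
  rw [bil_hyperbolic] at *
  have hcs := Finset.sum_mul_sq_le_sq_mul_sq Finset.univ (fun i : Fin (n + 1) => p i.succ)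
    (fun i => q i.succ)
  simp only [← sq] at hp hq
  set a := ∑ i : Fin (n + 1), p i.succ ^ 2
  set b := ∑ i : Fin (n + 1), q i.succ ^ 2
  have ha0 : 0 ≤ a := Finset.sum_nonneg fun i _ => sq_nonneg _
  have hb0 : 0 ≤ b := Finset.sum_nonneg fun i _ => sq_nonneg _
  have h1 : a * b < (p 0 * q 0) ^ 2 := by nlinarith
  have := abs_lt_of_sq_lt_sq (lt_of_le_of_lt hcs h1) (by positivity)
  have := (abs_lt.1 this).2
  linarith

/-- Two timelike vectors with negative `bil`-product and equal square differ by a spacelike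
vector. -/
lemma bil_sub_self_pos_of_timelike {p q : Ambient n} (hp : bil hyperbolic p p < 0)
    (hpq : bil hyperbolic p q < 0) (he : bil hyperbolic p p = bil hyperbolic q q) (hne : p ≠ q) :
    0 < bil hyperbolic (p - q) (p - q) := by
  -- `p + q` is timelike and orthogonal to `p - q`
  refine bil_self_pos_of_timelike (p := p + q) ?_ ?_ (sub_ne_zero.2 hne)
  · simp [bil_symm q p]; linarith
  · simp [bil_symm q p]; linarith

lemma bil_sub_self_pos {p q : Ambient n} (hp : p ∈ carrier S n) (hq : q ∈ carrier S n)
    (hne : p ≠ q) : 0 < bil S (p - q) (p - q) := by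
  have hne' := sub_ne_zero.2 hne
  cases S
  · rw [bil_euclidean]; exact real_inner_self_pos.2 hne'
  · rw [bil_spherical]; exact real_inner_self_pos.2 hne'
  · have h1 : bil hyperbolic p p = -1 := by rw [bil_apply]; exact hp.1
    have h2 : bil hyperbolic q q = -1 := by rw [bil_apply]; exact hq.1
    exact bil_sub_self_pos_of_timelike (by linarith)
      (bil_neg_of_timelike (by linarith) hp.2 (by linarith) hq.2) (by linarith) hne

lemma basePoint_mem : basePoint n ∈ carrier S n := by
  cases S
  · simp [carrier]
  · simp only [carrier, mem_ofPred_eq, form_eq, bil_spherical, real_inner_self_eq_norm_sq]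
    simp [basePoint]
  · simp [carrier, form]

/-- Two linear conditions in dimension `n + 2 ≥ 3`; this is where `1 ≤ n` gives the boundary a
tangent direction. -/
lemma exists_tangent_ne_zero (hn : 1 ≤ n) (p ν : Ambient n) :
    ∃ X : Ambient n, X ≠ 0 ∧ rad S p X = 0 ∧ bil S ν X = 0 := by
  let L : Ambient n →ₗ[ℝ] ℝ × ℝ := (rad S p : Ambient n →ₗ[ℝ] ℝ).prod (bil S ν : Ambient n →ₗ[ℝ] ℝ)
  have : LinearMap.ker L ≠ ⊥ := by
    apply LinearMap.ker_ne_bot_of_finrank_lt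
    simp
    omega
  obtain ⟨X, hX, h0⟩ := Submodule.exists_mem_ne_zero_of_ne_bot this
  have h1 : L X = 0 := hX
  exact ⟨X, h0, congrArg Prod.fst h1, congrArg Prod.snd h1⟩

lemma hasDerivAt_bil {f g : ℝ → Ambient n} {f' g' : Ambient n} {t : ℝ} (hf : HasDerivAt f f' t)
    (hg : HasDerivAt g g' t) :
    HasDerivAt (fun s => bil S (f s) (g s)) (bil S f' (g t) + bil S (f t) g') t := by
  have h1 : HasDerivAt (fun s => bil S (f s)) (bil S f') t := (bil S).hasFDerivAt.comp_hasDerivAt t hf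
  simpa using h1.clm_apply hg

end SpaceForm

/-! ### Projection onto the model, curves and tangent vectors. -/

namespace SpaceForm

/-- The domain of the central projection onto the model. -/
def domain (S : SpaceForm) (n : ℕ) : Set (Ambient n) :=
  match S with
  | euclidean => univ
  | spherical => {y | 0 < bil spherical y y}
  | hyperbolic => {y | bil hyperbolic y y < 0 ∧ 0 < y 0}

/-- The projection of the ambient space onto the model: vertical in the Euclidean case, central in
the two other cases. -/
noncomputable def ambProj (S : SpaceForm) {n : ℕ} (y : Ambient n) : Ambient n :=
  match S with
  | euclidean => y + (1 - y 0) • basePoint n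
  | spherical => (√(bil spherical y y))⁻¹ • y
  | hyperbolic => (√(-bil hyperbolic y y))⁻¹ • y

variable {S : SpaceForm} {n : ℕ}

lemma isOpen_domain : IsOpen (domain S n) := by
  have hc : ∀ S, Continuous fun y : Ambient n => bil S y y := fun S => by fun_prop
  cases S
  · exact isOpen_univ
  · exact isOpen_lt continuous_const (hc _)
  · exact (isOpen_lt (hc _) continuous_const).inter (isOpen_lt continuous_const
      (EuclideanSpace.proj (𝕜 := ℝ) (0 : Fin (n + 2))).continuous)

lemma carrier_subset_domain : carrier S n ⊆ domain S n := by
  intro p hp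
  cases S
  · trivial
  · have : bil spherical p p = 1 := by rw [bil_apply]; exact hp
    show 0 < bil spherical p p
    rw [this]; norm_num
  · have : bil hyperbolic p p = -1 := by rw [bil_apply]; exact hp.1
    exact ⟨by rw [this]; norm_num, hp.2⟩

lemma ambProj_mem {y : Ambient n} (hy : y ∈ domain S n) : ambProj S y ∈ carrier S n := by
  cases S
  · simp [ambProj, carrier]
  · have hy' : 0 < bil spherical y y := hy
    have h1 := Real.sqrt_ne_zero'.2 hy'
    show form spherical _ _ = 1
    rw [form_eq]
    simp [ambProj]
    field_simp
    rw [Real.sq_sqrt hy'.le]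
  · have hy' : 0 < -bil hyperbolic y y := by have := hy.1; linarith
    have h1 := Real.sqrt_ne_zero'.2 hy'
    refine ⟨?_, ?_⟩
    · rw [form_eq]
      simp [ambProj]
      field_simp
      rw [Real.sq_sqrt hy'.le]
      ring
    · simp only [ambProj, PiLp.smul_apply, smul_eq_mul]
      exact mul_pos (inv_pos.2 (Real.sqrt_pos.2 hy')) hy.2

lemma ambProj_self {p : Ambient n} (hp : p ∈ carrier S n) : ambProj S p = p := by
  cases S
  · have : p 0 = 1 := hp
    simp [ambProj, this]
  · have : bil spherical p p = 1 := by rw [bil_apply]; exact hp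
    simp [ambProj, this]
  · have : bil hyperbolic p p = -1 := by rw [bil_apply]; exact hp.1
    simp [ambProj, this]

lemma contDiffAt_ambProj {y : Ambient n} (hy : y ∈ domain S n) {k : WithTop ℕ∞} :
    ContDiffAt ℝ k (ambProj S) y := by
  have hc : ∀ S, ContDiff ℝ k fun y : Ambient n => bil S y y := fun S => by fun_prop
  cases S
  · show ContDiffAt ℝ k (fun y : Ambient n => y + (1 - y 0) • basePoint n) y
    fun_prop
  · have hy' : 0 < bil spherical y y := hy
    exact (((hc spherical).contDiffAt.sqrt hy'.ne').inv (Real.sqrt_ne_zero'.2 hy')).smul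
      contDiffAt_id
  · have hy' : 0 < -bil hyperbolic y y := by have := hy.1; linarith
    exact (((hc hyperbolic).neg.contDiffAt.sqrt hy'.ne').inv (Real.sqrt_ne_zero'.2 hy')).smul
      contDiffAt_id

/-- The kernel of the differential of the projection at `p` is spanned by `axis S p`. -/
noncomputable def axis (S : SpaceForm) {n : ℕ} (p : Ambient n) : Ambient n :=
  match S with
  | euclidean => basePoint n
  | spherical => p
  | hyperbolic => p

lemma rad_axis_ne_zero {p : Ambient n} (hp : p ∈ carrier S n) : rad S p (axis S p) ≠ 0 := by
  cases S
  · simp [rad, axis]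
  · exact rad_self_ne_zero hp
  · exact rad_self_ne_zero hp

lemma rad_eq_zero_iff_bil_axis {p N : Ambient n} : rad S p N = 0 ↔ bil S N (axis S p) = 0 := by
  cases S
  · have h : bil euclidean N (basePoint n) = N 0 := by
      rw [bil_euclidean, inner_ambient, Fin.sum_univ_succ]; simp
    simp only [axis, h]; rfl
  · rw [bil_symm]; rfl
  · rw [bil_symm]; rfl

lemma hasDerivAt_line (p Z : Ambient n) (t : ℝ) : HasDerivAt (fun t : ℝ => p + t • Z) Z t := by
  simpa using ((hasDerivAt_id t).smul_const Z).const_add p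

/-- The differential of the projection at a point of the model is the linear projection onto the
tangent space along `axis`. -/
lemma hasDerivAt_ambProj_line {p : Ambient n} (hp : p ∈ carrier S n) (Z : Ambient n) :
    ∃ s : ℝ, HasDerivAt (fun t : ℝ => ambProj S (p + t • Z)) (Z - s • axis S p) 0 ∧
      rad S p (Z - s • axis S p) = 0 := by
  have hl := hasDerivAt_line p Z 0
  have hb : ∀ S, HasDerivAt (fun t : ℝ => bil S (p + t • Z) (p + t • Z)) (2 * bil S p Z) 0 := by
    intro S
    convert hasDerivAt_bil (S := S) hl hl using 1
    simp [bil_symm Z p]; ring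
  cases S
  · refine ⟨Z 0, ?_, by simp [rad, axis]⟩
    have h0 : HasDerivAt (fun t : ℝ => (p + t • Z) 0) (Z 0) 0 :=
      (EuclideanSpace.proj (𝕜 := ℝ) (0 : Fin (n + 2))).hasFDerivAt.comp_hasDerivAt 0 hl
    refine (hl.add ((h0.const_sub 1).smul_const (basePoint n))).congr_deriv ?_
    simp only [axis]
    module
  · have h1 : bil spherical p p = 1 := by rw [bil_apply]; exact hp
    refine ⟨bil spherical p Z, ?_, by simp [rad, axis, h1]⟩
    have hs := ((hb spherical).sqrt (by simp [h1])).inv (by simp [h1])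
    refine (hs.smul hl).congr_deriv ?_
    simp [h1, axis]
    module
  · have h1 : bil hyperbolic p p = -1 := by rw [bil_apply]; exact hp.1
    refine ⟨-bil hyperbolic p Z, ?_, by simp [rad, axis, h1]⟩
    have hs := ((hb hyperbolic).neg.sqrt (by simp [h1])).inv (by simp [h1])
    refine (hs.smul hl).congr_deriv ?_
    simp [h1, axis, neg_div]

lemma exists_fderiv_ambProj_eq {p : Ambient n} (hp : p ∈ carrier S n) (Z : Ambient n) :
    ∃ s : ℝ, fderiv ℝ (ambProj S) p Z = Z - s • axis S p ∧ rad S p (Z - s • axis S p) = 0 := by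
  obtain ⟨s, h1, h2⟩ := hasDerivAt_ambProj_line hp Z
  have hd := ((contDiffAt_ambProj (carrier_subset_domain hp) (k := 1)).differentiableAt
    one_ne_zero).hasFDerivAt
  exact ⟨s, (HasFDerivAt.comp_hasDerivAt_of_eq 0 hd (hasDerivAt_line p Z 0) (by simp)).unique h1,
    h2⟩

lemma rad_fderiv_ambProj {p : Ambient n} (hp : p ∈ carrier S n) (Z : Ambient n) :
    rad S p (fderiv ℝ (ambProj S) p Z) = 0 := by
  obtain ⟨s, h1, h2⟩ := exists_fderiv_ambProj_eq hp Z
  rw [h1, h2]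

lemma fderiv_ambProj_of_rad_eq_zero {p Z : Ambient n} (hp : p ∈ carrier S n)
    (hZ : rad S p Z = 0) : fderiv ℝ (ambProj S) p Z = Z := by
  obtain ⟨s, h1, h2⟩ := exists_fderiv_ambProj_eq hp Z
  rw [map_sub, hZ, map_smul, zero_sub, neg_eq_zero, smul_eq_mul] at h2
  rw [h1, (mul_eq_zero.1 h2).resolve_right (rad_axis_ne_zero hp), zero_smul, sub_zero]

/-- A vector which only pairs with tangential parts is tangent. -/
lemma rad_eq_zero_of_forall_bil {p N : Ambient n} (hp : p ∈ carrier S n)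
    (h : ∀ Z, bil S N (fderiv ℝ (ambProj S) p Z) = bil S N Z) : rad S p N = 0 := by
  obtain ⟨s, h1, h2⟩ := exists_fderiv_ambProj_eq hp (axis S p)
  rw [map_sub, map_smul, smul_eq_mul] at h2
  have h3 : (1 - s) * rad S p (axis S p) = 0 := by linarith
  have h4 : s = 1 := by
    have := (mul_eq_zero.1 h3).resolve_right (rad_axis_ne_zero hp)
    linarith
  have h5 := h (axis S p)
  rw [h1, h4, one_smul, sub_self, map_zero] at h5
  exact rad_eq_zero_iff_bil_axis.2 h5.symm

open Classical in
/-- The projection as a map to the model. -/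
noncomputable def proj (S : SpaceForm) {n : ℕ} (y : Ambient n) : Space S n :=
  if h : ambProj S y ∈ carrier S n then ⟨ambProj S y, h⟩ else ⟨basePoint n, basePoint_mem⟩

lemma coe_proj {y : Ambient n} (hy : y ∈ domain S n) : (proj S y : Ambient n) = ambProj S y := by
  simp [proj, ambProj_mem hy]

lemma coe_mem_domain (p : Space S n) : (p : Ambient n) ∈ domain S n := carrier_subset_domain p.2

lemma proj_coe (p : Space S n) : proj S (p : Ambient n) = p :=
  Subtype.ext (by rw [coe_proj (coe_mem_domain p), ambProj_self p.2])

lemma continuousAt_proj {y : Ambient n} (hy : y ∈ domain S n) : ContinuousAt (proj S) y := by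
  rw [Topology.IsInducing.subtypeVal.continuousAt_iff]
  refine (contDiffAt_ambProj hy (k := 0)).continuousAt.congr ?_
  filter_upwards [isOpen_domain.mem_nhds hy] with z hz
  exact (coe_proj hz).symm

lemma eventually_domain (p : Space S n) : ∀ᶠ z in 𝓝 (p : Ambient n), z ∈ domain S n :=
  isOpen_domain.mem_nhds (coe_mem_domain p)

lemma tendsto_proj (p : Space S n) : Tendsto (proj S) (𝓝 (p : Ambient n)) (𝓝 p) := by
  have := continuousAt_proj (coe_mem_domain p)
  rwa [ContinuousAt, proj_coe] at this

lemma hasDerivAt_coe_proj {γ : ℝ → Ambient n} {X : Ambient n} {t : ℝ} {p : Space S n}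
    (hγ : HasDerivAt γ X t) (hp : γ t = p) (hX : rad S (p : Ambient n) X = 0) :
    HasDerivAt (fun s => (proj S (γ s) : Ambient n)) X t := by
  have hd := ((contDiffAt_ambProj (coe_mem_domain p) (k := 1)).differentiableAt
    one_ne_zero).hasFDerivAt
  have h := HasFDerivAt.comp_hasDerivAt_of_eq t hd hγ hp.symm
  rw [fderiv_ambProj_of_rad_eq_zero p.2 hX] at h
  refine h.congr_of_eventuallyEq ?_
  have h2 : ∀ᶠ z in 𝓝 (γ t), z ∈ domain S n := by rw [hp]; exact eventually_domain p
  filter_upwards [hγ.continuousAt.eventually h2] with s hs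
  exact coe_proj hs

/-- The velocity of a curve in the model is tangent to it. -/
lemma rad_deriv_eq_zero {γ : ℝ → Space S n} {X : Ambient n} {t : ℝ}
    (hγ : HasDerivAt (fun s => (γ s : Ambient n)) X t) : rad S (γ t : Ambient n) X = 0 := by
  have hd := ((contDiffAt_ambProj (coe_mem_domain (γ t)) (k := 1)).differentiableAt
    one_ne_zero).hasFDerivAt
  have h := hd.comp_hasDerivAt t hγ
  have h2 : (ambProj S ∘ fun s => (γ s : Ambient n)) = fun s => (γ s : Ambient n) := by
    funext s; exact ambProj_self (γ s).2
  rw [h2] at h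
  rw [hγ.unique h]
  exact rad_fderiv_ambProj (γ t).2 X

lemma isTangent_univ_iff {p : Space S n} {X : Ambient n} :
    IsTangent univ p X ↔ rad S (p : Ambient n) X = 0 := by
  constructor
  · rintro ⟨γ, h0, h1, -⟩
    rw [← h0]
    exact rad_deriv_eq_zero h1
  · intro h
    have hl := hasDerivAt_line (p : Ambient n) X 0
    exact ⟨fun t => proj S (p + t • X), by simp [proj_coe],
      hasDerivAt_coe_proj hl (by simp) h, by simp⟩

/-- The domain is the whole space, a punctured space or a convex cone. The model is its image, hence
connected, which later guarantees that a nonempty proper `K` has a boundary point. -/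
lemma isPreconnected_domain : IsPreconnected (domain S n) := by
  cases S
  · exact isPreconnected_univ
  · have h : domain spherical n = {0}ᶜ := by
      ext y
      show 0 < bil spherical y y ↔ _
      rw [bil_spherical, real_inner_self_pos]; rfl
    rw [h]
    refine (isConnected_compl_singleton_of_one_lt_rank ?_ 0).isPreconnected
    rw [← Module.finrank_eq_rank]
    simp
    norm_cast; omega
  · apply Convex.isPreconnected
    rintro x ⟨hx, hx0⟩ y ⟨hy, hy0⟩ a b ha hb hab
    have h := bil_neg_of_timelike hx hx0 hy hy0
    rcases ha.eq_or_lt with rfl | ha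
    · obtain rfl : b = 1 := by linarith
      simpa using ⟨hy, hy0⟩
    · refine ⟨?_, ?_⟩
      · simp [bil_symm y x]
        nlinarith [mul_pos ha ha, mul_nonneg hb hb, mul_nonneg ha.le hb]
      · simp
        have := mul_pos ha hx0
        have := mul_nonneg hb hy0.le
        linarith

instance : PreconnectedSpace (Space S n) := by
  have h : proj S '' domain S n = univ := by
    refine eq_univ_of_forall fun p => ⟨p, coe_mem_domain p, proj_coe p⟩
  exact ⟨h ▸ isPreconnected_domain.image _ fun y hy => (continuousAt_proj hy).continuousWithinAt⟩

end SpaceForm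

/-! ### Straightening a level set. -/

/-- A function with nonzero differential becomes affine in suitable coordinates. -/
lemma exists_straightening {E : Type*} [NormedAddCommGroup E] [NormedSpace ℝ E] [CompleteSpace E]
    {F : E → ℝ} {p : E} {k : WithTop ℕ∞} (hF : ContDiffAt ℝ k F p) (hk : k ≠ 0)
    (hd : fderiv ℝ F p ≠ 0) :
    ∃ Φ Ψ : E → E, Φ p = p ∧ ContinuousAt Φ p ∧ Ψ p = p ∧ ContDiffAt ℝ k Ψ p ∧
      HasFDerivAt Ψ (ContinuousLinearMap.id ℝ E) p ∧
      (∀ᶠ z in 𝓝 p, F (Ψ z) - F p = fderiv ℝ F p (z - p)) ∧ ∀ᶠ y in 𝓝 p, Ψ (Φ y) = y := by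
  obtain ⟨v₀, hv₀⟩ : ∃ v, fderiv ℝ F p v ≠ 0 := by
    by_contra! h
    exact hd (ContinuousLinearMap.ext h)
  set l := fderiv ℝ F p with hl
  set v := (l v₀)⁻¹ • v₀ with hv
  have hlv : l v = 1 := by simp [hv, hv₀]
  -- The correction along `v` turns `l (Φ y - p)` into `F y - F p`, because `l v = 1`. It vanishes
  -- to first order at `p`, so the differential of `Φ` there is the identity.
  set Φ : E → E := fun y => y + (F y - F p - l (y - p)) • v with hΦ
  have hΦp : Φ p = p := by simp [hΦ]
  have hΦc : ContDiffAt ℝ k Φ p := by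
    have : ContDiffAt ℝ k (fun y => l (y - p)) p := by fun_prop
    exact contDiffAt_id.add (((hF.sub contDiffAt_const).sub this).smul contDiffAt_const)
  have hΦd : HasFDerivAt Φ ((ContinuousLinearEquiv.refl ℝ E : E ≃L[ℝ] E) : E →L[ℝ] E) p := by
    have h1 : HasFDerivAt F l p := (hF.differentiableAt hk).hasFDerivAt
    have h2 : HasFDerivAt (fun y => l (y - p)) l p := by
      exact l.hasFDerivAt.comp p ((hasFDerivAt_id p).sub_const p)
    have h3 := (hasFDerivAt_id p).add (((h1.sub_const (F p)).sub h2).smul_const v)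
    refine h3.congr_fderiv ?_
    ext x
    simp
  set e := hΦc.toOpenPartialHomeomorph Φ hΦd hk with he
  have hpe : p ∈ e.source := hΦc.mem_toOpenPartialHomeomorph_source hΦd hk
  have hcoe : ∀ y, e y = Φ y := fun y => rfl
  have hpt : p ∈ e.target := by
    have := e.map_source hpe
    rwa [hcoe, hΦp] at this
  have hsymm : e.symm p = p := by
    have := e.left_inv hpe
    rwa [hcoe, hΦp] at this
  have hinv : ContDiffAt ℝ k e.symm p := by
    have := hΦc.to_localInverse hΦd hk
    rwa [hΦp] at this
  refine ⟨Φ, e.symm, hΦp, hΦc.continuousAt, hsymm, hinv, ?_, ?_, ?_⟩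
  · have h1 := e.hasFDerivAt_symm (f' := ContinuousLinearEquiv.refl ℝ E) hpt
      (by rw [hsymm]; exact hΦd)
    exact h1
  · filter_upwards [e.open_target.mem_nhds hpt] with z hz
    have h1 : Φ (e.symm z) = z := e.right_inv hz
    have h2 : l (Φ (e.symm z) - p) = F (e.symm z) - F p := by
      simp only [hΦ, map_sub, map_add, map_smul, hlv, smul_eq_mul]
      ring
    rw [← h2, h1]
  · filter_upwards [e.open_source.mem_nhds hpe] with y hy
    exact e.left_inv hy

namespace SpaceForm

variable {S : SpaceForm} {n : ℕ}

/-! ### Local defining functions of the boundary. -/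

/-- Near `p`, `F` defines the hypersurface `frontier K`; it is constant along the fibres of the
projection. -/
structure IsFrontierFun (K : Set (Space S n)) (p : Space S n) (F : Ambient n → ℝ) : Prop where
  contDiffAt : ContDiffAt ℝ 2 F p
  fderiv_ne : fderiv ℝ F (p : Ambient n) ≠ 0
  comp_ambProj : ∀ᶠ z in 𝓝 (p : Ambient n), F (ambProj S z) = F z
  frontier_iff : ∀ᶠ z in 𝓝 (p : Ambient n), proj S z ∈ frontier K ↔ F z = 0

/-- Near `p`, `K` is the set where `F` is nonnegative, and `F` defines the hypersurface
`frontier K`. -/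
structure IsDefFun (K : Set (Space S n)) (p : Space S n) (F : Ambient n → ℝ) : Prop extends
    IsFrontierFun K p F where
  mem_iff : ∀ᶠ z in 𝓝 (p : Ambient n), proj S z ∈ K ↔ 0 ≤ F z

lemma ambProj_ambProj {z : Ambient n} (hz : z ∈ domain S n) :
    ambProj S (ambProj S z) = ambProj S z := ambProj_self (ambProj_mem hz)

lemma ambProj_coe (p : Space S n) : ambProj S (p : Ambient n) = p := ambProj_self p.2

/-- Precomposing with the projection makes the function constant along the fibres, so that its
ambient gradient is tangent to the model and no tangential projection is needed later. -/
lemma exists_isFrontierFun {K : Set (Space S n)} (hM : IsHypersurface 2 (frontier K))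
    {p : Space S n} (hp : p ∈ frontier K) : ∃ F, IsFrontierFun K p F := by
  obtain ⟨f, hf, hfr, X, hX, hfX⟩ := hM p hp
  have hfp : ContDiffAt ℝ 2 f (ambProj S p) := by rwa [ambProj_coe]
  refine ⟨fun z => f (ambProj S z), hfp.comp _ (contDiffAt_ambProj (coe_mem_domain p)), ?_, ?_, ?_⟩
  · intro h0
    apply hfX
    have h1 := (hfp.differentiableAt two_ne_zero).hasFDerivAt.comp (p : Ambient n)
      ((contDiffAt_ambProj (coe_mem_domain p) (k := 1)).differentiableAt one_ne_zero).hasFDerivAt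
    have h2 := congrArg (fun L => L X) (h1.fderiv.symm.trans h0)
    simpa [fderiv_ambProj_of_rad_eq_zero p.2 (isTangent_univ_iff.1 hX), ambProj_coe] using h2
  · filter_upwards [eventually_domain p] with z hz
    rw [ambProj_ambProj hz]
  · filter_upwards [eventually_domain p, (tendsto_proj p).eventually hfr] with z hz h1
    rw [h1, coe_proj hz]

lemma IsFrontierFun.apply_eq_zero {K : Set (Space S n)} {p : Space S n} {F : Ambient n → ℝ}
    (h : IsFrontierFun K p F) (hp : p ∈ frontier K) : F p = 0 := by
  have := h.frontier_iff.self_of_nhds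
  rw [proj_coe] at this
  exact this.1 hp

lemma exists_mem_frontier_of_isPreconnected {X : Type*} [TopologicalSpace X] {s K : Set X}
    (hs : IsPreconnected s) {x y : X} (hx : x ∈ s) (hxK : x ∈ K) (hy : y ∈ s) (hyK : y ∉ K) :
    ∃ z ∈ s, z ∈ frontier K := by
  by_contra! h
  obtain ⟨z, -, hz1, hz2⟩ := hs (interior K) (closure K)ᶜ isOpen_interior
    isClosed_closure.isOpen_compl
    (fun z hz => by
      by_contra hcon
      rw [mem_union, not_or] at hcon
      exact h z hz ⟨not_not.1 hcon.2, hcon.1⟩)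
    ⟨x, hx, by_contra fun h1 => h x hx ⟨subset_closure hxK, h1⟩⟩
    ⟨y, hy, fun h1 => h y hy ⟨h1, fun h2 => hyK (interior_subset h2)⟩⟩
  exact hz2 (subset_closure (interior_subset hz1))

/-- A closed set bounded by a hypersurface is locally one of the sides of the hypersurface, or the
hypersurface itself. -/
lemma IsFrontierFun.isDefFun_or {K : Set (Space S n)} (hK : IsClosed K) {p : Space S n}
    (hp : p ∈ frontier K) {F : Ambient n → ℝ} (hF : IsFrontierFun K p F) :
    (∃ G, IsDefFun K p G) ∨ ∀ᶠ z in 𝓝 (p : Ambient n), proj S z ∈ K → F z = 0 := by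
  have hF0 := hF.apply_eq_zero hp
  obtain ⟨Φ, Ψ, hΦp, hΦ, hΨp, hΨ, -, hFΨ, hΨΦ⟩ :=
    exists_straightening hF.contDiffAt two_ne_zero hF.fderiv_ne
  set l := fderiv ℝ F p
  have hΨt : Tendsto Ψ (𝓝 (p : Ambient n)) (𝓝 (p : Ambient n)) := by
    have := hΨ.continuousAt
    rwa [ContinuousAt, hΨp] at this
  have hΦt : Tendsto Φ (𝓝 (p : Ambient n)) (𝓝 (p : Ambient n)) := by
    rwa [ContinuousAt, hΦp] at hΦ
  have hcont : ∀ᶠ z in 𝓝 (p : Ambient n), ContinuousAt Ψ z :=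
    (hΨ.eventually (by simp)).mono fun z hz => hz.continuousAt
  obtain ⟨r, hr, hball⟩ := Metric.eventually_nhds_iff_ball.1
    ((hFΨ.and (hΨt.eventually hF.frontier_iff)).and
      (hcont.and (hΨt.eventually (eventually_domain p))))
  -- A convex set avoiding the straightened hypersurface has a connected image that misses the
  -- frontier, so it lies entirely in `K` or entirely outside.
  have hside : ∀ s : Set (Ambient n), Convex ℝ s → s ⊆ Metric.ball (p : Ambient n) r →
      (∀ z ∈ s, l (z - p) ≠ 0) → (∀ z ∈ s, proj S (Ψ z) ∈ K) ∨ ∀ z ∈ s, proj S (Ψ z) ∉ K := by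
    intro s hs hsr hne
    have hpre : IsPreconnected ((fun z => proj S (Ψ z)) '' s) := by
      refine hs.isPreconnected.image _ fun z hz => ?_
      obtain ⟨-, h1, h2⟩ := hball z (hsr hz)
      exact (ContinuousAt.comp (continuousAt_proj h2) h1).continuousWithinAt
    by_contra! hcon
    obtain ⟨⟨z1, hz1, h1⟩, z2, hz2, h2⟩ := hcon
    obtain ⟨x, ⟨z, hz, rfl⟩, hx⟩ := exists_mem_frontier_of_isPreconnected hpre
      ⟨z2, hz2, rfl⟩ h2 ⟨z1, hz1, rfl⟩ h1
    obtain ⟨⟨h3, h4⟩, -⟩ := hball z (hsr hz)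
    have h5 := h4.1 hx
    rw [h5, hF0, sub_zero] at h3
    exact hne z hz h3.symm
  have hlin : IsLinearMap ℝ l := l.toLinearMap.isLinear
  have hconv1 : Convex ℝ (Metric.ball (p : Ambient n) r ∩ {z | l p < l z}) :=
    (convex_ball _ _).inter (convex_halfSpace_gt hlin _)
  have hconv2 : Convex ℝ (Metric.ball (p : Ambient n) r ∩ {z | l z < l p}) :=
    (convex_ball _ _).inter (convex_halfSpace_lt hlin _)
  have hpos := hside _ hconv1 inter_subset_left (fun z hz => by
    have : l p < l z := hz.2
    rw [map_sub]; exact (sub_pos.2 this).ne')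
  have hneg := hside _ hconv2 inter_subset_left (fun z hz => by
    have : l z < l p := hz.2
    rw [map_sub]; exact (sub_neg.2 this).ne)
  -- transport to neighbourhoods of `p`
  have hnear : ∀ᶠ y in 𝓝 (p : Ambient n), Φ y ∈ Metric.ball (p : Ambient n) r ∧ Ψ (Φ y) = y ∧
      F y = l (Φ y) - l p ∧ (proj S y ∈ frontier K ↔ F y = 0) := by
    filter_upwards [hΦt.eventually (Metric.ball_mem_nhds _ hr), hΨΦ, hF.frontier_iff]
      with y h1 h2 h3
    refine ⟨h1, h2, ?_, h3⟩
    have := (hball _ h1).1.1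
    rw [h2, hF0, sub_zero, map_sub] at this
    exact this
  -- Both half balls in `K` would make `p` interior; exactly one in `K` gives a defining function,
  -- up to sign; neither leaves only the hypersurface.
  rcases hpos with hpos | hpos <;> rcases hneg with hneg | hneg
  · exfalso
    have hall : ∀ᶠ y in 𝓝 (p : Ambient n), proj S y ∈ K := by
      filter_upwards [hnear] with y ⟨h1, h2, h3, h4⟩
      rcases lt_trichotomy (F y) 0 with h | h | h
      · rw [← h2]; exact hneg _ ⟨h1, show l (Φ y) < l p by linarith⟩
      · exact hK.frontier_subset (h4.2 h)
      · rw [← h2]; exact hpos _ ⟨h1, show l p < l (Φ y) by linarith⟩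
    have h5 : ∀ᶠ x : Space S n in 𝓝 p, x ∈ K := by
      filter_upwards [continuous_subtype_val.continuousAt.eventually hall] with x hx
      rwa [proj_coe] at hx
    exact hp.2 (mem_interior_iff_mem_nhds.2 h5)
  · left
    refine ⟨F, hF, ?_⟩
    filter_upwards [hnear] with y ⟨h1, h2, h3, h4⟩
    rcases lt_trichotomy (F y) 0 with h | h | h
    · have := hneg _ ⟨h1, show l (Φ y) < l p by linarith⟩
      rw [h2] at this
      simp [this, h]
    · simp [h, hK.frontier_subset (h4.2 h)]
    · have := hpos _ ⟨h1, show l p < l (Φ y) by linarith⟩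
      rw [h2] at this
      simp [this, h.le]
  · left
    refine ⟨fun z => -F z, ⟨hF.contDiffAt.neg, ?_, ?_, ?_⟩, ?_⟩
    · rw [fderiv_fun_neg]; exact neg_ne_zero.2 hF.fderiv_ne
    · filter_upwards [hF.comp_ambProj] with z hz
      rw [hz]
    · filter_upwards [hF.frontier_iff] with z hz
      rw [hz, neg_eq_zero]
    filter_upwards [hnear] with y ⟨h1, h2, h3, h4⟩
    rcases lt_trichotomy (F y) 0 with h | h | h
    · have := hneg _ ⟨h1, show l (Φ y) < l p by linarith⟩
      rw [h2] at this
      simp [this, h.le]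
    · simp [h, hK.frontier_subset (h4.2 h)]
    · have := hpos _ ⟨h1, show l p < l (Φ y) by linarith⟩
      rw [h2] at this
      simp [this, h]
  · right
    filter_upwards [hnear] with y ⟨h1, h2, h3, h4⟩ hyK
    rcases lt_trichotomy (F y) 0 with h | h | h
    · exact absurd hyK (h2 ▸ hneg _ ⟨h1, show l (Φ y) < l p by linarith⟩)
    · exact h
    · exact absurd hyK (h2 ▸ hpos _ ⟨h1, show l p < l (Φ y) by linarith⟩)

/-- If `K` were locally only the hypersurface, there would be no interior points near `p`. -/
lemma exists_isDefFun_of_mem_closure {K : Set (Space S n)} (hK : IsClosed K)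
    (hM : IsHypersurface 2 (frontier K)) {p : Space S n} (hp : p ∈ frontier K)
    (hpc : p ∈ closure (interior K)) : ∃ F, IsDefFun K p F := by
  obtain ⟨F, hF⟩ := exists_isFrontierFun hM hp
  refine (hF.isDefFun_or hK hp).resolve_right fun h => ?_
  have h1 : ∀ᶠ x : Space S n in 𝓝 p, x ∈ K → x ∈ frontier K := by
    filter_upwards [continuous_subtype_val.continuousAt.eventually (h.and hF.frontier_iff)]
      with x ⟨h1, h2⟩ hx
    rw [proj_coe] at h1 h2
    exact h2.2 (h1 hx)
  obtain ⟨x, hx, hxi⟩ := ((mem_closure_iff_frequently.1 hpc).and_eventually h1).exists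
  exact (hxi (interior_subset hx)).2 hx

lemma IsDefFun.mem_closure_interior {K : Set (Space S n)} {p : Space S n}
    (hp : p ∈ frontier K) {F : Ambient n → ℝ} (hF : IsDefFun K p F) :
    p ∈ closure (interior K) := by
  obtain ⟨v₀, hv₀⟩ : ∃ v, fderiv ℝ F p v ≠ 0 := by
    by_contra! h
    exact hF.fderiv_ne (ContinuousLinearMap.ext h)
  set v := (fderiv ℝ F p v₀)⁻¹ • v₀ with hv
  have hlv : fderiv ℝ F p v = 1 := by simp [hv, hv₀]
  have hl := hasDerivAt_line (p : Ambient n) v 0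
  have hd : HasDerivAt (fun t : ℝ => F (p + t • v)) 1 0 := by
    rw [← hlv]
    exact HasFDerivAt.comp_hasDerivAt_of_eq 0
      (hF.contDiffAt.differentiableAt two_ne_zero).hasFDerivAt hl (by simp)
  have hpos : ∀ᶠ t in 𝓝[>] (0 : ℝ), 0 < F (p + t • v) := by
    have := hd.tendsto_slope.eventually (lt_mem_nhds (zero_lt_one))
    have := this.filter_mono (nhdsWithin_mono 0 (fun t (ht : 0 < t) => ht.ne'))
    filter_upwards [this, self_mem_nhdsWithin] with t ht ht0
    have ht0' : (0 : ℝ) < t := ht0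
    rw [slope_def_field] at ht
    simp [hF.apply_eq_zero hp] at ht
    exact (div_pos_iff_of_pos_right ht0').1 ht
  have ht : Tendsto (fun t : ℝ => (p : Ambient n) + t • v) (𝓝[>] 0) (𝓝 (p : Ambient n)) := by
    have := hl.continuousAt.tendsto
    simp only [zero_smul, add_zero] at this
    exact this.mono_left nhdsWithin_le_nhds
  refine mem_closure_of_tendsto ((tendsto_proj p).comp ht) ?_
  filter_upwards [hpos, ht.eventually hF.mem_iff, ht.eventually hF.frontier_iff] with t h1 h2 h3
  rw [← self_sdiff_frontier]
  exact ⟨h2.2 h1.le, fun h => h1.ne' (h3.1 h)⟩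

lemma IsDefFun.eventually {K : Set (Space S n)} {p : Space S n} {F : Ambient n → ℝ}
    (hF : IsDefFun K p F) : ∀ᶠ x : Space S n in 𝓝 p, IsDefFun K x F := by
  have h1 : ∀ᶠ z in 𝓝 (p : Ambient n), ContDiffAt ℝ 2 F z ∧ fderiv ℝ F z ≠ 0 := by
    refine (hF.contDiffAt.eventually (by simp)).and ?_
    exact (hF.contDiffAt.fderiv_right (m := 0) (by norm_num)).continuousAt.eventually_ne
      hF.fderiv_ne
  have h2 := h1.and (hF.comp_ambProj.eventually_nhds.and
    (hF.frontier_iff.eventually_nhds.and hF.mem_iff.eventually_nhds))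
  filter_upwards [continuous_subtype_val.continuousAt.eventually h2]
    with x ⟨⟨h1, h2⟩, h3, h4, h5⟩
  exact ⟨⟨h1, h2, h3, h4⟩, h5⟩

/-- A connected closed set with nonempty interior which is bounded by a hypersurface is the closure
of its interior. -/
lemma closure_interior_eq {K : Set (Space S n)} (hK : IsClosed K) (hconn : IsConnected K)
    (hint : (interior K).Nonempty) (hM : IsHypersurface 2 (frontier K)) :
    closure (interior K) = K := by
  have hsub : closure (interior K) ⊆ K := hK.closure_interior_subset
  refine hsub.antisymm ?_
  -- points near a point of `closure (interior K)` in `K` are in this set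
  have hop : ∀ p ∈ closure (interior K), ∀ᶠ x in 𝓝 p, x ∈ K → x ∈ closure (interior K) := by
    intro p hp
    by_cases hpf : p ∈ frontier K
    · obtain ⟨F, hF⟩ := exists_isDefFun_of_mem_closure hK hM hpf hp
      filter_upwards [hF.eventually] with x hFx hxK
      by_cases hx : x ∈ frontier K
      · exact hFx.mem_closure_interior hx
      · exact subset_closure (by rw [← self_sdiff_frontier]; exact ⟨hxK, hx⟩)
    · have : p ∈ interior K := by rw [← self_sdiff_frontier]; exact ⟨hsub hp, hpf⟩
      filter_upwards [isOpen_interior.mem_nhds this] with x hx _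
      exact subset_closure hx
  have hcl : IsClopen ((↑) ⁻¹' closure (interior K) : Set K) := by
    refine ⟨isClosed_closure.preimage continuous_subtype_val, isOpen_iff_mem_nhds.2 ?_⟩
    intro x hx
    filter_upwards [continuous_subtype_val.continuousAt.eventually (hop x hx)] with y hy
    exact hy y.2
  have : PreconnectedSpace K := isPreconnected_iff_preconnectedSpace.1 hconn.isPreconnected
  obtain ⟨x, hx⟩ := hint
  have huniv := hcl.eq_univ ⟨⟨x, interior_subset hx⟩, subset_closure hx⟩
  intro y hy
  exact (huniv ▸ mem_univ (⟨y, hy⟩ : K) : (⟨y, hy⟩ : K) ∈ _)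

/-! ### Gradients and inward unit normals. -/

/-- The gradient with respect to `bil`. -/
noncomputable def grad (S : SpaceForm) {n : ℕ} (F : Ambient n → ℝ) (y : Ambient n) : Ambient n :=
  refl S n ((InnerProductSpace.toDual ℝ (Ambient n)).symm (fderiv ℝ F y))

/-- The normalised gradient with respect to `bil`. -/
noncomputable def unitGrad (S : SpaceForm) {n : ℕ} (F : Ambient n → ℝ) (y : Ambient n) :
    Ambient n :=
  (√(bil S (grad S F y) (grad S F y)))⁻¹ • grad S F y

lemma bil_grad (F : Ambient n → ℝ) (y Z : Ambient n) :
    bil S (grad S F y) Z = fderiv ℝ F y Z := bil_refl_gradient F y Z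

lemma contDiffAt_grad {F : Ambient n → ℝ} {y : Ambient n} (hF : ContDiffAt ℝ 2 F y) :
    ContDiffAt ℝ 1 (grad S F) y := by
  have h1 : ContDiffAt ℝ 1 (fderiv ℝ F) y := hF.fderiv_right (by norm_num)
  exact (refl S n).contDiff.contDiffAt.comp _
    ((InnerProductSpace.toDual ℝ (Ambient n)).symm.toContinuousLinearEquiv.contDiff.contDiffAt.comp
      _ h1)

namespace IsFrontierFun

variable {K : Set (Space S n)} {p : Space S n} {F : Ambient n → ℝ}

lemma eventually (hF : IsFrontierFun K p F) : ∀ᶠ x : Space S n in 𝓝 p, IsFrontierFun K x F := by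
  have h1 : ∀ᶠ z in 𝓝 (p : Ambient n), ContDiffAt ℝ 2 F z ∧ fderiv ℝ F z ≠ 0 := by
    refine (hF.contDiffAt.eventually (by simp)).and ?_
    exact (hF.contDiffAt.fderiv_right (m := 0) (by norm_num)).continuousAt.eventually_ne
      hF.fderiv_ne
  have h2 := h1.and (hF.comp_ambProj.eventually_nhds.and hF.frontier_iff.eventually_nhds)
  filter_upwards [continuous_subtype_val.continuousAt.eventually h2] with x ⟨⟨h1, h2⟩, h3, h4⟩
  exact ⟨h1, h2, h3, h4⟩

/-- Differentiating `F ∘ ambProj = F` at `p` shows that the gradient pairs only with tangential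
parts of vectors. -/
lemma rad_grad (hF : IsFrontierFun K p F) : rad S (p : Ambient n) (grad S F p) = 0 := by
  refine rad_eq_zero_of_forall_bil p.2 fun Z => ?_
  rw [bil_grad, bil_grad]
  have h1 := (contDiffAt_ambProj (coe_mem_domain p) (k := 1)).differentiableAt one_ne_zero
  have h2 : DifferentiableAt ℝ F (ambProj S p) := by
    rw [ambProj_coe]; exact hF.contDiffAt.differentiableAt two_ne_zero
  have h3 : (fun z => F (ambProj S z)) =ᶠ[𝓝 (p : Ambient n)] F := hF.comp_ambProj
  have h4 := h3.fderiv_eq (𝕜 := ℝ)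
  have h5 : HasFDerivAt (fun z => F (ambProj S z)) _ (p : Ambient n) :=
    h2.hasFDerivAt.comp (p : Ambient n) h1.hasFDerivAt
  rw [h5.fderiv, ambProj_coe] at h4
  exact DFunLike.congr_fun h4 Z

lemma grad_ne_zero (hF : IsFrontierFun K p F) : grad S F p ≠ 0 := by
  intro h
  apply hF.fderiv_ne
  ext Z
  rw [← bil_grad (S := S), h]
  simp

lemma bil_grad_pos (hF : IsFrontierFun K p F) :
    0 < bil S (grad S F p) (grad S F p) :=
  bil_self_pos p.2 hF.rad_grad hF.grad_ne_zero

lemma contDiffAt_unitGrad (hF : IsFrontierFun K p F) : ContDiffAt ℝ 1 (unitGrad S F) p := by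
  have h1 : ContDiffAt ℝ 1 (grad S F) p := contDiffAt_grad hF.contDiffAt
  have h2 : ContDiffAt ℝ 1 (fun y => bil S (grad S F y) (grad S F y)) p :=
    ((bil S).contDiff.contDiffAt.comp _ h1).clm_apply h1
  exact ((h2.sqrt hF.bil_grad_pos.ne').inv (Real.sqrt_ne_zero'.2 hF.bil_grad_pos)).smul h1

lemma fderiv_eq (hF : IsFrontierFun K p F) (Z : Ambient n) :
    fderiv ℝ F p Z = √(bil S (grad S F p) (grad S F p)) * bil S (unitGrad S F p) Z := by
  have := Real.sqrt_ne_zero'.2 hF.bil_grad_pos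
  rw [unitGrad, bil_smul_left, bil_grad F (p : Ambient n) Z, mul_inv_cancel_left₀ this]

lemma sqrt_pos (hF : IsFrontierFun K p F) : 0 < √(bil S (grad S F p) (grad S F p)) :=
  Real.sqrt_pos.2 hF.bil_grad_pos

lemma rad_unitGrad (hF : IsFrontierFun K p F) : rad S (p : Ambient n) (unitGrad S F p) = 0 := by
  rw [unitGrad, map_smul, hF.rad_grad, smul_zero]

lemma eventually_bil_unitGrad_self (hF : IsFrontierFun K p F) :
    ∀ᶠ y in 𝓝 (p : Ambient n), bil S (unitGrad S F y) (unitGrad S F y) = 1 := by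
  have h1 : ContDiffAt ℝ 1 (grad S F) p := contDiffAt_grad hF.contDiffAt
  have h2 : ContDiffAt ℝ 1 (fun y => bil S (grad S F y) (grad S F y)) p :=
    ((bil S).contDiff.contDiffAt.comp _ h1).clm_apply h1
  filter_upwards [h2.continuousAt.eventually (lt_mem_nhds hF.bil_grad_pos)] with y hy
  have h3 := Real.sqrt_ne_zero'.2 hy
  rw [unitGrad, bil_smul_left, bil_smul_right]
  field_simp
  rw [Real.sq_sqrt hy.le]

lemma bil_unitGrad_self (hF : IsFrontierFun K p F) :
    bil S (unitGrad S F p) (unitGrad S F p) = 1 := hF.eventually_bil_unitGrad_self.self_of_nhds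

/-- Every vector tangent to the hypersurface is the velocity of a `C²` curve in it. -/
lemma exists_curve (hF : IsFrontierFun K p F) (hp : p ∈ frontier K) {X : Ambient n}
    (hX : rad S (p : Ambient n) X = 0) (hNX : bil S (unitGrad S F p) X = 0) :
    ∃ γ : ℝ → Space S n, γ 0 = p ∧ ContDiffAt ℝ 2 (fun t => (γ t : Ambient n)) 0 ∧
      HasDerivAt (fun t => (γ t : Ambient n)) X 0 ∧ ∀ᶠ t in 𝓝 (0 : ℝ), γ t ∈ frontier K := by
  obtain ⟨Φ, Ψ, -, -, hΨp, hΨ, hΨd, hFΨ, -⟩ :=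
    exists_straightening hF.contDiffAt two_ne_zero hF.fderiv_ne
  have hl := hasDerivAt_line (p : Ambient n) X 0
  have hcl : ContDiffAt ℝ 2 (fun t : ℝ => (p : Ambient n) + t • X) 0 := by fun_prop
  have hlt : Tendsto (fun t : ℝ => (p : Ambient n) + t • X) (𝓝 0) (𝓝 (p : Ambient n)) := by
    simpa using hcl.continuousAt.tendsto
  have hΨt : Tendsto Ψ (𝓝 (p : Ambient n)) (𝓝 (p : Ambient n)) := by
    have := hΨ.continuousAt
    rwa [ContinuousAt, hΨp] at this
  have hc : ContDiffAt ℝ 2 (fun t : ℝ => Ψ (p + t • X)) 0 :=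
    ContDiffAt.comp (0 : ℝ) (by simpa using hΨ) hcl
  have hd : HasDerivAt (fun t : ℝ => Ψ (p + t • X)) X 0 :=
    HasFDerivAt.comp_hasDerivAt_of_eq 0 hΨd hl (by simp)
  have ht := hΨt.comp hlt
  refine ⟨fun t => proj S (Ψ (p + t • X)), by simp [hΨp, proj_coe], ?_,
    hasDerivAt_coe_proj hd (by simp [hΨp]) hX, ?_⟩
  · have h1 : ContDiffAt ℝ 2 (fun t : ℝ => ambProj S (Ψ (p + t • X))) 0 := by
      refine ContDiffAt.comp (g := ambProj S) (0 : ℝ) ?_ hc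
      simpa [hΨp] using contDiffAt_ambProj (coe_mem_domain p)
    refine h1.congr_of_eventuallyEq ?_
    filter_upwards [ht.eventually (eventually_domain p)] with t h2
    exact coe_proj h2
  · filter_upwards [ht.eventually hF.frontier_iff, hlt.eventually hFΨ] with t h1 h2
    refine h1.2 ?_
    rw [hF.apply_eq_zero hp, sub_zero, add_sub_cancel_left, map_smul, hF.fderiv_eq, hNX] at h2
    simpa using h2

lemma hasDerivAt_comp (hF : IsFrontierFun K p F) {γ : ℝ → Space S n} {X : Ambient n}
    (h0 : γ 0 = p) (hγ : HasDerivAt (fun t => (γ t : Ambient n)) X 0) :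
    HasDerivAt (fun t => F (γ t)) (fderiv ℝ F p X) 0 :=
  HasFDerivAt.comp_hasDerivAt_of_eq 0
      (hF.contDiffAt.differentiableAt two_ne_zero).hasFDerivAt hγ (by simp [h0])

lemma isTangent_iff (hF : IsFrontierFun K p F) (hp : p ∈ frontier K) {X : Ambient n} :
    IsTangent (frontier K) p X ↔ rad S (p : Ambient n) X = 0 ∧ bil S (unitGrad S F p) X = 0 := by
  constructor
  · rintro ⟨γ, h0, h1, h2⟩
    refine ⟨by rw [← h0]; exact rad_deriv_eq_zero h1, ?_⟩
    have h3 := hF.hasDerivAt_comp h0 h1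
    have ht : Tendsto (fun t => (γ t : Ambient n)) (𝓝 0) (𝓝 (p : Ambient n)) := by
      have := h1.continuousAt.tendsto
      rwa [h0] at this
    have h4 : (fun t => F (γ t)) =ᶠ[𝓝 0] fun _ => 0 := by
      filter_upwards [ht.eventually hF.frontier_iff, h2] with t h5 h6
      rw [proj_coe] at h5
      exact h5.1 h6
    have h5 := h3.unique ((hasDerivAt_const (0 : ℝ) (0 : ℝ)).congr_of_eventuallyEq h4)
    rw [hF.fderiv_eq] at h5
    exact (mul_eq_zero.1 h5).resolve_left hF.sqrt_pos.ne'
  · rintro ⟨h1, h2⟩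
    obtain ⟨γ, h0, -, h3, h4⟩ := hF.exists_curve hp h1 h2
    exact ⟨γ, h0, h3, h4⟩

/-- A unit vector normal to the hypersurface is `± unitGrad`. -/
lemma eq_smul_unitGrad (hF : IsFrontierFun K p F) (hp : p ∈ frontier K) {v : Ambient n}
    (hv : IsTangent univ p v) (hv2 : ∀ X, IsTangent (frontier K) p X → form S v X = 0) :
    v = bil S (unitGrad S F p) v • unitGrad S F p := by
  set c := bil S (unitGrad S F p) v
  have hv' := isTangent_univ_iff.1 hv
  set w := v - c • unitGrad S F p with hw
  have hw1 : rad S (p : Ambient n) w = 0 := by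
    rw [hw, map_sub, map_smul, hv', hF.rad_unitGrad]; simp
  have hw2 : bil S (unitGrad S F p) w = 0 := by
    rw [hw, map_sub, map_smul, hF.bil_unitGrad_self]; simp [c]
  have h3 := hv2 w ((hF.isTangent_iff hp).2 ⟨hw1, hw2⟩)
  rw [form_eq] at h3
  by_contra hne
  have h4 := bil_self_pos p.2 hw1 (sub_ne_zero.2 hne)
  have h5 : bil S w w = bil S v w - c * bil S (unitGrad S F p) w := by
    rw [← bil_smul_left, ← bil_sub_left]
  rw [h5, h3, hw2] at h4
  simp at h4

end IsFrontierFun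

/-- `v` is the inward unit normal of `K` at `p`. -/
def IsInwardUnitNormalAt (K : Set (Space S n)) (p : Space S n) (v : Ambient n) : Prop :=
  (IsTangent univ p v ∧ form S v v = 1 ∧ ∀ X, IsTangent (frontier K) p X → form S v X = 0) ∧
    ∃ γ : ℝ → Space S n, γ 0 = p ∧ HasDerivAt (fun t => (γ t : Ambient n)) v 0 ∧
      ∀ᶠ t in 𝓝[>] (0 : ℝ), γ t ∈ K

lemma isInwardUnitNormal_iff {K : Set (Space S n)} {ν : Space S n → Ambient n} :
    IsInwardUnitNormal K ν ↔ ∀ p ∈ frontier K, IsInwardUnitNormalAt K p (ν p) :=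
  ⟨fun h p hp => ⟨h.1 p hp, h.2 p hp⟩, fun h => ⟨fun p hp => (h p hp).1, fun p hp => (h p hp).2⟩⟩

lemma eventually_pos_of_hasDerivAt {f : ℝ → ℝ} {c : ℝ} (hf : HasDerivAt f c 0) (h0 : f 0 = 0)
    (hc : 0 < c) : ∀ᶠ t in 𝓝[>] (0 : ℝ), 0 < f t := by
  have := hf.tendsto_slope.eventually (lt_mem_nhds hc)
  have := this.filter_mono (nhdsWithin_mono 0 (fun t (ht : 0 < t) => ht.ne'))
  filter_upwards [this, self_mem_nhdsWithin] with t ht ht0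
  have ht0' : (0 : ℝ) < t := ht0
  rw [slope_def_field, h0, sub_zero, sub_zero] at ht
  exact (div_pos_iff_of_pos_right ht0').1 ht

namespace IsDefFun

variable {K : Set (Space S n)} {p : Space S n} {F : Ambient n → ℝ}

lemma bil_nonneg_of_curve (hF : IsDefFun K p F) (hp : p ∈ frontier K) {γ : ℝ → Space S n}
    {w : Ambient n} (h0 : γ 0 = p) (hγ : HasDerivAt (fun t => (γ t : Ambient n)) w 0)
    (hK : ∀ᶠ t in 𝓝[>] (0 : ℝ), γ t ∈ K) : 0 ≤ bil S (unitGrad S F p) w := by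
  by_contra! h
  have h1 := (hF.hasDerivAt_comp h0 hγ).neg
  have h2 : 0 < -fderiv ℝ F p w := by
    rw [hF.fderiv_eq]
    have := mul_pos hF.sqrt_pos (neg_pos.2 h)
    linarith
  have h3 := eventually_pos_of_hasDerivAt h1 (by simp [h0, hF.apply_eq_zero hp]) h2
  have ht : Tendsto (fun t => (γ t : Ambient n)) (𝓝 0) (𝓝 (p : Ambient n)) := by
    have := hγ.continuousAt.tendsto
    rwa [h0] at this
  obtain ⟨t, ⟨ht1, ht2⟩, ht3⟩ := ((h3.and hK).and
    ((ht.mono_left nhdsWithin_le_nhds).eventually hF.mem_iff)).exists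
  rw [proj_coe] at ht3
  have := ht3.1 ht2
  simp at ht1
  linarith

lemma eventually_mem_interior (hF : IsDefFun K p F) (hp : p ∈ frontier K) {γ : ℝ → Space S n}
    {w : Ambient n} (h0 : γ 0 = p) (hγ : HasDerivAt (fun t => (γ t : Ambient n)) w 0)
    (hw : 0 < bil S (unitGrad S F p) w) : ∀ᶠ t in 𝓝[>] (0 : ℝ), γ t ∈ interior K := by
  have h1 := hF.hasDerivAt_comp h0 hγ
  have h2 : 0 < fderiv ℝ F p w := by rw [hF.fderiv_eq]; exact mul_pos hF.sqrt_pos hw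
  have h3 := eventually_pos_of_hasDerivAt h1 (by simp [h0, hF.apply_eq_zero hp]) h2
  have ht : Tendsto (fun t => (γ t : Ambient n)) (𝓝[>] 0) (𝓝 (p : Ambient n)) := by
    have := hγ.continuousAt.tendsto
    rw [h0] at this
    exact this.mono_left nhdsWithin_le_nhds
  filter_upwards [h3, ht.eventually hF.mem_iff, ht.eventually hF.frontier_iff] with t h4 h5 h6
  rw [proj_coe] at h5 h6
  rw [← self_sdiff_frontier]
  exact ⟨h5.2 h4.le, fun h => h4.ne' (h6.1 h)⟩

lemma exists_curve_univ {X : Ambient n} (hX : rad S (p : Ambient n) X = 0) :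
    ∃ γ : ℝ → Space S n, γ 0 = p ∧ HasDerivAt (fun t => (γ t : Ambient n)) X 0 := by
  obtain ⟨γ, h0, h1, -⟩ := isTangent_univ_iff.2 hX
  exact ⟨γ, h0, h1⟩

lemma isInwardUnitNormalAt (hF : IsDefFun K p F) (hp : p ∈ frontier K) :
    IsInwardUnitNormalAt K p (unitGrad S F p) := by
  refine ⟨⟨isTangent_univ_iff.2 hF.rad_unitGrad, ?_, fun X hX => ?_⟩, ?_⟩
  · rw [form_eq, hF.bil_unitGrad_self]
  · rw [form_eq]; exact ((hF.isTangent_iff hp).1 hX).2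
  · obtain ⟨γ, h0, h1⟩ := exists_curve_univ hF.rad_unitGrad
    refine ⟨γ, h0, h1, ?_⟩
    have := hF.eventually_mem_interior hp h0 h1 (by rw [hF.bil_unitGrad_self]; norm_num)
    filter_upwards [this] with t ht using interior_subset ht

lemma eq_unitGrad (hF : IsDefFun K p F) (hp : p ∈ frontier K) {v : Ambient n}
    (hv : IsInwardUnitNormalAt K p v) : v = unitGrad S F p := by
  obtain ⟨⟨h1, h2, h3⟩, γ, h4, h5, h6⟩ := hv
  have h7 := hF.eq_smul_unitGrad hp h1 h3
  have h8 := hF.bil_nonneg_of_curve hp h4 h5 h6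
  set c := bil S (unitGrad S F p) v
  -- A unit normal is `±unitGrad`; the curve entering `K` gives `0 ≤ c` and so fixes the sign.
  have h9 : c ^ 2 = 1 := by
    rw [form_eq, h7] at h2
    simp [hF.bil_unitGrad_self] at h2
    nlinarith
  have : c = 1 := by nlinarith
  rw [h7, this, one_smul]

end IsDefFun

/-- A side with an inward normal is not locally contained in its boundary. -/
lemma exists_isDefFun_of_inward {K : Set (Space S n)} (hK : IsClosed K)
    (hM : IsHypersurface 2 (frontier K)) {p : Space S n} (hp : p ∈ frontier K) {v : Ambient n}
    (hv : IsInwardUnitNormalAt K p v) : ∃ F, IsDefFun K p F := by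
  obtain ⟨F, hF⟩ := exists_isFrontierFun hM hp
  refine (hF.isDefFun_or hK hp).resolve_right fun h => ?_
  obtain ⟨⟨h1, h2, h3⟩, γ, h4, h5, h6⟩ := hv
  have h7 := hF.eq_smul_unitGrad hp h1 h3
  set c := bil S (unitGrad S F p) v with hc
  have hc0 : c ≠ 0 := by
    intro h0
    rw [form_eq, h7, h0] at h2
    simp at h2
  have ht : Tendsto (fun t => (γ t : Ambient n)) (𝓝[>] 0) (𝓝 (p : Ambient n)) := by
    have := h5.continuousAt.tendsto
    rw [h4] at this
    exact this.mono_left nhdsWithin_le_nhds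
  -- In the degenerate case `F` vanishes on `K`, hence along the inward curve, although the
  -- derivative of `F` along it is a nonzero multiple of `c`.
  have h8 : ∀ᶠ t in 𝓝[>] (0 : ℝ), F (γ t) = 0 := by
    filter_upwards [h6, ht.eventually h] with t h9 h10
    rw [proj_coe] at h10
    exact h10 h9
  have h9 := hF.hasDerivAt_comp h4 h5
  rw [hF.fderiv_eq, ← hc] at h9
  have h10 := (hF.hasDerivAt_comp h4 h5).neg
  rw [hF.fderiv_eq, ← hc] at h10
  rcases hc0.lt_or_gt with h0 | h0
  · have := eventually_pos_of_hasDerivAt h10 (by simp [h4, hF.apply_eq_zero hp])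
      (by have := mul_pos hF.sqrt_pos (neg_pos.2 h0); linarith)
    obtain ⟨t, h11, h12⟩ := (this.and h8).exists
    simp [h12] at h11
  · have := eventually_pos_of_hasDerivAt h9 (by simp [h4, hF.apply_eq_zero hp])
      (mul_pos hF.sqrt_pos h0)
    obtain ⟨t, h11, h12⟩ := (this.and h8).exists
    simp [h12] at h11

/-! ### The Weingarten map and the smallest principal curvature. -/

/-- The vectors tangent to the model at `p` and orthogonal to `N`. -/
noncomputable def tangentPlane (S : SpaceForm) {n : ℕ} (p N : Ambient n) :
    Submodule ℝ (Ambient n) :=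
  LinearMap.ker (rad S p : Ambient n →ₗ[ℝ] ℝ) ⊓ LinearMap.ker (bil S N : Ambient n →ₗ[ℝ] ℝ)

lemma mem_tangentPlane {p N X : Ambient n} :
    X ∈ tangentPlane S p N ↔ rad S p X = 0 ∧ bil S N X = 0 := Iff.rfl

/-- A symmetric endomorphism of a tangent plane has a smallest eigenvalue, the minimum of its
Rayleigh quotient. -/
lemma exists_least_eigenvalue {p N : Ambient n} (hp : p ∈ carrier S n)
    {L : Ambient n →L[ℝ] Ambient n}
    (hL : ∀ X ∈ tangentPlane S p N, L X ∈ tangentPlane S p N)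
    (hsymm : ∀ X ∈ tangentPlane S p N, ∀ Y ∈ tangentPlane S p N, bil S (L X) Y = bil S X (L Y))
    (hne : ∃ X ∈ tangentPlane S p N, X ≠ 0) :
    ∃ κ : ℝ, (∃ X ∈ tangentPlane S p N, X ≠ 0 ∧ L X = κ • X) ∧
      ∀ Y ∈ tangentPlane S p N, κ * bil S Y Y ≤ bil S (L Y) Y := by
  set T := tangentPlane S p N with hT
  have hpos : ∀ X ∈ T, X ≠ 0 → 0 < bil S X X := fun X hX h0 => bil_self_pos hp hX.1 h0
  set C := Metric.sphere (0 : Ambient n) 1 ∩ (T : Set (Ambient n)) with hC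
  have hCc : IsCompact C := (isCompact_sphere _ _).inter_right T.closed_of_finiteDimensional
  have hC0 : ∀ X ∈ C, X ≠ 0 := by
    rintro X ⟨hX, -⟩ rfl
    simp at hX
  have hCn : ∀ X ∈ T, X ≠ 0 → ‖X‖⁻¹ • X ∈ C := by
    intro X hX h0
    have := norm_ne_zero_iff.2 h0
    refine ⟨?_, T.smul_mem _ hX⟩
    simp [norm_smul, this]
  have hcont : ContinuousOn (fun X => bil S (L X) X / bil S X X) C := by
    have h1 : Continuous fun X => bil S (L X) X := by fun_prop
    have h2 : Continuous fun X : Ambient n => bil S X X := by fun_prop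
    exact h1.continuousOn.div h2.continuousOn fun X hX => (hpos X hX.2 (hC0 X hX)).ne'
  obtain ⟨X₀, hX₀, h0⟩ := hne
  obtain ⟨X, hXC, hmin⟩ := hCc.exists_isMinOn ⟨_, hCn X₀ hX₀ h0⟩ hcont
  have hXT := hXC.2
  have hX0 := hC0 X hXC
  set κ := bil S (L X) X / bil S X X with hκ
  have hray : ∀ Y ∈ T, κ * bil S Y Y ≤ bil S (L Y) Y := by
    intro Y hY
    rcases eq_or_ne Y 0 with rfl | hY0
    · simp
    have h1 : κ ≤ _ := hmin (hCn Y hY hY0)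
    have h2 := hpos Y hY hY0
    have h3 := norm_ne_zero_iff.2 hY0
    simp only [L.map_smul, bil_smul_left, bil_smul_right] at h1
    rw [mul_div_mul_left _ _ (inv_ne_zero h3), mul_div_mul_left _ _ (inv_ne_zero h3)] at h1
    exact (le_div_iff₀ h2).1 h1
  refine ⟨κ, ⟨X, hXT, hX0, ?_⟩, hray⟩
  have hXX : κ * bil S X X = bil S (L X) X := div_mul_cancel₀ _ (hpos X hXT hX0).ne'
  -- first variation
  set W := L X - κ • X with hW
  have hWT : W ∈ T := T.sub_mem (hL X hXT) (T.smul_mem _ hXT)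
  have hvar : ∀ t : ℝ, 0 ≤ 2 * t * bil S W W + t ^ 2 * (bil S (L W) W - κ * bil S W W) := by
    intro t
    have h1 := hray (X + t • W) (T.add_mem hXT (T.smul_mem _ hWT))
    have h2 : bil S (L W) X = bil S (L X) W := by rw [hsymm W hWT X hXT, bil_symm]
    have h3 : bil S W W = bil S (L X) W - κ * bil S X W := by
      rw [← bil_smul_left, ← bil_sub_left]
    simp only [L.map_add, L.map_smul, bil_add_left, bil_smul_left, bil_add_right, bil_smul_right,
      h2, bil_symm W X] at h1
    rw [← sub_nonneg] at h1
    convert h1 using 1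
    linear_combination 2 * t * h3 + hXX
  by_contra hcon
  have hW0 : W ≠ 0 := sub_ne_zero.2 hcon
  have hWp := hpos W hWT hW0
  set m := bil S (L W) W - κ * bil S W W
  have hm : 0 ≤ m := sub_nonneg.2 (hray W hWT)
  -- With this `t` one has `t * (m + 1) = -bil S W W`, so the quadratic in `hvar` becomes `t * bil S
  -- W W - t ^ 2`, which is negative.
  have h1 := hvar (-(bil S W W / (m + 1)))
  have h2 : -(bil S W W / (m + 1)) * (m + 1) = -bil S W W := by field_simp
  set t := -(bil S W W / (m + 1))
  have ht : t < 0 := by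
    have : 0 < bil S W W / (m + 1) := by positivity
    simp only [t]; linarith
  have h3 : 2 * t * bil S W W + t ^ 2 * m = t * bil S W W - t ^ 2 := by linear_combination t * h2
  rw [h3] at h1
  nlinarith [mul_pos (neg_pos.2 ht) hWp, sq_nonneg t]

namespace IsFrontierFun

variable {K : Set (Space S n)} {p : Space S n} {F : Ambient n → ℝ}

/-- The Weingarten map of the level set of `F`. -/
noncomputable def _root_.SpaceForm.shape (S : SpaceForm) {n : ℕ} (F : Ambient n → ℝ)
    (p : Ambient n) : Ambient n →L[ℝ] Ambient n :=
  -fderiv ℝ (unitGrad S F) p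

/-- Against tangent vectors the derivative of the normalising factor contributes nothing; what
remains is a multiple of the Hessian of `F`, symmetric because `F` is `C²`. -/
lemma bil_shape_symm (hF : IsFrontierFun K p F) {X Y : Ambient n}
    (hX : bil S (unitGrad S F p) X = 0) (hY : bil S (unitGrad S F p) Y = 0) :
    bil S (shape S F p X) Y = bil S X (shape S F p Y) := by
  have h1 : ContDiffAt ℝ 1 (grad S F) p := contDiffAt_grad hF.contDiffAt
  have h2 : ContDiffAt ℝ 1 (fun y => bil S (grad S F y) (grad S F y)) p :=
    ((bil S).contDiff.contDiffAt.comp _ h1).clm_apply h1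
  have h3 := (h2.sqrt hF.bil_grad_pos.ne').inv (Real.sqrt_ne_zero'.2 hF.bil_grad_pos)
  have hs := (h3.differentiableAt one_ne_zero).hasFDerivAt
  have hg := (h1.differentiableAt one_ne_zero).hasFDerivAt
  have hN := (hs.smul hg).fderiv
  have hgz : ∀ Z, bil S (unitGrad S F p) Z = 0 → bil S (grad S F p) Z = 0 := by
    intro Z hZ
    rw [bil_grad, hF.fderiv_eq, hZ, mul_zero]
  have hD : ∀ Z W, bil S (fderiv ℝ (grad S F) p Z) W = fderiv ℝ (fderiv ℝ F) p Z W := by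
    intro Z W
    have h4 : HasFDerivAt (fun y => bil S (grad S F y) W) _ (p : Ambient n) :=
      ((bil S).flip W).hasFDerivAt.comp (p : Ambient n) hg
    have h5 : (fun y => bil S (grad S F y) W) = fun y => fderiv ℝ F y W := by
      funext y; rw [bil_grad]
    rw [h5] at h4
    have h6 : HasFDerivAt (fderiv ℝ F) (fderiv ℝ (fderiv ℝ F) p) (p : Ambient n) :=
      ((hF.contDiffAt.fderiv_right (m := 1) (by norm_num)).differentiableAt
        one_ne_zero).hasFDerivAt
    have h7 := h6.clm_apply (hasFDerivAt_const W (p : Ambient n))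
    have h8 := DFunLike.congr_fun (h4.unique h7) Z
    simpa using h8
  have hsym : IsSymmSndFDerivAt ℝ F p := hF.contDiffAt.isSymmSndFDerivAt (by simp)
  have hc : ∀ Z W, bil S (unitGrad S F p) W = 0 → bil S (shape S F p Z) W =
      -((√(bil S (grad S F p) (grad S F p)))⁻¹ * fderiv ℝ (fderiv ℝ F) p Z W) := by
    intro Z W hW
    have h4 : fderiv ℝ (unitGrad S F) p = _ := hN
    rw [shape, h4]
    simp [hD, hgz W hW]
  rw [hc X Y hY, bil_symm X, hc Y X hX, hsym]

/-- The derivative of a field of constant square is orthogonal to the field. -/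
lemma bil_unitGrad_shape (hF : IsFrontierFun K p F) (X : Ambient n) :
    bil S (unitGrad S F p) (shape S F p X) = 0 := by
  have hN := (hF.contDiffAt_unitGrad.differentiableAt one_ne_zero).hasFDerivAt
  have hl := hasDerivAt_line (p : Ambient n) X 0
  have h1 : HasDerivAt (fun t : ℝ => unitGrad S F (p + t • X)) (fderiv ℝ (unitGrad S F) p X) 0 :=
    HasFDerivAt.comp_hasDerivAt_of_eq 0 hN hl (by simp)
  have h2 := hasDerivAt_bil (S := S) h1 h1
  have ht : Tendsto (fun t : ℝ => (p : Ambient n) + t • X) (𝓝 0) (𝓝 (p : Ambient n)) := by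
    simpa using hl.continuousAt.tendsto
  have h3 := h2.unique ((hasDerivAt_const (0 : ℝ) (1 : ℝ)).congr_of_eventuallyEq
    (ht.eventually hF.eventually_bil_unitGrad_self))
  rw [zero_smul, add_zero, bil_symm (fderiv ℝ (unitGrad S F) p X)] at h3
  rw [shape, FunLike.coe_neg, Pi.neg_apply, map_neg]
  linarith

lemma hasDerivAt_unitGrad_comp (hF : IsFrontierFun K p F) {γ : ℝ → Space S n} {X : Ambient n}
    (h0 : γ 0 = p) (hγ : HasDerivAt (fun t => (γ t : Ambient n)) X 0) :
    HasDerivAt (fun t => unitGrad S F (γ t)) (-shape S F p X) 0 := by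
  have hN := (hF.contDiffAt_unitGrad.differentiableAt one_ne_zero).hasFDerivAt
  have := HasFDerivAt.comp_hasDerivAt_of_eq 0 hN hγ (by simp [h0])
  rw [shape, FunLike.coe_neg, Pi.neg_apply, neg_neg]
  exact this

/-- Tangency to the model comes from differentiating `rad (γ t) (unitGrad (γ t)) = 0`: on the
quadrics the other term is `bil X N`, which vanishes, and in the Euclidean model `rad` does not
depend on the point. -/
lemma shape_mem (hF : IsFrontierFun K p F) {X : Ambient n}
    (hX : X ∈ tangentPlane S (p : Ambient n) (unitGrad S F p)) :
    shape S F p X ∈ tangentPlane S (p : Ambient n) (unitGrad S F p) := by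
  refine ⟨?_, hF.bil_unitGrad_shape X⟩
  obtain ⟨γ, h0, h1, -⟩ := isTangent_univ_iff.2 hX.1
  have h2 := hF.hasDerivAt_unitGrad_comp h0 h1
  have ht : Tendsto γ (𝓝 0) (𝓝 p) := by
    have : ContinuousAt γ 0 := Topology.IsInducing.subtypeVal.continuousAt_iff.2 h1.continuousAt
    rwa [ContinuousAt, h0] at this
  have h3 : ∀ᶠ t in 𝓝 (0 : ℝ), rad S (γ t : Ambient n) (unitGrad S F (γ t)) = 0 := by
    filter_upwards [ht.eventually hF.eventually] with t ht using ht.rad_unitGrad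
  have key : ∀ S' : SpaceForm, ∀ q : ℝ → Ambient n, HasDerivAt q X 0 → q 0 = p →
      (∀ᶠ t in 𝓝 (0 : ℝ), bil S' (q t) (unitGrad S F (γ t)) = 0) →
      bil S' X (unitGrad S F p) = 0 → bil S' p (shape S F p X) = 0 := by
    intro S' q hq hq0 h4 h5
    have h6 := (hasDerivAt_bil (S := S') hq h2).unique
      ((hasDerivAt_const (0 : ℝ) (0 : ℝ)).congr_of_eventuallyEq h4)
    rw [h0, h5, hq0, map_neg] at h6
    linarith
  have h7 : bil S X (unitGrad S F p) = 0 := by rw [bil_symm]; exact hX.2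
  cases S
  · have h4 : HasDerivAt (fun t => (unitGrad euclidean F (γ t)) 0) ((-shape euclidean F p X) 0) 0 :=
      (EuclideanSpace.proj (𝕜 := ℝ) (0 : Fin (n + 2))).hasFDerivAt.comp_hasDerivAt 0 h2
    have h6 := h4.unique ((hasDerivAt_const (0 : ℝ) (0 : ℝ)).congr_of_eventuallyEq h3)
    show (shape euclidean F p X) 0 = 0
    simpa using h6
  · exact key spherical _ h1 (by rw [h0]) h3 h7
  · exact key hyperbolic _ h1 (by rw [h0]) h3 h7

end IsFrontierFun

/-- The derivative of a unit normal along a curve is given by the Weingarten map. -/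
lemma IsWeingarten.hasDerivAt {M : Set (Space S n)} {ν : Space S n → Ambient n} {p : Space S n}
    {X Y : Ambient n} (h : IsWeingarten M ν p X Y) {γ : ℝ → Space S n} {t : ℝ} (h0 : γ t = p)
    (hγ : HasDerivAt (fun s => (γ s : Ambient n)) X t) (hM : ∀ᶠ s in 𝓝 t, γ s ∈ M) :
    HasDerivAt (fun s => ν (γ s)) (-Y) t := by
  obtain ⟨-, N, hN, hNν, rfl⟩ := h
  rw [neg_neg]
  have h1 : HasDerivAt (fun s => N (γ s)) (fderiv ℝ N p X) t :=
    HasFDerivAt.comp_hasDerivAt_of_eq t (hN.differentiableAt one_ne_zero).hasFDerivAt hγ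
      (by simp [h0])
  refine h1.congr_of_eventuallyEq ?_
  have ht : Tendsto γ (𝓝 t) (𝓝 p) := by
    have : ContinuousAt γ t := Topology.IsInducing.subtypeVal.continuousAt_iff.2 hγ.continuousAt
    rwa [ContinuousAt, h0] at this
  have ht' : Tendsto γ (𝓝 t) (𝓝[M] p) := tendsto_nhdsWithin_iff.2 ⟨ht, hM⟩
  filter_upwards [ht'.eventually hNν] with s hs using hs.symm

lemma continuousAt_of_hasDerivAt_coe {γ : ℝ → Space S n} {X : Ambient n} {t : ℝ}
    (hγ : HasDerivAt (fun s => (γ s : Ambient n)) X t) : ContinuousAt γ t :=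
  Topology.IsInducing.subtypeVal.continuousAt_iff.2 hγ.continuousAt

lemma isTangent_inter_iff {U M : Set (Space S n)} (hU : IsOpen U) {p : Space S n} (hp : p ∈ U)
    {X : Ambient n} : IsTangent (U ∩ M) p X ↔ IsTangent M p X := by
  constructor
  · rintro ⟨γ, h0, h1, h2⟩
    exact ⟨γ, h0, h1, h2.mono fun t ht => ht.2⟩
  · rintro ⟨γ, h0, h1, h2⟩
    refine ⟨γ, h0, h1, ?_⟩
    have h3 : ∀ᶠ t in 𝓝 (0 : ℝ), γ t ∈ U :=
      (continuousAt_of_hasDerivAt_coe h1).eventually (hU.mem_nhds (by rwa [h0]))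
    filter_upwards [h2, h3] with t h4 h5 using ⟨h5, h4⟩

namespace IsDefFun

variable {K : Set (Space S n)} {p : Space S n} {F : Ambient n → ℝ} {ν : Space S n → Ambient n}

lemma normal_eq (hF : IsDefFun K p F) (hν : IsInwardUnitNormal K ν) (hp : p ∈ frontier K) :
    ν p = unitGrad S F p := hF.eq_unitGrad hp (isInwardUnitNormal_iff.1 hν p hp)

lemma eventually_normal_eq (hF : IsDefFun K p F) (hν : IsInwardUnitNormal K ν) :
    ∀ᶠ q in 𝓝 p, q ∈ frontier K → unitGrad S F q = ν q := by
  filter_upwards [hF.eventually] with q hq hqK using (hq.normal_eq hν hqK).symm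

/-- Two extensions of the normal agree along curves in the boundary, hence have the same derivative
on tangent vectors. So the Weingarten relation is the graph of a linear map, and principal
curvatures become eigenvalues of `shape`. -/
lemma isWeingarten_iff (hF : IsDefFun K p F) (hν : IsInwardUnitNormal K ν)
    {U : Set (Space S n)} (hU : IsOpen U) (hpU : p ∈ U) (hp : p ∈ frontier K) {X Y : Ambient n} :
    IsWeingarten (U ∩ frontier K) ν p X Y ↔
      X ∈ tangentPlane S (p : Ambient n) (ν p) ∧ Y = shape S F p X := by
  have hNν : ∀ᶠ q : Space S n in 𝓝[U ∩ frontier K] p, unitGrad S F q = ν q := by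
    filter_upwards [(hF.eventually_normal_eq hν).filter_mono nhdsWithin_le_nhds,
      self_mem_nhdsWithin] with q h1 h2 using h1 h2.2
  rw [hF.normal_eq hν hp, mem_tangentPlane, ← hF.isTangent_iff hp,
    ← isTangent_inter_iff (M := frontier K) hU hpU]
  have hW : ∀ Z, IsTangent (U ∩ frontier K) p Z →
      IsWeingarten (U ∩ frontier K) ν p Z (shape S F p Z) :=
    fun Z hZ => ⟨hZ, unitGrad S F, hF.contDiffAt_unitGrad, hNν, by simp [shape]⟩
  constructor
  · intro h
    refine ⟨h.1, ?_⟩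
    obtain ⟨γ, h0, h1, h2⟩ := h.1
    have h3 := (h.hasDerivAt h0 h1 h2).unique ((hW X h.1).hasDerivAt h0 h1 h2)
    exact neg_injective h3
  · rintro ⟨h1, rfl⟩
    exact hW X h1

lemma exists_isLeast (hn : 1 ≤ n) (hF : IsDefFun K p F) (hν : IsInwardUnitNormal K ν)
    {U : Set (Space S n)} (hU : IsOpen U) (hpU : p ∈ U) (hp : p ∈ frontier K) :
    ∃ κ X, X ∈ tangentPlane S (p : Ambient n) (ν p) ∧ X ≠ 0 ∧ shape S F p X = κ • X ∧
      IsLeast (principalCurvatures (U ∩ frontier K) ν p) κ := by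
  have hνp := hF.normal_eq hν hp
  obtain ⟨X₀, hX₀, h1, h2⟩ := exists_tangent_ne_zero (S := S) hn (p : Ambient n) (ν p)
  obtain ⟨κ, ⟨X, hX, hX0, hκ⟩, hmin⟩ := exists_least_eigenvalue (N := ν p) (L := shape S F p) p.2
    (fun X hX => by rw [hνp] at hX ⊢; exact hF.shape_mem hX)
    (fun X hX Y hY => by
      rw [hνp] at hX hY
      exact hF.bil_shape_symm hX.2 hY.2)
    ⟨X₀, ⟨h1, h2⟩, hX₀⟩
  refine ⟨κ, X, hX, hX0, hκ, ⟨X, hX0, ?_⟩, ?_⟩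
  · rw [hF.isWeingarten_iff hν hU hpU hp]
    exact ⟨hX, hκ.symm⟩
  · rintro μ ⟨Y, hY0, hY⟩
    rw [hF.isWeingarten_iff hν hU hpU hp] at hY
    have h3 := hmin Y hY.1
    rw [← hY.2, bil_smul_left] at h3
    exact le_of_mul_le_mul_right h3 (bil_self_pos p.2 hY.1.1 hY0)

end IsDefFun

/-- Where all the normal curvatures are larger than `lam`, the boundary of `K` is strictly
`lam`-convex nearby. -/
lemma exists_isStrictlyLambdaConvex (hn : 1 ≤ n) {K : Set (Space S n)} {p : Space S n}
    {F : Ambient n → ℝ} {ν : Space S n → Ambient n} {lam : ℝ} (hF : IsDefFun K p F)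
    (hM : IsHypersurface 2 (frontier K)) (hν : IsInwardUnitNormal K ν) (hp : p ∈ frontier K)
    (hpos : ∀ X ∈ tangentPlane S (p : Ambient n) (ν p), X ≠ 0 →
      lam * bil S X X < bil S (shape S F p X) X) :
    (∃ κ, IsLeast (principalCurvatures (frontier K) ν p) κ ∧ lam < κ) ∧
      ∃ U : Set (Space S n), IsOpen U ∧ (U ∩ frontier K).Nonempty ∧
        IsStrictlyLambdaConvex lam (U ∩ frontier K) ν := by
  have hν' := isInwardUnitNormal_iff.1 hν
  have hlt : ∀ q : Space S n, IsDefFun K q F → q ∈ frontier K →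
      (∀ X ∈ tangentPlane S (q : Ambient n) (ν q), X ≠ 0 →
        lam * bil S X X < bil S (shape S F q X) X) → ∀ U, IsOpen U → q ∈ U →
      ∃ κ, IsLeast (principalCurvatures (U ∩ frontier K) ν q) κ ∧ lam < κ := by
    intro q hFq hq hposq U hU hqU
    obtain ⟨κ, X, hX, hX0, hκ, hleast⟩ := hFq.exists_isLeast hn hν hU hqU hq
    refine ⟨κ, hleast, ?_⟩
    have := hposq X hX hX0
    rw [hκ, bil_smul_left] at this
    exact lt_of_mul_lt_mul_right this (bil_self_pos q.2 hX.1 hX0).le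
  constructor
  · have := hlt p hF hp hpos univ isOpen_univ (mem_univ _)
    rwa [univ_inter] at this
  have hνp := hF.normal_eq hν hp
  -- the condition is open
  have hcont : ContinuousAt (shape S F) p :=
    (hF.contDiffAt_unitGrad.fderiv_right (m := 0) (by norm_num)).continuousAt.neg
  have hNc : ContinuousAt (unitGrad S F) p := hF.contDiffAt_unitGrad.continuousAt
  have hopen : ∀ᶠ q in 𝓝 (p : Ambient n), ∀ X ∈ Metric.sphere (0 : Ambient n) 1,
      rad S q X = 0 → bil S (unitGrad S F q) X = 0 →
      lam * bil S X X < bil S (shape S F q X) X := by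
    -- By compactness of the unit sphere it suffices to argue near each single `X`. If `X` fails to
    -- be tangent at `p`, nearby vectors fail to be tangent at nearby points.
    refine (isCompact_sphere _ _).eventually_forall_of_forall_eventually fun X hX => ?_
    have hX0 : X ≠ 0 := by rintro rfl; simp at hX
    have hfst : ContinuousAt (Prod.fst : Ambient n × Ambient n → Ambient n) (↑p, X) :=
      continuousAt_fst
    have hsnd : ContinuousAt (Prod.snd : Ambient n × Ambient n → Ambient n) (↑p, X) :=
      continuousAt_snd
    have hN2 : ContinuousAt (fun z : Ambient n × Ambient n => unitGrad S F z.1) (↑p, X) :=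
      ContinuousAt.comp (f := Prod.fst) (g := unitGrad S F) hNc hfst
    have hA2 : ContinuousAt (fun z : Ambient n × Ambient n => shape S F z.1) (↑p, X) :=
      ContinuousAt.comp (f := Prod.fst) (g := shape S F) hcont hfst
    have hb : ∀ f g : Ambient n × Ambient n → Ambient n, ContinuousAt f (↑p, X) →
        ContinuousAt g (↑p, X) → ContinuousAt (fun z => bil S (f z) (g z)) (↑p, X) :=
      fun f g hf hg => ((bil S).continuous.continuousAt.comp hf).clm_apply hg
    have hr : ContinuousAt (fun z : Ambient n × Ambient n => rad S z.1 z.2) (↑p, X) := by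
      cases S
      · exact (EuclideanSpace.proj (𝕜 := ℝ) (0 : Fin (n + 2))).continuous.continuousAt.comp hsnd
      · exact hb _ _ hfst hsnd
      · exact hb _ _ hfst hsnd
    by_cases h1 : rad S (p : Ambient n) X = 0
    · by_cases h2 : bil S (unitGrad S F p) X = 0
      · have h3 := hpos X ⟨h1, by rwa [hνp]⟩ hX0
        have h4 : ContinuousAt (fun z : Ambient n × Ambient n => lam * bil S z.2 z.2) (↑p, X) :=
          continuousAt_const.mul (hb _ _ hsnd hsnd)
        have h5 : ContinuousAt (fun z : Ambient n × Ambient n => bil S (shape S F z.1 z.2) z.2)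
            (↑p, X) := hb _ _ (hA2.clm_apply hsnd) hsnd
        filter_upwards [h4.eventually_lt h5 h3] with z hz _ _ using hz
      · filter_upwards [(hb _ _ hN2 hsnd).eventually_ne h2] with z hz _ h using absurd h hz
    · filter_upwards [hr.eventually_ne h1] with z hz h using absurd h hz
  have hev := (continuous_subtype_val.continuousAt.eventually hopen).and hF.eventually
  obtain ⟨U, hUev, hU, hpU⟩ := eventually_nhds_iff.1 hev
  refine ⟨U, hU, ⟨p, hpU, hp⟩, ?_, ?_, ?_⟩
  · rintro q ⟨hqU, hq⟩
    obtain ⟨f, h1, h2, h3⟩ := hM q hq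
    refine ⟨f, h1, ?_, h3⟩
    filter_upwards [h2, hU.mem_nhds hqU] with x h4 h5
    rw [← h4]
    exact and_iff_right h5
  · rintro q ⟨hqU, hq⟩
    obtain ⟨h1, h2, h3⟩ := (hν' q hq).1
    exact ⟨h1, h2, fun X hX => h3 X ((isTangent_inter_iff hU hqU).1 hX)⟩
  · rintro q ⟨hqU, hq⟩
    obtain ⟨h1, hFq⟩ := hUev q hqU
    refine hlt q hFq hq (fun X hX hX0 => ?_) U hU hqU
    rw [hFq.normal_eq hν hq] at hX
    have hnX := norm_pos_iff.2 hX0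
    have hT := (tangentPlane S (q : Ambient n) (unitGrad S F q)).smul_mem ‖X‖⁻¹ hX
    have h2 := h1 (‖X‖⁻¹ • X) (by simp [norm_smul, hnX.ne']) hT.1 hT.2
    simp only [(shape S F (q : Ambient n)).map_smul, bil_smul_left, bil_smul_right] at h2
    have h3 : 0 < ‖X‖⁻¹ * ‖X‖⁻¹ := by positivity
    have h4 : ‖X‖⁻¹ * ‖X‖⁻¹ * (lam * bil S X X) < ‖X‖⁻¹ * ‖X‖⁻¹ * bil S (shape S F q X) X := by
      linarith
    exact lt_of_mul_lt_mul_left h4 h3.le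

end SpaceForm

/-! ### Calculus along lines and at one-sided minima. -/

section

variable {E : Type*} [NormedAddCommGroup E] [NormedSpace ℝ E]

lemma strictMonoOn_line {f : E → ℝ} {z v : E} {a b : ℝ}
    (hf : ∀ s ∈ Icc a b, DifferentiableAt ℝ f (z + s • v) ∧ 0 < fderiv ℝ f (z + s • v) v) :
    StrictMonoOn (fun s : ℝ => f (z + s • v)) (Icc a b) := by
  have hd : ∀ s ∈ Icc a b,
      HasDerivAt (fun s : ℝ => f (z + s • v)) (fderiv ℝ f (z + s • v) v) s := by
    intro s hs
    have hl : HasDerivAt (fun t : ℝ => z + t • v) v s := by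
      simpa using ((hasDerivAt_id s).smul_const v).const_add z
    exact (hf s hs).1.hasFDerivAt.comp_hasDerivAt s hl
  refine strictMonoOn_of_deriv_pos (convex_Icc a b)
    (fun s hs => (hd s hs).continuousAt.continuousWithinAt) fun s hs => ?_
  have hs' := interior_subset hs
  rw [(hd s hs').deriv]
  exact (hf s hs').2

/-- If the zero set of `F` is contained in that of `U` and both functions increase in a common
direction, then `U` is nonnegative where `F` is. -/
lemma eventually_nonneg_of_zero_imp {F U : E → ℝ} {p v : E} (hF : ContDiffAt ℝ 1 F p)
    (hU : ContDiffAt ℝ 1 U p) (hF0 : F p = 0) (hFv : 0 < fderiv ℝ F p v)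
    (hUv : 0 < fderiv ℝ U p v) (hFU : ∀ᶠ z in 𝓝 p, F z = 0 → U z = 0) :
    ∀ᶠ z in 𝓝 p, 0 ≤ F z → 0 ≤ U z := by
  have hgood : ∀ f : E → ℝ, ContDiffAt ℝ 1 f p → 0 < fderiv ℝ f p v →
      ∀ᶠ z in 𝓝 p, DifferentiableAt ℝ f z ∧ 0 < fderiv ℝ f z v := by
    intro f hf hfv
    have h1 : ContinuousAt (fun z => fderiv ℝ f z v) p :=
      (hf.fderiv_right (m := 0) (by norm_num)).continuousAt.clm_apply continuousAt_const
    filter_upwards [hf.eventually (by simp), h1.eventually (lt_mem_nhds hfv)] with z h2 h3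
    exact ⟨h2.differentiableAt one_ne_zero, h3⟩
  obtain ⟨r, hr, hball⟩ := Metric.eventually_nhds_iff_ball.1
    ((hgood F hF hFv).and ((hgood U hU hUv).and hFU))
  -- Short enough that segments of direction `v` and length parameter `s₁` starting in the half ball
  -- stay in the ball.
  set s₁ := r / (2 * (‖v‖ + 1)) with hs₁
  have hs₁0 : 0 < s₁ := by positivity
  have hs₁v : s₁ * ‖v‖ < r / 2 := by
    have h1 : s₁ * (‖v‖ + 1) = r / 2 := by rw [hs₁]; field_simp
    linarith
  have hline : ∀ z ∈ Metric.ball p (r / 2), ∀ s ∈ Icc (-s₁) 0, z + s • v ∈ Metric.ball p r := by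
    intro z hz s hs
    rw [mem_ball_iff_norm] at hz ⊢
    have h1 : ‖s • v‖ ≤ s₁ * ‖v‖ := by
      rw [norm_smul, Real.norm_eq_abs]
      exact mul_le_mul_of_nonneg_right (abs_le.2 ⟨hs.1, hs.2.trans hs₁0.le⟩) (norm_nonneg _)
    calc ‖z + s • v - p‖ = ‖(z - p) + s • v‖ := by congr 1; abel
      _ ≤ ‖z - p‖ + ‖s • v‖ := norm_add_le _ _
      _ < r := by linarith
  have hmem0 : (0 : ℝ) ∈ Icc (-s₁) 0 := ⟨by linarith, le_rfl⟩
  have hmem1 : -s₁ ∈ Icc (-s₁) 0 := ⟨le_rfl, by linarith⟩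
  have hneg : F (p + (-s₁) • v) < 0 := by
    have h1 := strictMonoOn_line (f := F) (z := p) (v := v) (a := -s₁) (b := 0)
      (fun s hs => (hball _ (hline p (Metric.mem_ball_self (by positivity)) s hs)).1)
    have h2 := h1 hmem1 hmem0 (by linarith)
    simpa [hF0] using h2
  have hcont : ContinuousAt (fun z => F (z + (-s₁) • v)) p := by
    have h1 : DifferentiableAt ℝ F (p + (-s₁) • v) :=
      (hball _ (hline p (Metric.mem_ball_self (by positivity)) _ hmem1)).1.1
    exact ContinuousAt.comp (g := F) h1.continuousAt (by fun_prop)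
  filter_upwards [hcont.eventually (gt_mem_nhds hneg), Metric.ball_mem_nhds p (half_pos hr)]
    with z hz hzb hFz
  have hFm := strictMonoOn_line (f := F) (z := z) (v := v) (a := -s₁) (b := 0)
    (fun s hs => (hball _ (hline z hzb s hs)).1)
  have hUm := strictMonoOn_line (f := U) (z := z) (v := v) (a := -s₁) (b := 0)
    (fun s hs => (hball _ (hline z hzb s hs)).2.1)
  have hFc : ContinuousOn (fun s : ℝ => F (z + s • v)) (Icc (-s₁) 0) := by
    intro s hs
    have h1 := (hball _ (hline z hzb s hs)).1.1.continuousAt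
    exact (ContinuousAt.comp (g := F) (f := fun s : ℝ => z + s • v) h1
      (by fun_prop)).continuousWithinAt
  -- Going back from `z` against `v` one meets a zero of `F`, since `F` is negative at the far end.
  -- There `U` vanishes too, and it increases on the way back to `z`.
  obtain ⟨s, hs, hs0⟩ := intermediate_value_Icc (by linarith : -s₁ ≤ 0) hFc
    (show (0 : ℝ) ∈ Icc _ _ from ⟨hz.le, by simpa using hFz⟩)
  have hU0 := (hball _ (hline z hzb s hs)).2.2 hs0
  have := hUm.monotoneOn hs hmem0 hs.2
  simp only [zero_smul, add_zero] at this
  linarith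

/-- Second derivative test at a one-sided minimum. -/
lemma nonneg_of_deriv_test {h k : ℝ → ℝ} {c : ℝ} (hh : ∀ᶠ t in 𝓝 (0 : ℝ), HasDerivAt h (k t) t)
    (hk0 : k 0 = 0) (hk : HasDerivAt k c 0) (hmin : ∀ᶠ t in 𝓝[>] (0 : ℝ), h 0 ≤ h t) :
    0 ≤ c := by
  by_contra! hc
  have h1 : ∀ᶠ t in 𝓝[>] (0 : ℝ), 0 < -k t :=
    SpaceForm.eventually_pos_of_hasDerivAt hk.neg (by simp [hk0]) (by linarith)
  have h2 := eventually_nhdsWithin_iff.1 (h1.and hmin)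
  obtain ⟨r, hr, hball⟩ := Metric.eventually_nhds_iff_ball.1 (hh.and h2)
  have hin : ∀ s ∈ Icc 0 (r / 2), s ∈ Metric.ball (0 : ℝ) r := by
    intro s hs
    rw [Metric.mem_ball, Real.dist_0_eq_abs, abs_of_nonneg hs.1]
    linarith [hs.2]
  have h3 : StrictAntiOn h (Icc 0 (r / 2)) := by
    refine strictAntiOn_of_deriv_neg (convex_Icc _ _)
      (fun s hs => (hball s (hin s hs)).1.continuousAt.continuousWithinAt) fun s hs => ?_
    rw [interior_Icc] at hs
    have h4 := hball s (hin s (Ioo_subset_Icc_self hs))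
    rw [h4.1.deriv]
    have := (h4.2 hs.1).1
    linarith
  have h5 := h3 (left_mem_Icc.2 (by positivity)) (right_mem_Icc.2 (by positivity))
    (by positivity : (0 : ℝ) < r / 2)
  have h6 := ((hball _ (hin _ (right_mem_Icc.2 (by positivity)))).2
    (by show (0 : ℝ) < r / 2; positivity)).2
  linarith

end

/-! ### Umbilic sides as quadratic inequalities, and touching conditions. -/

namespace SpaceForm

variable {S : SpaceForm} {n : ℕ}

/-- The point `x` lies in the side, with boundary of curvature `mu` and inward normal `v` at `p`,
if and only if `gap S mu v p x` is nonnegative. -/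
noncomputable def gap (S : SpaceForm) {n : ℕ} (mu : ℝ) (v p x : Ambient n) : ℝ :=
  bil S v (x - p) - mu / 2 * bil S (x - p) (x - p)

/-- Hence `gap S lam v p` depends on `v` and `p` only through the vector `v + lam • p`, an
unnormalised centre of the quadric. -/
lemma one_sub_bil_self_eq {lam : ℝ} {v p : Ambient n} (hv : bil S v v = 1) (x : Ambient n) :
    1 - bil S (v + lam • p - lam • x) (v + lam • p - lam • x) = 2 * lam * gap S lam v p x := by
  have h : v + lam • p - lam • x = v - lam • (x - p) := by module
  rw [h, gap, bil_sub_left, bil_sub_right, bil_sub_right, bil_smul_left, bil_smul_left,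
    bil_smul_right, bil_smul_right, hv, bil_symm (x - p) v]
  ring

/-- Where one factor vanishes, the product rule needs only continuity of the other. This saves a
derivative in the second order tests below, where the boundary is merely `C²`. -/
lemma hasDerivAt_bil_of_zero {Z W : ℝ → Ambient n} {W' : Ambient n} (hZ : ContinuousAt Z 0)
    (hW0 : W 0 = 0) (hW : HasDerivAt W W' 0) :
    HasDerivAt (fun t => bil S (Z t) (W t)) (bil S (Z 0) W') 0 := by
  rw [hasDerivAt_iff_tendsto_slope] at hW ⊢
  have h1 : Tendsto Z (𝓝[≠] 0) (𝓝 (Z 0)) := hZ.tendsto.mono_left nhdsWithin_le_nhds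
  have h2 : Tendsto (fun t => bil S (Z t) (slope W 0 t)) (𝓝[≠] 0) (𝓝 (bil S (Z 0) W')) :=
    (isBoundedBilinearMap_apply.continuous.tendsto (bil S (Z 0), W')).comp
      ((((bil S).continuous.tendsto (Z 0)).comp h1).prodMk_nhds hW)
  refine h2.congr fun t => ?_
  simp [slope_def_module, hW0]

/-- Near a boundary point `p`, a side of an umbilic hypersurface consists of the points `x` with
`lam / 2 * |x - p| ^ 2 ≤ ⟨v, x - p⟩`. -/
lemma IsUmbilicSide.exists_support {lam : ℝ} (hlam : 0 < lam) {D : Set (Space S n)}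
    (hD : IsUmbilicSide lam D) {p : Space S n} (hp : p ∈ frontier D) :
    ∃ v : Ambient n, rad S (p : Ambient n) v = 0 ∧ bil S v v = 1 ∧
      ∀ᶠ x : Space S n in 𝓝 p, x ∈ D →
        0 ≤ gap S lam v p x := by
  obtain ⟨hcl, -, hsm, ν, hν, hW⟩ := hD
  have hM : IsHypersurface 2 (frontier D) := by
    intro q hq
    obtain ⟨f, hf, h2⟩ := hsm q hq
    exact ⟨f, hf.of_le (by norm_cast), h2⟩
  have hν' := isInwardUnitNormal_iff.1 hν
  obtain ⟨F, hF⟩ := exists_isDefFun_of_inward hcl hM hp (hν' p hp)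
  have hF0 := hF.apply_eq_zero hp
  have hνp := hF.normal_eq hν hp
  -- `ν + lam • id` is locally constant on the hypersurface
  have hconst : ∀ᶠ q : Space S n in 𝓝 p, q ∈ frontier D →
      ν q + lam • (q : Ambient n) = ν p + lam • (p : Ambient n) := by
    obtain ⟨Φ, Ψ, hΦp, hΦ, hΨp, hΨ, -, hFΨ, hΨΦ⟩ :=
      exists_straightening hF.contDiffAt two_ne_zero hF.fderiv_ne
    set l := fderiv ℝ F p
    have hΨt : Tendsto Ψ (𝓝 (p : Ambient n)) (𝓝 (p : Ambient n)) := by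
      have := hΨ.continuousAt
      rwa [ContinuousAt, hΨp] at this
    have hΦt : Tendsto Φ (𝓝 (p : Ambient n)) (𝓝 (p : Ambient n)) := by
      rwa [ContinuousAt, hΦp] at hΦ
    obtain ⟨r, hr, hball⟩ := Metric.eventually_nhds_iff_ball.1
      ((hFΨ.and (hΨt.eventually hF.frontier_iff)).and
        ((hΨ.eventually (by simp)).and (hΨt.eventually (eventually_domain p))))
    have hΦq := continuous_subtype_val.continuousAt.eventually
      ((hΦt.eventually (Metric.ball_mem_nhds (p : Ambient n) hr)).and (hΨΦ.and hF.frontier_iff))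
    filter_upwards [hΦq] with q hq hqD
    obtain ⟨hqb, hΨq, hqF⟩ := hq
    rw [proj_coe] at hqF
    have hFq := hqF.1 hqD
    set X := Φ q - (p : Ambient n) with hX
    have hlX : l X = 0 := by
      have := (hball _ hqb).1.1
      rw [hΨq, hFq, hF0, sub_zero] at this
      exact this.symm
    set z : ℝ → Ambient n := fun t => p + t • X with hz
    have hzc : Continuous z := by fun_prop
    have hzb : ∀ t ∈ Icc (0 : ℝ) 1, z t ∈ Metric.ball (p : Ambient n) r := by
      intro t ht
      rw [← Metric.mem_ball, mem_ball_iff_norm] at hqb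
      rw [mem_ball_iff_norm]
      simp only [hz, add_sub_cancel_left, norm_smul, Real.norm_eq_abs, abs_of_nonneg ht.1]
      exact (mul_le_of_le_one_left (norm_nonneg _) ht.2).trans_lt hqb
    set γ : ℝ → Space S n := fun t => proj S (Ψ (z t)) with hγ
    have hγD : ∀ t, z t ∈ Metric.ball (p : Ambient n) r → γ t ∈ frontier D := by
      intro t ht
      obtain ⟨⟨h1, h2⟩, -⟩ := hball _ ht
      rw [h2]
      simp only [hz, add_sub_cancel_left, map_smul, hlX, smul_zero] at h1
      rw [hF0, sub_zero] at h1
      exact h1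
    -- Umbilicity says that the derivative of `ν` along a boundary curve is `-lam` times the
    -- velocity; a straightened segment supplies such a curve from `p` to `q`.
    have hder : ∀ t ∈ Icc (0 : ℝ) 1,
        HasDerivAt (fun s => ν (γ s) + lam • (γ s : Ambient n)) 0 t := by
      intro t ht
      have hev : ∀ᶠ s in 𝓝 t, z s ∈ Metric.ball (p : Ambient n) r :=
        hzc.continuousAt.eventually (Metric.isOpen_ball.mem_nhds (hzb t ht))
      obtain ⟨-, h1, h2⟩ := hball _ (hzb t ht)
      have hd1 : DifferentiableAt ℝ (fun s => ambProj S (Ψ (z s))) t := by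
        have h3 : DifferentiableAt ℝ z t := by fun_prop
        have h4 : DifferentiableAt ℝ (fun s => Ψ (z s)) t :=
          (h1.differentiableAt two_ne_zero).comp t h3
        exact ((contDiffAt_ambProj h2 (k := 1)).differentiableAt one_ne_zero).comp t h4
      have hd : HasDerivAt (fun s => (γ s : Ambient n))
          (deriv (fun s => ambProj S (Ψ (z s))) t) t := by
        refine hd1.hasDerivAt.congr_of_eventuallyEq ?_
        filter_upwards [hev] with s hs
        exact coe_proj (hball _ hs).2.2
      set Y := deriv (fun s => ambProj S (Ψ (z s))) t
      have htan : IsTangent (frontier D) (γ t) Y := by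
        refine ⟨fun s => γ (t + s), by simp, ?_, ?_⟩
        · exact HasDerivAt.comp_const_add t 0 (by simpa using hd)
        · have h3 : Tendsto (fun s : ℝ => t + s) (𝓝 0) (𝓝 t) := by
            simpa using (continuous_const.add continuous_id).tendsto (x := (0 : ℝ)) (f := fun s => t + s)
          filter_upwards [h3.eventually hev] with s hs using hγD _ hs
      have h5 := (hW (γ t) (hγD t (hzb t ht)) Y htan).hasDerivAt rfl hd
        (hev.mono fun s hs => hγD s hs)
      refine (h5.add (hd.const_smul lam)).congr_deriv ?_
      simp
    have h6 := constant_of_has_deriv_right_zero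
      (fun t ht => (hder t ht).continuousAt.continuousWithinAt)
      (fun t ht => (hder t (Ico_subset_Icc_self ht)).hasDerivWithinAt) 1 (by simp)
    have h7 : γ 1 = q := by simp [hγ, hz, hX, hΨq, proj_coe]
    have h8 : γ 0 = p := by simp [hγ, hz, hΨp, proj_coe]
    rwa [h7, h8] at h6
  set c := ν p + lam • (p : Ambient n) with hc
  set u : Ambient n → ℝ := fun z => 1 - bil S (c - lam • z) (c - lam • z) with hu
  set U : Ambient n → ℝ := fun z => u (ambProj S z) with hU
  have hNN := hF.bil_unitGrad_self
  rw [← hνp] at hNN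
  have hrad := hF.rad_unitGrad
  rw [← hνp] at hrad
  have hcp : c - lam • (p : Ambient n) = ν p := by simp [hc]
  have huc : ContDiff ℝ 1 u := by
    have h1 : ContDiff ℝ 1 fun z : Ambient n => c - lam • z := by fun_prop
    exact contDiff_const.sub (((bil S).contDiff.comp h1).clm_apply h1)
  have hUc : ContDiffAt ℝ 1 U p := huc.contDiffAt.comp _ (contDiffAt_ambProj (coe_mem_domain p))
  have hUd : fderiv ℝ U p (ν p) = 2 * lam := by
    obtain ⟨γ, h0, h1, -⟩ := isTangent_univ_iff.2 hrad
    have h2 : HasDerivAt (fun t => U (γ t)) (fderiv ℝ U p (ν p)) 0 :=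
      HasFDerivAt.comp_hasDerivAt_of_eq 0 (hUc.differentiableAt one_ne_zero).hasFDerivAt h1
        (by simp [h0])
    have h3 : (fun t => U (γ t)) = fun t => 1 - bil S (c - lam • (γ t : Ambient n))
        (c - lam • (γ t : Ambient n)) := by
      funext t; simp only [hU, hu, ambProj_coe]
    rw [h3] at h2
    have h4 := (h1.const_smul lam).const_sub c
    have h5 := h2.unique ((hasDerivAt_bil (S := S) h4 h4).const_sub 1)
    simp only [Pi.smul_apply, h0, hcp] at h5
    rw [h5]
    simp [hNN]
    ring
  have hzero : ∀ᶠ z in 𝓝 (p : Ambient n), F z = 0 → U z = 0 := by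
    filter_upwards [hF.frontier_iff, (tendsto_proj p).eventually hconst, eventually_domain p]
      with z h1 h2 h3 h4
    have h5 := h2 (h1.2 h4)
    have h6 := (hν' _ (h1.2 h4)).1.2.1
    rw [coe_proj h3] at h5
    have h7 : c - lam • ambProj S z = ν (proj S z) := by rw [← h5]; simp
    simp only [hU, hu, h7]
    rw [form_eq] at h6
    rw [h6, sub_self]
  -- The boundary of `D` lies in the zero set of `U`, and `F` and `U` both increase along `ν p`; so
  -- `D` lies locally where `U` is nonnegative.
  have hfin := eventually_nonneg_of_zero_imp (hF.contDiffAt.of_le (by norm_num)) hUc hF0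
    (v := ν p) (by rw [hF.fderiv_eq, ← hνp, hNN, mul_one]; exact hF.sqrt_pos)
    (by rw [hUd]; positivity) hzero
  refine ⟨ν p, hrad, hNN, ?_⟩
  filter_upwards [continuous_subtype_val.continuousAt.eventually (hfin.and hF.mem_iff)]
    with x ⟨h1, h2⟩ hxD
  rw [proj_coe] at h2
  have h3 := h1 (h2.1 hxD)
  simp only [hU, hu, ambProj_coe, hc, one_sub_bil_self_eq hNN] at h3
  exact nonneg_of_mul_nonneg_right h3 (by positivity)

lemma tendsto_of_hasDerivAt_coe {γ : ℝ → Space S n} {X : Ambient n} {z : Space S n} (h0 : γ 0 = z)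
    (hγ : HasDerivAt (fun s => (γ s : Ambient n)) X 0) : Tendsto γ (𝓝 0) (𝓝 z) := by
  have := continuousAt_of_hasDerivAt_coe hγ
  rwa [ContinuousAt, h0] at this

lemma exists_smooth_curve {z : Space S n} {X : Ambient n} (hX : rad S (z : Ambient n) X = 0) :
    ∃ γ : ℝ → Space S n, γ 0 = z ∧ ContDiffAt ℝ 2 (fun t => (γ t : Ambient n)) 0 ∧
      HasDerivAt (fun t => (γ t : Ambient n)) X 0 := by
  have hl := hasDerivAt_line (z : Ambient n) X 0
  have hcl : ContDiffAt ℝ 2 (fun t : ℝ => (z : Ambient n) + t • X) 0 := by fun_prop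
  refine ⟨fun t => proj S (z + t • X), by simp [proj_coe], ?_,
    hasDerivAt_coe_proj hl (by simp) hX⟩
  have h1 : ContDiffAt ℝ 2 (fun t : ℝ => ambProj S ((z : Ambient n) + t • X)) 0 := by
    refine ContDiffAt.comp (g := ambProj S) (0 : ℝ) ?_ hcl
    simpa using contDiffAt_ambProj (coe_mem_domain z)
  have ht : Tendsto (fun t : ℝ => (z : Ambient n) + t • X) (𝓝 0) (𝓝 (z : Ambient n)) := by
    simpa using hcl.continuousAt.tendsto
  refine h1.congr_of_eventuallyEq ?_
  filter_upwards [ht.eventually (eventually_domain z)] with t h2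
  exact coe_proj h2

lemma hasDerivAt_gap_comp {b : Ambient n} {τ : ℝ} {γ : ℝ → Ambient n} {γ' z : Ambient n} {t : ℝ}
    (hγ : HasDerivAt γ γ' t) :
    HasDerivAt (fun s => gap S τ b z (γ s)) (bil S (b - τ • (γ t - z)) γ') t := by
  have h1 := hγ.sub_const z
  have h2 := (hasDerivAt_bil (S := S) (hasDerivAt_const t b) h1).sub
    ((hasDerivAt_bil (S := S) h1 h1).const_mul (τ / 2))
  refine h2.congr_deriv ?_
  simp only [map_zero, FunLike.coe_zero, Pi.zero_apply, bil_sub_left, bil_smul_left,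
    bil_symm γ' (γ t - z)]
  ring

/-- First order condition at a one-sided minimum. -/
lemma bil_nonneg_of_gap_nonneg {b : Ambient n} {τ : ℝ} {z : Space S n} {γ : ℝ → Space S n}
    {X : Ambient n} (h0 : γ 0 = z) (hγ : HasDerivAt (fun s => (γ s : Ambient n)) X 0)
    (hmin : ∀ᶠ t in 𝓝[>] (0 : ℝ), 0 ≤ gap S τ b z (γ t)) : 0 ≤ bil S b X := by
  by_contra! h
  have h1 := (hasDerivAt_gap_comp (S := S) (b := b) (τ := τ) (z := z) hγ).neg
  have h2 := eventually_pos_of_hasDerivAt h1 (by simp [gap, h0]) (by simpa [h0] using h)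
  obtain ⟨t, h3, h4⟩ := (h2.and hmin).exists
  simp only [Pi.neg_apply] at h3
  linarith

/-- Second order condition at a one-sided minimum, along a curve which is orthogonal to the field
`M`. -/
lemma second_order_of_gap_nonneg {b N Y : Ambient n} {α β τ : ℝ} {z : Space S n}
    {γ : ℝ → Space S n} {X : Ambient n} {M : ℝ → Ambient n} (h0 : γ 0 = z)
    (hγ : HasDerivAt (fun s => (γ s : Ambient n)) X 0)
    (hγ2 : ContDiffAt ℝ 2 (fun s => (γ s : Ambient n)) 0)
    (hM : HasDerivAt M (-Y) 0) (hM0 : M 0 = N)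
    (hMγ : ∀ᶠ t in 𝓝 (0 : ℝ), ∀ Z, HasDerivAt (fun s => (γ s : Ambient n)) Z t →
      bil S (M t) Z = 0)
    (hb : b = β • N + (curv S * α) • (z : Ambient n))
    (hmin : ∀ᶠ t in 𝓝[>] (0 : ℝ), 0 ≤ gap S τ b z (γ t)) :
    (curv S * α + τ) * bil S X X ≤ β * bil S Y X := by
  set g : ℝ → Ambient n := fun s => (γ s : Ambient n) with hg
  have hd : ∀ᶠ t in 𝓝 (0 : ℝ), HasDerivAt g (deriv g t) t :=
    (hγ2.eventually (by simp)).mono fun t ht => (ht.differentiableAt two_ne_zero).hasDerivAt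
  have hgc : ContinuousAt (deriv g) 0 := by
    have h1 : ContinuousAt (fun t => fderiv ℝ g t 1) 0 :=
      (hγ2.fderiv_right (m := 1) (by norm_num)).continuousAt.clm_apply continuousAt_const
    exact h1
  have hg0 : deriv g 0 = X := hγ.deriv
  -- Subtracting `β • M t + (curv S * α) • g t` from the vector paired with the velocity in the
  -- derivative of `gap` does not change that derivative, since both terms are orthogonal to the
  -- velocity. The remainder `W` vanishes at 0.
  set W : ℝ → Ambient n := fun t => β • (N - M t) - (curv S * α + τ) • (g t - z) with hW
  have hW0 : W 0 = 0 := by simp [hW, hM0, hg, h0]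
  have hWd : HasDerivAt W (β • Y - (curv S * α + τ) • X) 0 := by
    have h1 := ((hM.const_sub N).const_smul β).sub
      ((hγ.sub_const (z : Ambient n)).const_smul (curv S * α + τ))
    rw [neg_neg] at h1
    exact h1
  have hk := hasDerivAt_bil_of_zero (S := S) hgc hW0 hWd
  have hh : ∀ᶠ t in 𝓝 (0 : ℝ), HasDerivAt (fun s => gap S τ b z (g s))
      (bil S (deriv g t) (W t)) t := by
    filter_upwards [hd, hMγ] with t h1 h2
    refine (hasDerivAt_gap_comp h1).congr_deriv ?_
    have h3 := h2 _ h1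
    have h4 := curv_mul_bil_eq_zero (rad_deriv_eq_zero h1)
    rw [bil_symm (deriv g t), hW, hb]
    simp only [bil_sub_left, bil_add_left, bil_smul_left, h3]
    linear_combination α * h4
  have h5 := nonneg_of_deriv_test hh (by simp [hW0]) hk (by
    filter_upwards [hmin] with t ht
    have h6 : gap S τ b z (g 0) = 0 := by simp [hg, h0, gap]
    rw [h6]; exact ht)
  rw [hg0, bil_symm, bil_sub_left, bil_smul_left, bil_smul_left] at h5
  linarith

/-- A set which lies, near its boundary point `z`, in the region `0 ≤ gap S τ b z` is curved at
least as much as this region. -/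
lemma IsDefFun.touch {K : Set (Space S n)} {z : Space S n} {F : Ambient n → ℝ}
    (hF : IsDefFun K z F) (hz : z ∈ frontier K) {b : Ambient n} {α τ : ℝ}
    (hb : rad S (z : Ambient n) (b - (curv S * α) • (z : Ambient n)) = 0) (hK : IsClosed K)
    (hmin : ∀ᶠ x in 𝓝 z, x ∈ K → 0 ≤ gap S τ b z x) :
    ∃ β : ℝ, 0 ≤ β ∧ b = β • unitGrad S F z + (curv S * α) • (z : Ambient n) ∧
      ∀ X ∈ tangentPlane S (z : Ambient n) (unitGrad S F z),
        (curv S * α + τ) * bil S X X ≤ β * bil S (shape S F z X) X := by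
  set N := unitGrad S F z with hN
  have hNN : bil S N N = 1 := hF.bil_unitGrad_self
  set b' := b - (curv S * α) • (z : Ambient n) with hb'
  have hbb : ∀ X, rad S (z : Ambient n) X = 0 → bil S b' X = bil S b X := by
    intro X hX
    rw [hb', bil_sub_left, bil_smul_left]
    have := curv_mul_bil_eq_zero hX
    linear_combination (-α) * this
  have hmin' : ∀ γ : ℝ → Space S n, ∀ X, γ 0 = z →
      HasDerivAt (fun s => (γ s : Ambient n)) X 0 → (∀ᶠ t in 𝓝[>] (0 : ℝ), γ t ∈ K) →
      ∀ᶠ t in 𝓝[>] (0 : ℝ), 0 ≤ gap S τ b z (γ t) := by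
    intro γ X h0 h1 h2
    have h3 := (tendsto_of_hasDerivAt_coe h0 h1).mono_left
      (nhdsWithin_le_nhds (s := Ioi 0))
    filter_upwards [h3.eventually hmin, h2] with t h4 h5 using h4 h5
  have hge : ∀ X ∈ tangentPlane S (z : Ambient n) N, 0 ≤ bil S b' X := by
    intro X hX
    obtain ⟨γ, h0, -, h1, h2⟩ := hF.exists_curve hz hX.1 hX.2
    rw [hbb X hX.1]
    exact bil_nonneg_of_gap_nonneg h0 h1 (hmin' γ X h0 h1
      ((h2.filter_mono nhdsWithin_le_nhds).mono fun t ht => hK.frontier_subset ht))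
  -- Boundary curves exist in the directions `X` and `-X`, so the one-sided first order condition
  -- becomes an equality.
  have horth : ∀ X ∈ tangentPlane S (z : Ambient n) N, bil S b' X = 0 := by
    intro X hX
    have h1 := hge X hX
    have h2 := hge (-X) (Submodule.neg_mem _ hX)
    rw [map_neg] at h2
    linarith
  have hb'N : b' = bil S N b' • N := by
    refine hF.eq_smul_unitGrad hz (isTangent_univ_iff.2 hb) fun X hX => ?_
    rw [form_eq]
    exact horth X ((hF.isTangent_iff hz).1 hX)
  set β := bil S N b' with hβ
  have hbeq : b = β • N + (curv S * α) • (z : Ambient n) := by rw [← hb'N, hb']; abel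
  refine ⟨β, ?_, hbeq, ?_⟩
  · obtain ⟨γ, h0, h1⟩ := IsDefFun.exists_curve_univ hF.rad_unitGrad
    have h2 := hF.eventually_mem_interior hz h0 h1 (by rw [hF.bil_unitGrad_self]; norm_num)
    rw [hβ, bil_symm, hbb _ hF.rad_unitGrad]
    exact bil_nonneg_of_gap_nonneg h0 h1 (hmin' γ _ h0 h1 (h2.mono fun t ht => interior_subset ht))
  · intro X hX
    obtain ⟨γ, h0, hγ2, h1, h2⟩ := hF.exists_curve hz hX.1 hX.2
    refine second_order_of_gap_nonneg h0 h1 hγ2 (hF.hasDerivAt_unitGrad_comp h0 h1)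
      (by rw [h0]) ?_ hbeq (hmin' γ X h0 h1
        ((h2.filter_mono nhdsWithin_le_nhds).mono fun t ht => hK.frontier_subset ht))
    filter_upwards [(tendsto_of_hasDerivAt_coe h0 h1).eventually hF.toIsFrontierFun.eventually,
      h2.eventually_nhds] with t h3 h4 Z hZ
    refine ((h3.isTangent_iff h4.self_of_nhds).1 ⟨fun s => γ (t + s), by simp, ?_, ?_⟩).2
    · exact HasDerivAt.comp_const_add t 0 (by simpa using hZ)
    · have h5 : Tendsto (fun s : ℝ => t + s) (𝓝 0) (𝓝 t) := by
        have : Continuous fun s : ℝ => t + s := by fun_prop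
        simpa using this.tendsto 0
      exact h5.eventually h4

/-- An interior minimum of `gap S τ b z`. -/
lemma touch_interior (hn : 1 ≤ n) {z : Space S n} {b : Ambient n} {α τ : ℝ}
    (hb : rad S (z : Ambient n) (b - (curv S * α) • (z : Ambient n)) = 0)
    (hmin : ∀ᶠ x : Space S n in 𝓝 z, 0 ≤ gap S τ b z x) : curv S * α + τ ≤ 0 := by
  set b' := b - (curv S * α) • (z : Ambient n) with hb'
  have hmin' : ∀ γ : ℝ → Space S n, ∀ X, γ 0 = z →
      HasDerivAt (fun s => (γ s : Ambient n)) X 0 →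
      ∀ᶠ t in 𝓝[>] (0 : ℝ), 0 ≤ gap S τ b z (γ t) := by
    intro γ X h0 h1
    exact ((tendsto_of_hasDerivAt_coe h0 h1).mono_left
      (nhdsWithin_le_nhds (s := Ioi 0))).eventually hmin
  have hb0 : b' = 0 := by
    -- If the tangential part `b'` were nonzero, moving in the direction `-b'` would decrease the
    -- function.
    by_contra hne
    obtain ⟨γ, h0, -, h1⟩ := exists_smooth_curve (X := -b') (z := z) (by rw [map_neg, hb, neg_zero])
    have h2 := bil_nonneg_of_gap_nonneg h0 h1 (hmin' γ _ h0 h1)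
    have h3 := curv_mul_bil_eq_zero hb
    have h4 : bil S b b' = bil S b' b' + (curv S * α) * bil S (z : Ambient n) b' := by
      rw [← bil_smul_left, ← bil_add_left, hb']; congr 2; abel
    have h5 := bil_self_pos z.2 hb hne
    rw [map_neg, h4] at h2
    have h6 : curv S * α * bil S (z : Ambient n) b' = 0 := by linear_combination α * h3
    linarith
  obtain ⟨X, hX0, hX, -⟩ := exists_tangent_ne_zero (S := S) hn (z : Ambient n) 0
  obtain ⟨γ, h0, hγ2, h1⟩ := exists_smooth_curve hX
  have h2 := second_order_of_gap_nonneg (N := 0) (Y := 0) (M := fun _ => 0) (β := 0) (α := α)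
    h0 h1 hγ2 (by simpa using hasDerivAt_const (0 : ℝ) (0 : Ambient n)) rfl (by simp)
    (by rw [hb', sub_eq_zero] at hb0; simp [← hb0]) (hmin' γ X h0 h1)
  have h3 := bil_self_pos z.2 hX hX0
  rw [zero_mul] at h2
  by_contra! h
  have := mul_pos h h3
  linarith

/-- At its boundary points, a `lam`-convex set is locally supported by the side determined by its
own normal, and its principal curvatures are at least `lam`. -/
lemma IsDefFun.lambdaConvex {K : Set (Space S n)} {z : Space S n} {F : Ambient n → ℝ}
    (hF : IsDefFun K z F) (hz : z ∈ frontier K) (hK : IsClosed K) {lam : ℝ} (hlam : 0 < lam)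
    (hconv : IsLambdaConvex lam K) :
    (∀ᶠ x in 𝓝 z, x ∈ K → 0 ≤ gap S lam (unitGrad S F z) z x) ∧
      ∀ X ∈ tangentPlane S (z : Ambient n) (unitGrad S F z),
        lam * bil S X X ≤ bil S (shape S F z X) X := by
  obtain ⟨D, hD, hzD, hKD⟩ := hconv z hz
  obtain ⟨v, hv, hvv, hsup⟩ := hD.exists_support hlam hzD
  rw [eventually_nhdsWithin_iff] at hKD
  have hmin : ∀ᶠ x in 𝓝 z, x ∈ K → 0 ≤ gap S lam v z x := by
    filter_upwards [hKD, hsup] with x h1 h2 h3 using h2 (h1 h3)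
  obtain ⟨β, hβ, hvβ, hX⟩ := hF.touch hz (b := v) (α := 0) (by simpa using hv) hK hmin
  simp only [mul_zero, zero_smul, add_zero, zero_add] at hvβ hX
  -- Both `v` and the inward normal are unit vectors, and `0 ≤ β`; hence the supporting hypersurface
  -- has the normal of `K`.
  have hβ1 : β = 1 := by
    rw [hvβ, bil_smul_left, bil_smul_right, hF.bil_unitGrad_self] at hvv
    nlinarith
  rw [hβ1, one_smul] at hvβ
  simp only [hβ1, one_mul] at hX
  exact ⟨hvβ ▸ hmin, hX⟩

/-! ### From local to global convexity: visibility from an interior point. -/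

/-- `K` has a boundary of class `C²` and is locally strictly supported by the geodesic hyperplanes
tangent to its boundary. -/
def IsLocallyStrictlyConvex (K : Set (Space S n)) : Prop :=
  ∀ p ∈ frontier K, ∃ F, IsDefFun K p F ∧
    ∀ᶠ x in 𝓝 p, x ∈ K → x ≠ p → 0 < bil S (unitGrad S F p) ((x : Ambient n) - p)

lemma mem_interior_of_not_mem_frontier {X : Type*} [TopologicalSpace X] {K : Set X} {x : X}
    (hx : x ∈ K) (h : x ∉ frontier K) : x ∈ interior K := by
  rw [← self_sdiff_frontier]; exact ⟨hx, h⟩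

/-- A curve which starts in the interior of `K` has a first point on the boundary. -/
lemma exists_first_hit {X : Type*} [TopologicalSpace X] {K : Set X} {g : ℝ → X} {a b : ℝ}
    (hg : ContinuousOn g (Icc a b)) (ha : g a ∈ interior K)
    (h : ∃ t ∈ Icc a b, g t ∈ frontier K) :
    ∃ t₀ ∈ Ioc a b, g t₀ ∈ frontier K ∧ ∀ t ∈ Ico a t₀, g t ∉ frontier K := by
  have hc : IsCompact (Icc a b ∩ g ⁻¹' frontier K) :=
    isCompact_Icc.of_isClosed_subset (hg.preimage_isClosed_of_isClosed isClosed_Icc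
      isClosed_frontier) inter_subset_left
  obtain ⟨t₀, ⟨ht₀, hf⟩, hmin⟩ := hc.exists_isLeast h
  refine ⟨t₀, ⟨lt_of_le_of_ne ht₀.1 ?_, ht₀.2⟩, hf, fun t ht htf => ?_⟩
  · rintro rfl
    exact hf.2 ha
  · exact absurd (hmin ⟨⟨ht.1, ht.2.le.trans ht₀.2⟩, htf⟩) (not_le.2 ht.2)

/-- The chord from `x` to `y`. -/
def chord {n : ℕ} (x y : Ambient n) (t : ℝ) : Ambient n := x + t • (y - x)

/-- On the sphere only the chord between antipodes meets the origin; the future timelike cone is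
convex. -/
lemma chord_mem_domain {x y : Ambient n} (hx : x ∈ carrier S n) (hy : y ∈ carrier S n)
    (hne : y ≠ -x) {t : ℝ} (ht : t ∈ Icc (0 : ℝ) 1) : chord x y t ∈ domain S n := by
  have hc : chord x y t = (1 - t) • x + t • y := by rw [chord]; module
  rw [hc]
  cases S
  · trivial
  · show 0 < bil spherical _ _
    rw [bil_spherical, real_inner_self_pos]
    intro h0
    have hx1 : ‖x‖ = 1 := by
      have : form spherical x x = 1 := hx
      rw [form_eq, bil_spherical, real_inner_self_eq_norm_sq] at this
      nlinarith [norm_nonneg x]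
    have hy1 : ‖y‖ = 1 := by
      have : form spherical y y = 1 := hy
      rw [form_eq, bil_spherical, real_inner_self_eq_norm_sq] at this
      nlinarith [norm_nonneg y]
    have h1 : (1 - t) • x = -(t • y) := by rw [eq_neg_iff_add_eq_zero]; exact h0
    have h2 := congrArg norm h1
    rw [norm_neg, norm_smul, norm_smul, hx1, hy1, Real.norm_eq_abs, Real.norm_eq_abs,
      abs_of_nonneg ht.1, abs_of_nonneg (by linarith [ht.2])] at h2
    have h3 : t = 1 / 2 := by linarith
    apply hne
    rw [h3] at h0
    have h4 : (2 : ℝ) • ((1 - 1 / 2 : ℝ) • x + (1 / 2 : ℝ) • y) = x + y := by module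
    rw [h0, smul_zero] at h4
    exact (neg_eq_of_add_eq_zero_right h4.symm).symm
  · have hx2 := carrier_subset_domain hx
    have hy2 := carrier_subset_domain hy
    have h := bil_neg_of_timelike hx2.1 hx2.2 hy2.1 hy2.2
    have hs : 0 ≤ 1 - t := by linarith [ht.2]
    have hxx : bil hyperbolic x x = -1 := by rw [bil_apply]; exact hx.1
    have hyy : bil hyperbolic y y = -1 := by rw [bil_apply]; exact hy.1
    have hpos : 0 < (1 - t) ^ 2 + t ^ 2 := by nlinarith [sq_nonneg (1 - 2 * t)]
    refine ⟨?_, ?_⟩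
    · simp only [bil_add_left, bil_add_right, bil_smul_left, bil_smul_right, bil_symm y x, hxx, hyy]
      nlinarith [mul_nonneg hs ht.1]
    · have e : ((1 - t) • x + t • y) 0 = (1 - t) * x 0 + t * y 0 := by simp
      rw [e]
      rcases ht.1.eq_or_lt with h0 | h0
      · rw [← h0]; simpa using hx2.2
      · have h1 := mul_pos h0 hy2.2
        have h2 := mul_nonneg hs hx2.2.le
        linarith

/-- The projection of a point of a chord is on the same side of a geodesic hyperplane through `m`
as this point. -/
lemma exists_bil_ambProj_chord {m N x y : Ambient n} {t : ℝ} (hN : rad S m N = 0)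
    (hx : x ∈ carrier S n) (hy : y ∈ carrier S n) (ht : chord x y t ∈ domain S n) :
    ∃ r : ℝ, 0 < r ∧ bil S N (ambProj S (chord x y t) - m) = r * bil S N (chord x y t - m) := by
  cases S
  · refine ⟨1, one_pos, ?_⟩
    have h0 : (chord x y t) 0 = 1 := by
      have h1 : x 0 = 1 := hx
      have h2 : y 0 = 1 := hy
      simp [chord, h1, h2]
    rw [ambProj_self (S := euclidean) h0, one_mul]
  · have h1 : 0 < bil spherical (chord x y t) (chord x y t) := ht
    refine ⟨(√(bil spherical (chord x y t) (chord x y t)))⁻¹,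
      inv_pos.2 (Real.sqrt_pos.2 h1), ?_⟩
    have h2 : bil spherical N m = 0 := by rw [bil_symm]; exact hN
    rw [bil_sub_right, bil_sub_right, h2, ambProj, bil_smul_right, sub_zero, sub_zero]
  · have h1 : 0 < -bil hyperbolic (chord x y t) (chord x y t) := by have := ht.1; linarith
    refine ⟨(√(-bil hyperbolic (chord x y t) (chord x y t)))⁻¹,
      inv_pos.2 (Real.sqrt_pos.2 h1), ?_⟩
    have h2 : bil hyperbolic N m = 0 := by rw [bil_symm]; exact hN
    rw [bil_sub_right, bil_sub_right, h2, ambProj, bil_smul_right, sub_zero, sub_zero]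

lemma chord_zero (x y : Ambient n) : chord x y 0 = x := by simp [chord]

lemma chord_one (x y : Ambient n) : chord x y 1 = y := by simp [chord]

lemma continuous_chord : Continuous fun z : Ambient n × Ambient n × ℝ => chord z.1 z.2.1 z.2.2 := by
  unfold chord; fun_prop

/-- The geodesic segment from `x` to `y` is contained in `K`. -/
def SegmentSubset (K : Set (Space S n)) (x y : Space S n) : Prop :=
  ∀ t ∈ Icc (0 : ℝ) 1, chord (x : Ambient n) y t ∈ domain S n ∧ proj S (chord (x : Ambient n) y t) ∈ K

lemma continuousAt_proj_chord {x y : Space S n} {t : ℝ}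
    (h : chord (x : Ambient n) y t ∈ domain S n) :
    ContinuousAt (fun z : Space S n × ℝ => proj S (chord (x : Ambient n) z.1 z.2)) (y, t) := by
  refine ContinuousAt.comp (g := proj S) (continuousAt_proj h) ?_
  have : Continuous fun z : Space S n × ℝ => chord (x : Ambient n) z.1 z.2 :=
    continuous_chord.comp (f := fun z : Space S n × ℝ => ((x : Ambient n), (z.1 : Ambient n), z.2))
      (by fun_prop)
  exact this.continuousAt

lemma continuousAt_proj_chord_right {x y : Space S n} {t : ℝ}
    (h : chord (x : Ambient n) y t ∈ domain S n) :
    ContinuousAt (fun s : ℝ => proj S (chord (x : Ambient n) y s)) t :=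
  ContinuousAt.comp (f := fun s : ℝ => (y, s)) (continuousAt_proj_chord h) (by fun_prop)

/-- A geodesic segment in `K` which starts in the interior of `K` meets the boundary at most at its
end, and transversally. -/
lemma SegmentSubset.inner {K : Set (Space S n)} (hloc : IsLocallyStrictlyConvex K) {x y : Space S n}
    (hx : x ∈ interior K) (h : SegmentSubset K x y) :
    (∀ t ∈ Ico (0 : ℝ) 1, proj S (chord (x : Ambient n) y t) ∈ interior K) ∧
      (y ∈ frontier K → ∃ F, IsDefFun K y F ∧ 0 < bil S (unitGrad S F y) ((x : Ambient n) - y)) := by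
  set g : ℝ → Space S n := fun t => proj S (chord (x : Ambient n) y t) with hg
  have hgc : ContinuousOn g (Icc 0 1) := fun t ht =>
    (continuousAt_proj_chord_right (h t ht).1).continuousWithinAt
  have hg0 : g 0 = x := by simp [hg, chord_zero, proj_coe]
  have hg1 : g 1 = y := by simp [hg, chord_one, proj_coe]
  -- at the first hit the support functional is positive before
  have key : ∀ t₀ ∈ Ioc (0 : ℝ) 1, g t₀ ∈ frontier K → (∀ t ∈ Ico 0 t₀, g t ∉ frontier K) →
      ∃ F, IsDefFun K (g t₀) F ∧ 0 < bil S (unitGrad S F (g t₀)) ((x : Ambient n) - g t₀) ∧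
        t₀ = 1 := by
    intro t₀ ht₀ hf hbef
    have ht₀' : t₀ ∈ Icc (0 : ℝ) 1 := ⟨ht₀.1.le, ht₀.2⟩
    obtain ⟨F, hF, hsup⟩ := hloc _ hf
    set N := unitGrad S F (g t₀)
    set m := g t₀ with hm
    -- The support functional is affine along the chord, and the projection rescales its value by a
    -- positive factor only. So its sign along the geodesic segment is that of an affine function.
    set A : ℝ → ℝ := fun t => bil S N (chord (x : Ambient n) y t - m) with hA
    have hAr : ∀ t ∈ Icc (0 : ℝ) 1, ∃ r : ℝ, 0 < r ∧ bil S N ((g t : Ambient n) - m) = r * A t := by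
      intro t ht
      rw [hg, coe_proj (h t ht).1]
      exact exists_bil_ambProj_chord hF.rad_unitGrad x.2 y.2 (h t ht).1
    have hA0 : A t₀ = 0 := by
      obtain ⟨r, hr, h1⟩ := hAr t₀ ht₀'
      rw [← hm, sub_self, map_zero] at h1
      exact (mul_eq_zero.1 h1.symm).resolve_left hr.ne'
    have hlin : ∀ t, A t = (t - t₀) * bil S N ((y : Ambient n) - x) := by
      intro t
      have h1 : A t - A t₀ = (t - t₀) * bil S N ((y : Ambient n) - x) := by
        simp only [hA]
        rw [← bil_sub_right, ← bil_smul_right]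
        congr 1
        simp only [chord]
        module
      rw [hA0, sub_zero] at h1
      exact h1
    have hAev : ∀ᶠ t in 𝓝 t₀, t ∈ Icc (0 : ℝ) 1 → g t ≠ m → 0 < A t := by
      have h1 : ContinuousAt g t₀ := continuousAt_proj_chord_right (h t₀ ht₀').1
      filter_upwards [h1.eventually hsup] with t h2 ht hne
      obtain ⟨r, hr, h3⟩ := hAr t ht
      have h4 := h2 (h t ht).2 hne
      rw [h3] at h4
      exact (mul_pos_iff_of_pos_left hr).1 h4
    have hbefore : bil S N ((y : Ambient n) - x) < 0 := by
      have h1 : ∀ᶠ t in 𝓝[<] t₀, t ∈ Ico 0 t₀ := by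
        filter_upwards [self_mem_nhdsWithin, mem_nhdsWithin_of_mem_nhds (Ioi_mem_nhds ht₀.1)]
          with t h1 h2
        exact ⟨(show 0 < t from h2).le, h1⟩
      obtain ⟨t, h2, h3⟩ := ((hAev.filter_mono nhdsWithin_le_nhds).and h1).exists
      have h4 := h2 ⟨h3.1, h3.2.le.trans ht₀.2⟩ (fun h5 => hbef t h3 (h5 ▸ hf))
      rw [hlin] at h4
      have h5 : t - t₀ < 0 := by linarith [h3.2]
      nlinarith
    refine ⟨F, hF, ?_, ?_⟩
    · have h1 := hlin 0
      simp only [hA, chord_zero] at h1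
      rw [h1]
      nlinarith [ht₀.1]
    -- Positive before its zero `t₀`, the affine function is negative after it, although the segment
    -- would still be in `K`.
    · by_contra hne
      have hlt : t₀ < 1 := lt_of_le_of_ne ht₀.2 hne
      have h1 : ∀ᶠ t in 𝓝[>] t₀, t₀ < t ∧ t < 1 := by
        filter_upwards [self_mem_nhdsWithin, mem_nhdsWithin_of_mem_nhds (Iio_mem_nhds hlt)]
          with t h1 h2 using ⟨h1, h2⟩
      obtain ⟨t, h2, h3, h4⟩ := ((hAev.filter_mono nhdsWithin_le_nhds).and h1).exists
      have ht : t ∈ Icc (0 : ℝ) 1 := ⟨ht₀.1.le.trans h3.le, h4.le⟩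
      have h5 : A t < 0 := by rw [hlin]; nlinarith
      by_cases h6 : g t = m
      · obtain ⟨r, hr, h7⟩ := hAr t ht
        rw [h6, sub_self, map_zero] at h7
        exact h5.ne ((mul_eq_zero.1 h7.symm).resolve_left hr.ne')
      · exact absurd (h2 ht h6) (not_lt.2 h5.le)
  have hcase : (∀ t ∈ Ico (0 : ℝ) 1, g t ∉ frontier K) := by
    intro t ht hf
    obtain ⟨t₀, h1, h2, h3⟩ := exists_first_hit hgc (by rwa [hg0]) ⟨t, Ico_subset_Icc_self ht, hf⟩
    obtain ⟨F, -, -, h4⟩ := key t₀ h1 h2 h3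
    exact h3 t ⟨ht.1, h4 ▸ ht.2⟩ hf
  refine ⟨fun t ht => mem_interior_of_not_mem_frontier (h t (Ico_subset_Icc_self ht)).2 (hcase t ht),
    fun hy => ?_⟩
  obtain ⟨F, h1, h2, -⟩ := key 1 (by simp) (by rwa [hg1]) hcase
  rw [hg1] at h1 h2
  exact ⟨F, h1, h2⟩

/-- The set of points of `K` which are visible from an interior point is open in `K`. -/
lemma SegmentSubset.eventually {K : Set (Space S n)} (hloc : IsLocallyStrictlyConvex K)
    {x y₀ : Space S n} (hx : x ∈ interior K) (h : SegmentSubset K x y₀) :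
    ∀ᶠ y in 𝓝 y₀, y ∈ K → SegmentSubset K x y := by
  obtain ⟨hin, hend⟩ := h.inner hloc hx
  have hloc : ∀ t₀ ∈ Icc (0 : ℝ) 1, ∀ᶠ z : Space S n × ℝ in 𝓝 (y₀, t₀), z.1 ∈ K →
      z.2 ∈ Icc (0 : ℝ) 1 → chord (x : Ambient n) z.1 z.2 ∈ domain S n ∧
        proj S (chord (x : Ambient n) z.1 z.2) ∈ K := by
    intro t₀ ht₀
    have hc := continuousAt_proj_chord (h t₀ ht₀).1
    have hcc : Continuous fun z : Space S n × ℝ => chord (x : Ambient n) z.1 z.2 :=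
      continuous_chord.comp
        (f := fun z : Space S n × ℝ => ((x : Ambient n), (z.1 : Ambient n), z.2)) (by fun_prop)
    by_cases hint : proj S (chord (x : Ambient n) y₀ t₀) ∈ interior K
    · filter_upwards [hc.eventually (isOpen_interior.mem_nhds hint),
        hcc.continuousAt.eventually (isOpen_domain.mem_nhds (h t₀ ht₀).1)] with z h1 h2 _ _
      exact ⟨h2, interior_subset h1⟩
    · have ht1 : t₀ = 1 := by
        by_contra hne
        exact hint (hin t₀ ⟨ht₀.1, lt_of_le_of_ne ht₀.2 hne⟩)
      subst ht1
      have hyK := (h 1 ht₀).2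
      rw [chord_one, proj_coe] at hint hyK
      obtain ⟨F, hF, hpos⟩ := hend (by
        by_contra h1
        exact hint (mem_interior_of_not_mem_frontier hyK h1))
      have hdc : ContinuousAt (fun z : Ambient n × Ambient n => fderiv ℝ F z.1 (x - z.2))
          ((y₀ : Ambient n), (y₀ : Ambient n)) := by
        have h1 : ContinuousAt (fderiv ℝ F) (y₀ : Ambient n) :=
          (hF.contDiffAt.fderiv_right (m := 1) (by norm_num)).continuousAt
        exact (ContinuousAt.comp (f := Prod.fst) (g := fderiv ℝ F) h1 continuousAt_fst).clm_apply
          (by fun_prop)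
      have hd0 : 0 < fderiv ℝ F y₀ ((x : Ambient n) - y₀) := by
        rw [hF.fderiv_eq]; exact mul_pos hF.sqrt_pos hpos
      obtain ⟨r₁, hr₁, hb₁⟩ :=
        Metric.eventually_nhds_iff_ball.1 (hdc.eventually (lt_mem_nhds hd0))
      obtain ⟨r₂, hr₂, hb₂⟩ := Metric.eventually_nhds_iff_ball.1
        ((hF.contDiffAt.eventually (by simp)).and (hF.mem_iff.and (eventually_domain y₀)))
      set r := min r₁ r₂
      have hr : 0 < r := lt_min hr₁ hr₂
      have hb1 : ∀ z ∈ Metric.ball (y₀ : Ambient n) r, ∀ w ∈ Metric.ball (y₀ : Ambient n) r,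
          0 < fderiv ℝ F z (x - w) := by
        intro z hz w hw
        refine hb₁ (z, w) ?_
        rw [← ball_prod_same]
        exact ⟨Metric.ball_subset_ball (min_le_left _ _) hz,
          Metric.ball_subset_ball (min_le_left _ _) hw⟩
      have hb2 : ∀ z ∈ Metric.ball (y₀ : Ambient n) r, _ :=
        fun z hz => hb₂ z (Metric.ball_subset_ball (min_le_right _ _) hz)
      have he1 : ∀ᶠ z : Space S n × ℝ in 𝓝 (y₀, 1),
          (z.1 : Ambient n) ∈ Metric.ball (y₀ : Ambient n) r :=
        (continuous_subtype_val.comp continuous_fst).continuousAt.eventually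
          (Metric.ball_mem_nhds _ hr)
      have he2 : ∀ᶠ z : Space S n × ℝ in 𝓝 (y₀, 1),
          chord (x : Ambient n) z.1 z.2 ∈ Metric.ball (y₀ : Ambient n) r := by
        refine hcc.continuousAt.eventually ?_
        simp only [chord_one]
        exact Metric.ball_mem_nhds _ hr
      filter_upwards [he1, he2] with ⟨y, t⟩ h2 h3 hyK' ht
      simp only at h2 h3 hyK' ht ⊢
      have hch : chord (x : Ambient n) y t = y + (1 - t) • ((x : Ambient n) - y) := by
        rw [chord]; module
      have hline : ∀ s ∈ Icc (0 : ℝ) (1 - t),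
          (y : Ambient n) + s • ((x : Ambient n) - y) ∈ Metric.ball (y₀ : Ambient n) r := by
        intro s hs
        rcases (show (0 : ℝ) ≤ 1 - t by linarith [ht.2]).eq_or_lt with h0 | h0
        · have : s = 0 := le_antisymm (h0 ▸ hs.2) hs.1
          simpa [this] using h2
        · have h4 := (convex_ball (y₀ : Ambient n) r) h2 h3
            (show 0 ≤ 1 - s / (1 - t) by
              rw [sub_nonneg, div_le_one h0]; exact hs.2)
            (show 0 ≤ s / (1 - t) from div_nonneg hs.1 h0.le) (by ring)
          rw [hch] at h4
          convert h4 using 1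
          rw [smul_add, smul_smul, div_mul_cancel₀ _ h0.ne']
          module
      -- Near the end point `F` increases from `y` towards `x`, by transversality. Thus `0 ≤ F y`
      -- propagates to the last piece of the chord.
      have hmono := strictMonoOn_line (f := F) (z := y) (v := (x : Ambient n) - y) (a := 0)
        (b := 1 - t) (fun s hs => ⟨(hb2 _ (hline s hs)).1.differentiableAt two_ne_zero,
          hb1 _ (hline s hs) _ h2⟩)
      have h5 := hmono.monotoneOn (left_mem_Icc.2 (by linarith [ht.2]))
        (right_mem_Icc.2 (by linarith [ht.2])) (by linarith [ht.2])
      simp only [zero_smul, add_zero] at h5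
      rw [← hch] at h5
      have h6 := (hb2 _ h2).2.1
      rw [proj_coe] at h6
      have h7 := hb2 _ h3
      exact ⟨h7.2.2, h7.2.1.2 ((h6.1 hyK').trans h5)⟩
  have := isCompact_Icc.eventually_forall_of_forall_eventually (x₀ := y₀)
    (P := fun (y : Space S n) (t : ℝ) => y ∈ K → t ∈ Icc (0 : ℝ) 1 →
      chord (x : Ambient n) y t ∈ domain S n ∧ proj S (chord (x : Ambient n) y t) ∈ K) hloc
  filter_upwards [this] with y hy hyK t ht using hy t ht hyK ht

lemma segmentSubset_self {K : Set (Space S n)} {x : Space S n} (hx : x ∈ K) :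
    SegmentSubset K x x := by
  intro t _
  have : chord (x : Ambient n) x t = x := by simp [chord]
  rw [this, proj_coe]
  exact ⟨coe_mem_domain x, hx⟩

/-- Visibility is a closed condition away from the antipode. -/
lemma isClosed_visible {K : Set (Space S n)} (hK : IsClosed K) {x y : Space S n}
    (hy : (y : Ambient n) ≠ -x) (h : ∃ᶠ z in 𝓝 y, SegmentSubset K x z) : SegmentSubset K x y := by
  intro t ht
  have hd := chord_mem_domain x.2 y.2 hy ht
  refine ⟨hd, ?_⟩
  have hc : ContinuousAt (fun z : Space S n => proj S (chord (x : Ambient n) z t)) y :=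
    ContinuousAt.comp (f := fun z : Space S n => (z, t)) (continuousAt_proj_chord hd) (by fun_prop)
  have h1 : ∃ᶠ z : Space S n in 𝓝 y, proj S (chord (x : Ambient n) z t) ∈ K := h.mono fun z hz => (hz t ht).2
  exact hK.mem_of_frequently_of_tendsto h1 hc

/-- If visibility from `x` is a closed condition, then all of `K` is visible. -/
lemma segmentSubset_of_closed {K : Set (Space S n)}
    (hloc : IsLocallyStrictlyConvex K) (hconn : IsConnected K) {x : Space S n}
    (hx : x ∈ interior K)
    (hcl : ∀ y ∈ K, (∃ᶠ z in 𝓝 y, SegmentSubset K x z) → SegmentSubset K x y) :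
    ∀ y ∈ K, SegmentSubset K x y := by
  have : PreconnectedSpace K := isPreconnected_iff_preconnectedSpace.1 hconn.isPreconnected
  have hclopen : IsClopen {y : K | SegmentSubset K x y} := by
    constructor
    · rw [isClosed_iff_frequently]
      intro y hy
      exact hcl y y.2 (continuous_subtype_val.continuousAt.tendsto.frequently hy)
    · rw [isOpen_iff_mem_nhds]
      intro y hy
      have hy' : SegmentSubset K x y := hy
      filter_upwards [continuous_subtype_val.continuousAt.eventually (hy'.eventually hloc hx)]
        with z hz
      exact hz z.2
  have hxK := interior_subset hx
  have huniv := hclopen.eq_univ ⟨⟨x, hxK⟩, segmentSubset_self hxK⟩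
  intro y hy
  exact (huniv ▸ mem_univ (⟨y, hy⟩ : K) : (⟨y, hy⟩ : K) ∈ _)

/-! ### Antipodal points on the sphere. -/

lemma mem_domain_spherical {y : Ambient n} : y ∈ domain spherical n ↔ y ≠ 0 := by
  show 0 < bil spherical y y ↔ _
  rw [bil_spherical, real_inner_self_pos]

lemma proj_smul_spherical {r : ℝ} (hr : 0 < r) {z : Ambient n} (hz : z ≠ 0) :
    proj spherical (r • z) = proj spherical z := by
  have h1 : r • z ≠ 0 := smul_ne_zero hr.ne' hz
  apply Subtype.ext
  rw [coe_proj (mem_domain_spherical.2 h1), coe_proj (mem_domain_spherical.2 hz)]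
  simp only [ambProj, bil_smul_left, bil_smul_right, smul_smul]
  congr 1
  rw [← mul_assoc, Real.sqrt_mul (by positivity), Real.sqrt_mul_self hr.le, mul_inv]
  field_simp

/-- The great circle through `x` in direction `v`. -/
noncomputable def circle {n : ℕ} (x v : Ambient n) (θ : ℝ) : Ambient n :=
  Real.cos θ • x + Real.sin θ • v

lemma circle_ne_zero {x v : Ambient n} (hx : x ≠ 0) (hv : v ≠ 0)
    (hxv : bil spherical x v = 0) (θ : ℝ) : circle x v θ ≠ 0 := by
  intro h
  have h1 : bil spherical (circle x v θ) x = 0 := by rw [h]; simp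
  have h2 : bil spherical (circle x v θ) v = 0 := by rw [h]; simp
  rw [circle, bil_add_left, bil_smul_left, bil_smul_left, bil_symm v x, hxv, mul_zero, add_zero] at h1
  rw [circle, bil_add_left, bil_smul_left, bil_smul_left, hxv, mul_zero, zero_add] at h2
  rw [bil_spherical] at h1 h2
  have h3 := (mul_eq_zero.1 h1).resolve_right (real_inner_self_pos.2 hx).ne'
  have h4 := (mul_eq_zero.1 h2).resolve_right (real_inner_self_pos.2 hv).ne'
  have := Real.sin_sq_add_cos_sq θ
  rw [h3, h4] at this
  norm_num at this

lemma coe_ne_zero_spherical (x : Space spherical n) : (x : Ambient n) ≠ 0 :=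
  mem_domain_spherical.1 (coe_mem_domain x)

lemma continuous_circle (x : Ambient n) :
    Continuous fun z : Ambient n × ℝ => circle x z.1 z.2 := by
  unfold circle; fun_prop

/-- On a great circle a linear functional is a sinusoid, hence odd about each of its zeros. At a
boundary point the local support would make it positive just before and nonnegative just after,
which is impossible; the end points cause no trouble because they are interior to `K`. -/
lemma circle_interior {K : Set (Space spherical n)} (hloc : IsLocallyStrictlyConvex K)
    {x x' : Space spherical n} (hx : x ∈ interior K) (hx' : x' ∈ interior K)
    (hxx' : (x' : Ambient n) = -x) {v : Ambient n} (hv : v ≠ 0)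
    (hxv : bil spherical (x : Ambient n) v = 0)
    (h : ∀ θ ∈ Icc 0 Real.pi, proj spherical (circle (x : Ambient n) v θ) ∈ K) :
    ∀ θ ∈ Icc 0 Real.pi, proj spherical (circle (x : Ambient n) v θ) ∈ interior K := by
  set g : ℝ → Space spherical n := fun θ => proj spherical (circle (x : Ambient n) v θ) with hg
  have hdom : ∀ θ, circle (x : Ambient n) v θ ∈ domain spherical n := fun θ =>
    mem_domain_spherical.2 (circle_ne_zero (coe_ne_zero_spherical x) hv hxv θ)
  have hgc : Continuous g := by
    refine continuous_iff_continuousAt.2 fun θ => ?_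
    refine ContinuousAt.comp (g := proj spherical) (continuousAt_proj (hdom θ)) ?_
    unfold circle; fun_prop
  have hg0 : g 0 = x := by simp [hg, circle, proj_coe]
  have hgpi : g Real.pi = x' := by simp [hg, circle, ← hxx', proj_coe]
  have hnot : ∀ θ ∈ Icc 0 Real.pi, g θ ∉ frontier K := by
    by_contra! hcon
    obtain ⟨t₀, ht₀, hf, hbef⟩ := exists_first_hit hgc.continuousOn (by rwa [hg0]) hcon
    have hlt : t₀ < Real.pi := by
      refine lt_of_le_of_ne ht₀.2 ?_
      rintro rfl
      rw [hgpi] at hf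
      exact hf.2 hx'
    obtain ⟨F, hF, hsup⟩ := hloc _ hf
    set N := unitGrad spherical F (g t₀)
    have hNm : bil spherical N (g t₀) = 0 := by rw [bil_symm]; exact hF.rad_unitGrad
    set B : ℝ → ℝ := fun θ => bil spherical N (circle (x : Ambient n) v θ) with hB
    have hBr : ∀ θ, ∃ r : ℝ, 0 < r ∧ bil spherical N ((g θ : Ambient n) - g t₀) = r * B θ := by
      intro θ
      have h1 : 0 < bil spherical (circle (x : Ambient n) v θ) (circle (x : Ambient n) v θ) := hdom θ
      refine ⟨_, inv_pos.2 (Real.sqrt_pos.2 h1), ?_⟩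
      rw [bil_sub_right, hNm, sub_zero, hg, coe_proj (hdom θ), ambProj, bil_smul_right]
    have hB0 : B t₀ = 0 := by
      obtain ⟨r, hr, h1⟩ := hBr t₀
      rw [sub_self, map_zero] at h1
      exact (mul_eq_zero.1 h1.symm).resolve_left hr.ne'
    have hBev : ∀ᶠ t in 𝓝 t₀, (t ∈ Icc 0 Real.pi → g t ≠ g t₀ → 0 < B t) ∧ t ∈ Ioo 0 Real.pi := by
      filter_upwards [hgc.continuousAt.eventually hsup, Ioo_mem_nhds ht₀.1 hlt] with t h2 h3
      refine ⟨fun ht hne => ?_, h3⟩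
      obtain ⟨r, hr, h3⟩ := hBr t
      have h4 := h2 (h t ht) hne
      rw [h3] at h4
      exact (mul_pos_iff_of_pos_left hr).1 h4
    obtain ⟨r, hr, hball⟩ := Metric.eventually_nhds_iff_ball.1 hBev
    have h1 := hball (t₀ - r / 2) (by
      rw [Metric.mem_ball, Real.dist_eq, abs_lt]; constructor <;> linarith)
    have h2 := hball (t₀ + r / 2) (by
      rw [Metric.mem_ball, Real.dist_eq, abs_lt]; constructor <;> linarith)
    have h3 : 0 < B (t₀ - r / 2) := h1.1 (Ioo_subset_Icc_self h1.2)
      (fun h5 => hbef _ ⟨h1.2.1.le, by linarith⟩ (h5 ▸ hf))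
    have h4 : 0 ≤ B (t₀ + r / 2) := by
      by_cases h6 : g (t₀ + r / 2) = g t₀
      · obtain ⟨r', hr', h7⟩ := hBr (t₀ + r / 2)
        rw [h6, sub_self, map_zero] at h7
        exact ((mul_eq_zero.1 h7.symm).resolve_left hr'.ne').ge
      · exact (h2.1 (Ioo_subset_Icc_self h2.2) h6).le
    -- The addition formulas express oddness of the sinusoid about its zero `t₀`.
    have h5 : B (t₀ - r / 2) + B (t₀ + r / 2) = 2 * Real.cos (r / 2) * B t₀ := by
      simp only [hB, circle, bil_add_right, bil_smul_right, Real.cos_add, Real.sin_add,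
        Real.cos_sub, Real.sin_sub]
      ring
    rw [hB0, mul_zero] at h5
    linarith
  exact fun θ hθ => mem_interior_of_not_mem_frontier (h θ hθ) (hnot θ hθ)

/-- If `K` contains all geodesic half circles between two antipodal points, it is the sphere. -/
lemma eq_univ_of_circles {K : Set (Space spherical n)} {x x' : Space spherical n} (hx : x ∈ K)
    (hx' : x' ∈ K) (hxx' : (x' : Ambient n) = -x)
    (h : ∀ v : Ambient n, v ≠ 0 → bil spherical (x : Ambient n) v = 0 → ∀ θ ∈ Icc 0 Real.pi,
      proj spherical (circle (x : Ambient n) v θ) ∈ K) : K = univ := by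
  refine eq_univ_of_forall fun y => ?_
  have hxx : bil spherical (x : Ambient n) x = 1 := by rw [bil_apply]; exact x.2
  have hyy : bil spherical (y : Ambient n) y = 1 := by rw [bil_apply]; exact y.2
  set α := bil spherical (x : Ambient n) y with hα
  set v := (y : Ambient n) - α • (x : Ambient n) with hv
  have hxv : bil spherical (x : Ambient n) v = 0 := by
    rw [hv, bil_sub_right, bil_smul_right, hxx, ← hα]; ring
  by_cases hv0 : v = 0
  · rw [hv, sub_eq_zero] at hv0
    have h1 : α ^ 2 = 1 := by
      rw [hv0, bil_smul_left, bil_smul_right, hxx] at hyy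
      linarith
    rcases sq_eq_sq_iff_eq_or_eq_neg.1 (h1.trans (one_pow (M := ℝ) 2).symm) with h2 | h2
    · rw [h2, one_smul] at hv0
      rwa [Subtype.ext hv0]
    · rw [h2, neg_one_smul, ← hxx'] at hv0
      rwa [Subtype.ext hv0]
  -- This factor makes `s * α` and `s` the cosine and sine of one angle, at which the circle passes
  -- through `s • y`.
  · set s := (√(1 + α ^ 2))⁻¹ with hs
    have hpos : 0 < 1 + α ^ 2 := by positivity
    have hs0 : 0 < s := inv_pos.2 (Real.sqrt_pos.2 hpos)
    have hs2 : s ^ 2 * (1 + α ^ 2) = 1 := by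
      rw [hs, inv_pow, Real.sq_sqrt hpos.le]; field_simp
    have hle : (s * α) ^ 2 ≤ 1 := by nlinarith [sq_nonneg s]
    have hab := abs_le_one_iff_mul_self_le_one.2 ((sq (s * α)).symm.trans_le hle)
    have hcos : Real.cos (Real.arccos (s * α)) = s * α :=
      Real.cos_arccos (abs_le.1 hab).1 (abs_le.1 hab).2
    have hsin : Real.sin (Real.arccos (s * α)) = s := by
      rw [Real.sin_arccos, show 1 - (s * α) ^ 2 = s ^ 2 by linarith, Real.sqrt_sq hs0.le]
    have h1 := h v hv0 hxv (Real.arccos (s * α)) ⟨Real.arccos_nonneg _, Real.arccos_le_pi _⟩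
    have h2 : circle (x : Ambient n) v (Real.arccos (s * α)) = s • (y : Ambient n) := by
      rw [circle, hcos, hsin, hv]; module
    rwa [h2, proj_smul_spherical hs0 (coe_ne_zero_spherical y), proj_coe] at h1

/-- A connected, locally strictly convex proper subset of the sphere has no antipodal interior
points. -/
lemma not_antipodal_interior (hn : 1 ≤ n) {K : Set (Space spherical n)} (hK : IsClosed K)
    (hconn : IsConnected K) (hproper : K ≠ univ) (hloc : IsLocallyStrictlyConvex K)
    {x x' : Space spherical n} (hx : x ∈ interior K) (hx' : x' ∈ interior K) :
    (x' : Ambient n) ≠ -x := by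
  intro hxx'
  apply hproper
  have hxx : bil spherical (x : Ambient n) x = 1 := by rw [bil_apply]; exact x.2
  have hnx' : ¬ SegmentSubset K x x' := by
    intro h
    have h1 := (h (1 / 2) (by norm_num)).1
    rw [mem_domain_spherical, hxx', chord] at h1
    apply h1
    module
  -- points near the antipode are visible
  have hfreq : ∃ᶠ y in 𝓝 x', SegmentSubset K x y := by
    by_contra hcon
    rw [not_frequently] at hcon
    -- If no point near the antipode were visible, visibility would be a closed condition in `K`, so
    -- the antipode itself would be visible; but its chord passes through the origin.
    refine hnx' (segmentSubset_of_closed hloc hconn hx (fun y hy hfr => ?_) x'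
      (interior_subset hx'))
    by_cases hyx : y = x'
    · subst hyx
      exact absurd hcon hfr
    · exact isClosed_visible hK (fun h => hyx (Subtype.ext (h.trans hxx'.symm))) hfr
  have hnear : ∀ᶠ z in 𝓝 (x' : Ambient n), proj spherical z ∈ K :=
    ((tendsto_proj x').eventually (isOpen_interior.mem_nhds hx')).mono
      fun z hz => interior_subset hz
  obtain ⟨r, hr, hball⟩ := Metric.eventually_nhds_iff_ball.1 hnear
  have hne : x' ≠ x := by
    rintro rfl
    have h := congrArg (bil spherical (x' : Ambient n)) hxx'
    rw [map_neg, hxx] at h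
    norm_num at h
  obtain ⟨y, ⟨hy, hyr⟩, hyx⟩ := ((hfreq.and_eventually
    (continuous_subtype_val.continuousAt.eventually
    (Metric.ball_mem_nhds (x' : Ambient n) hr))).and_eventually (eventually_ne_nhds hne)).exists
  have hyne : (y : Ambient n) ≠ x' := fun h => hnx' (Subtype.ext h ▸ hy)
  have hynx : (y : Ambient n) ≠ -x := by rwa [← hxx']
  have hyy : bil spherical (y : Ambient n) y = 1 := by rw [bil_apply]; exact y.2
  set α := bil spherical (x : Ambient n) y with hα
  set v₀ := (y : Ambient n) - α • (x : Ambient n) with hv₀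
  have hdir : ∃ v : Ambient n, v ≠ 0 ∧ bil spherical (x : Ambient n) v = 0 ∧
      ∀ θ ∈ Icc 0 Real.pi, proj spherical (circle (x : Ambient n) v θ) ∈ K := by
    by_cases hv0 : v₀ = 0
    · exfalso
      rw [hv₀, sub_eq_zero] at hv0
      have h1 : α ^ 2 = 1 := by
        rw [hv0, bil_smul_left, bil_smul_right, hxx] at hyy
        linarith
      rcases sq_eq_sq_iff_eq_or_eq_neg.1 (h1.trans (one_pow (M := ℝ) 2).symm) with h2 | h2
      · exact hyx (Subtype.ext (by rw [hv0, h2, one_smul]))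
      · exact hynx (by rw [hv0, h2, neg_one_smul])
    have hxv : bil spherical (x : Ambient n) v₀ = 0 := by
      rw [hv₀, bil_sub_right, bil_smul_right, hxx, ← hα]; ring
    refine ⟨v₀, hv0, hxv, fun θ hθ => ?_⟩
    have hsin := Real.sin_nonneg_of_nonneg_of_le_pi hθ.1 hθ.2
    have hc0 := circle_ne_zero (coe_ne_zero_spherical x) hv0 hxv θ
    set a := Real.cos θ - α * Real.sin θ with ha
    have hceq : circle (x : Ambient n) v₀ θ = a • (x : Ambient n) + Real.sin θ • (y : Ambient n) := by
      rw [circle, hv₀, ha]; module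
    -- For `0 ≤ a` the point lies on the visible arc from `x` to `y`. For `a < 0` it lies on the arc
    -- from `y` to `x'`, which stays in the cone over a small ball about `x'`.
    rcases le_or_gt 0 a with h0 | h0
    · have hpos : 0 < a + Real.sin θ := by
        refine lt_of_le_of_ne (add_nonneg h0 hsin) fun h1 => hc0 ?_
        have h2 : a = 0 := by linarith
        have h3 : Real.sin θ = 0 := by linarith
        rw [hceq, h2, h3]; simp
      set t := Real.sin θ / (a + Real.sin θ) with ht
      have htm : t ∈ Icc (0 : ℝ) 1 :=
        ⟨div_nonneg hsin hpos.le, (div_le_one hpos).2 (by linarith)⟩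
      have h1 : circle (x : Ambient n) v₀ θ = (a + Real.sin θ) • chord (x : Ambient n) y t := by
        rw [hceq, chord, smul_add, smul_smul, ht, mul_div_cancel₀ _ hpos.ne']
        module
      rw [h1, proj_smul_spherical hpos (mem_domain_spherical.1 (hy t htm).1)]
      exact (hy t htm).2
    · have hpos : 0 < -a + Real.sin θ := by linarith
      have h1 : (-a + Real.sin θ)⁻¹ • circle (x : Ambient n) v₀ θ ∈
          Metric.ball (x' : Ambient n) r := by
        have h2 := (convex_ball (x' : Ambient n) r) (Metric.mem_ball_self hr) hyr
          (show 0 ≤ (-a + Real.sin θ)⁻¹ * (-a) from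
            mul_nonneg (inv_pos.2 hpos).le (by linarith))
          (show 0 ≤ (-a + Real.sin θ)⁻¹ * Real.sin θ from mul_nonneg (inv_pos.2 hpos).le hsin)
          (by field_simp)
        convert h2 using 1
        rw [hceq, hxx']
        module
      have h2 := hball _ h1
      rwa [proj_smul_spherical (inv_pos.2 hpos) hc0] at h2
  -- the set of good directions is open and closed
  set W := LinearMap.ker (bil spherical (x : Ambient n) : Ambient n →ₗ[ℝ] ℝ) with hW
  set V : Set W := {w | ∀ θ ∈ Icc 0 Real.pi, proj spherical (circle (x : Ambient n) w θ) ∈ K}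
  have hWc : IsPreconnected ({0}ᶜ : Set W) := by
    refine (isConnected_compl_singleton_of_one_lt_rank ?_ 0).isPreconnected
    have h1 := LinearMap.finrank_range_add_finrank_ker
      (bil spherical (x : Ambient n) : Ambient n →ₗ[ℝ] ℝ)
    have h2 := Submodule.finrank_le (LinearMap.range
      (bil spherical (x : Ambient n) : Ambient n →ₗ[ℝ] ℝ))
    simp only [finrank_euclideanSpace, Fintype.card_fin, Module.finrank_self] at h1 h2
    rw [← Module.finrank_eq_rank]
    have h3 : 1 < Module.finrank ℝ W := by rw [hW]; omega
    exact_mod_cast h3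
  have hcont : ∀ w : W, w ≠ 0 → ∀ θ, ContinuousAt
      (fun z : W × ℝ => proj spherical (circle (x : Ambient n) z.1 z.2)) (w, θ) := by
    intro w hw θ
    have h1 := circle_ne_zero (coe_ne_zero_spherical x) (v := (w : Ambient n))
      (fun h => hw (Subtype.ext h)) w.2 θ
    refine ContinuousAt.comp (g := proj spherical)
      (continuousAt_proj (mem_domain_spherical.2 h1)) ?_
    exact ((continuous_circle (x : Ambient n)).comp
      (f := fun z : W × ℝ => ((z.1 : Ambient n), z.2)) (by fun_prop)).continuousAt
  refine eq_univ_of_circles (interior_subset hx) (interior_subset hx') hxx' ?_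
  by_contra! hcon
  obtain ⟨v₁, hv₁, hxv₁, θ₁, hθ₁, hnot⟩ := hcon
  obtain ⟨v₂, hv₂, hxv₂, hV₂⟩ := hdir
  obtain ⟨w, hw0, hwf⟩ := exists_mem_frontier_of_isPreconnected hWc (K := V)
    (x := ⟨v₂, hxv₂⟩) (y := ⟨v₁, hxv₁⟩) (fun h => hv₂ (congrArg Subtype.val h)) hV₂
    (fun h => hv₁ (congrArg Subtype.val h)) (fun h => hnot (h θ₁ hθ₁))
  have hw0' : w ≠ 0 := hw0
  -- A frontier direction is impossible either way: a good half circle lies in the interior of `K`,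
  -- so by compactness its neighbours are good; a bad one has bad neighbours because `K` is closed.
  by_cases hwV : w ∈ V
  · apply hwf.2
    rw [mem_interior_iff_mem_nhds]
    have h1 := circle_interior hloc hx hx' hxx' (v := (w : Ambient n))
      (fun h => hw0' (Subtype.ext h)) w.2 hwV
    have h2 : ∀ᶠ w' in 𝓝 w, ∀ θ ∈ Icc 0 Real.pi,
        proj spherical (circle (x : Ambient n) (w' : W) θ) ∈ interior K :=
      isCompact_Icc.eventually_forall_of_forall_eventually fun θ hθ =>
        (hcont w hw0' θ).eventually (isOpen_interior.mem_nhds (h1 θ hθ))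
    filter_upwards [h2] with w' h3 θ hθ using interior_subset (h3 θ hθ)
  · have h1 : ∃ θ ∈ Icc 0 Real.pi, proj spherical (circle (x : Ambient n) w θ) ∉ K := by
      by_contra! h
      exact hwV h
    obtain ⟨θ, hθ, h2⟩ := h1
    have h3 : ContinuousAt (fun w' : W => proj spherical (circle (x : Ambient n) w' θ)) w :=
      ContinuousAt.comp (f := fun w' : W => (w', θ)) (hcont w hw0' θ) (by fun_prop)
    have h4 := h3.eventually (hK.isOpen_compl.mem_nhds h2)
    obtain ⟨w', h5, h6⟩ := ((mem_closure_iff_frequently.1 hwf.1).and_eventually h4).exists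
    exact h6 (h5 θ hθ)

/-- The points of `K` are not antipodal to interior points of `K`. -/
lemma ne_neg_of_mem_interior (hn : 1 ≤ n) {K : Set (Space S n)} (hK : IsClosed K)
    (hconn : IsConnected K) (hproper : K ≠ univ) (hloc : IsLocallyStrictlyConvex K)
    {x y : Space S n} (hx : x ∈ interior K) (hy : y ∈ K) : (y : Ambient n) ≠ -x := by
  intro hyx
  cases S
  · have h1 : (x : Ambient n) 0 = 1 := x.2
    have h2 : (y : Ambient n) 0 = 1 := y.2
    rw [hyx] at h2
    simp [h1] at h2
    norm_num at h2
  · by_cases hyf : y ∈ frontier K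
    · obtain ⟨F, hF, -⟩ := hloc y hyf
      have hneg : ∀ z : Space spherical n, -(z : Ambient n) ∈ carrier spherical n := by
        intro z
        have : form spherical (z : Ambient n) z = 1 := z.2
        show form spherical _ _ = 1
        rw [form_eq] at this ⊢
        simpa using this
      set ng : Space spherical n → Space spherical n := fun z => ⟨-z, hneg z⟩ with hng
      have hngc : Continuous ng := by
        refine Continuous.subtype_mk ?_ _
        exact continuous_subtype_val.neg
      have hngy : ng y = x := Subtype.ext (by simp [hng, hyx])
      -- A boundary point antipodal to an interior point can be moved slightly into the interior
      -- while its antipode stays interior.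
      obtain ⟨z, hz1, hz2⟩ := ((mem_closure_iff_frequently.1
        (IsDefFun.mem_closure_interior hyf hF)).and_eventually (hngc.continuousAt.eventually
          (isOpen_interior.mem_nhds (by rwa [hngy])))).exists
      exact not_antipodal_interior hn hK hconn hproper hloc hz2 hz1 (by simp [hng])
    · exact not_antipodal_interior hn hK hconn hproper hloc hx
        (mem_interior_of_not_mem_frontier hy hyf) hyx
  · have h1 : 0 < (x : Ambient n) 0 := x.2.2
    have h2 : 0 < (y : Ambient n) 0 := y.2.2
    rw [hyx] at h2
    simp at h2
    linarith

/-- Local strict convexity implies convexity: `K` is on one side of each geodesic hyperplane tangent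
to its boundary. -/
lemma bil_sub_nonneg (hn : 1 ≤ n) {K : Set (Space S n)} (hK : IsClosed K)
    (hconn : IsConnected K) (hproper : K ≠ univ) (hloc : IsLocallyStrictlyConvex K)
    (hcl : closure (interior K) = K) {p : Space S n} (hp : p ∈ frontier K) {F : Ambient n → ℝ}
    (hF : IsDefFun K p F) {x : Space S n} (hx : x ∈ K) :
    0 ≤ bil S (unitGrad S F p) ((x : Ambient n) - p) := by
  have hint : ∀ x ∈ interior K, 0 ≤ bil S (unitGrad S F p) ((x : Ambient n) - p) := by
    intro x hx
    have h1 := segmentSubset_of_closed hloc hconn hx (fun y hy hfr =>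
      isClosed_visible hK (ne_neg_of_mem_interior hn hK hconn hproper hloc hx hy) hfr) p
      (hK.frontier_subset hp)
    obtain ⟨G, hG, h2⟩ := (h1.inner hloc hx).2 hp
    rw [← hF.eq_unitGrad hp (hG.isInwardUnitNormalAt hp)]
    exact h2.le
  have hclosed : IsClosed {x : Space S n | 0 ≤ bil S (unitGrad S F p) ((x : Ambient n) - p)} := by
    refine isClosed_le continuous_const ?_
    exact (bil S (unitGrad S F p)).continuous.comp (continuous_subtype_val.sub continuous_const)
  rw [← hcl] at hx
  exact closure_minimal hint hclosed hx

/-! ### Rolling: every tangent umbilic side contains `K`. -/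

lemma curv_pow_three : curv S ^ 3 = curv S := by
  cases S <;> norm_num [curv]

lemma continuousOn_normal {K : Set (Space S n)} {ν : Space S n → Ambient n}
    (hdef : ∀ p ∈ frontier K, ∃ F, IsDefFun K p F) (hν : IsInwardUnitNormal K ν) :
    ContinuousOn ν (frontier K) := by
  intro p hp
  obtain ⟨F, hF⟩ := hdef p hp
  have h1 : ContinuousAt (fun q : Space S n => unitGrad S F q) p :=
    ContinuousAt.comp (g := unitGrad S F) hF.contDiffAt_unitGrad.continuousAt
      continuous_subtype_val.continuousAt
  refine h1.continuousWithinAt.congr_of_eventuallyEq ?_ (hF.normal_eq hν hp)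
  rw [EventuallyEq, eventually_nhdsWithin_iff]
  filter_upwards [hF.eventually_normal_eq hν] with q h2 h3 using (h2 h3).symm

lemma bil_sub_self_nonneg (x p : Space S n) :
    0 ≤ bil S ((x : Ambient n) - (p : Ambient n)) (x - p) := by
  by_cases h : (x : Ambient n) = p
  · simp [h]
  · exact (bil_sub_self_pos x.2 p.2 h).le

/-- The derivative of `gap` along a hypersurface and its unit normal. -/
lemma hasDerivAt_gap_normal {mu t : ℝ} {G g : ℝ → Ambient n} {G' g' x : Ambient n}
    (hG : HasDerivAt G G' t) (hg : HasDerivAt g g' t) (h : bil S (G t) g' = 0) :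
    HasDerivAt (fun s => gap S mu (G s) (g s) x) (bil S (G' + mu • g') (x - g t)) t := by
  have h1 := hg.const_sub x
  have h2 := (hasDerivAt_bil (S := S) hG h1).sub
    ((hasDerivAt_bil (S := S) h1 h1).const_mul (mu / 2))
  refine h2.congr_deriv ?_
  simp only [map_neg, FunLike.coe_neg, Pi.neg_apply, bil_add_left, bil_smul_left, h,
    bil_symm (x - g t) g']
  ring

namespace IsDefFun

variable {K : Set (Space S n)} {p : Space S n} {F : Ambient n → ℝ}

/-- Along a curve in the boundary, the normal and the velocity are orthogonal. -/
lemma eventually_bil_unitGrad_deriv (hF : IsDefFun K p F) {γ : ℝ → Space S n} {X : Ambient n}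
    (h0 : γ 0 = p) (h1 : HasDerivAt (fun s => (γ s : Ambient n)) X 0)
    (h2 : ∀ᶠ t in 𝓝 (0 : ℝ), γ t ∈ frontier K) :
    ∀ᶠ t in 𝓝 (0 : ℝ), ∀ Z, HasDerivAt (fun s => (γ s : Ambient n)) Z t →
      bil S (unitGrad S F (γ t)) Z = 0 := by
  filter_upwards [(tendsto_of_hasDerivAt_coe h0 h1).eventually hF.toIsFrontierFun.eventually,
    h2.eventually_nhds] with t h3 h4 Z hZ
  refine ((h3.isTangent_iff h4.self_of_nhds).1 ⟨fun s => γ (t + s), by simp, ?_, ?_⟩).2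
  · exact HasDerivAt.comp_const_add t 0 (by simpa using hZ)
  · have h5 : Tendsto (fun s : ℝ => t + s) (𝓝 0) (𝓝 t) := by
      have : Continuous fun s : ℝ => t + s := by fun_prop
      simpa using this.tendsto 0
    exact h5.eventually h4

/-- The conditions for a boundary point at which `p ↦ gap S mu (ν p) p x` is minimal, where `mu` is
smaller than the principal curvatures. -/
lemma gap_critical (hn : 1 ≤ n) (hF : IsDefFun K p F) (hp : p ∈ frontier K) {lam mu : ℝ}
    (hmu : mu < lam) (x : Space S n)
    (hQ : ∀ X ∈ tangentPlane S (p : Ambient n) (unitGrad S F p),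
      lam * bil S X X ≤ bil S (shape S F p X) X)
    (hs : 0 ≤ bil S (unitGrad S F p) ((x : Ambient n) - p))
    (hmin : ∀ᶠ q in 𝓝 p, q ∈ frontier K →
      gap S mu (unitGrad S F p) p x ≤ gap S mu (unitGrad S F q) q x)
    {s σ : ℝ} (hsdef : s = bil S (unitGrad S F p) ((x : Ambient n) - p))
    (hσdef : σ = bil S ((x : Ambient n) - (p : Ambient n)) (x - p) / 2) :
    s ^ 2 = 2 * σ - curv S * σ ^ 2 ∧ s * lam ≤ 1 - curv S * σ := by
  set N := unitGrad S F p with hN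
  have hNN : bil S N N = 1 := hF.bil_unitGrad_self
  have hpN : curv S * bil S (p : Ambient n) N = 0 := curv_mul_bil_eq_zero hF.rad_unitGrad
  have hpp := curv_mul_bil_self p.2
  -- the derivative of the function along curves in the boundary
  have key : ∀ X ∈ tangentPlane S (p : Ambient n) N, ∃ G g : ℝ → Ambient n,
      HasDerivAt G (-shape S F p X) 0 ∧ HasDerivAt g X 0 ∧ G 0 = N ∧ g 0 = p ∧
      ContinuousAt (deriv G) 0 ∧ ContinuousAt (deriv g) 0 ∧
      (∀ᶠ t in 𝓝 (0 : ℝ), HasDerivAt (fun s => gap S mu (G s) (g s) x)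
        (bil S (deriv G t + mu • deriv g t) (x - g t)) t) ∧
      (∀ᶠ t in 𝓝 (0 : ℝ), gap S mu (G 0) (g 0) x ≤ gap S mu (G t) (g t) x) ∧
      (∀ᶠ t in 𝓝 (0 : ℝ), bil S (deriv G t + mu • deriv g t) (G t) = 0 ∧
        curv S * bil S (deriv G t + mu • deriv g t) (g t) = 0) := by
    intro X hX
    obtain ⟨γ, h0, hγ2, h1, h2⟩ := hF.exists_curve hp hX.1 hX.2
    set g : ℝ → Ambient n := fun t => (γ t : Ambient n) with hg
    set G : ℝ → Ambient n := fun t => unitGrad S F (γ t) with hG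
    have hG1 : ContDiffAt ℝ 1 G 0 := by
      refine ContDiffAt.comp (g := unitGrad S F) (f := g) (0 : ℝ) ?_ (hγ2.of_le (by norm_num))
      rw [hg]
      simpa [h0] using hF.contDiffAt_unitGrad
    have hg1 : ContDiffAt ℝ 1 g 0 := hγ2.of_le (by norm_num)
    have hcd : ∀ f : ℝ → Ambient n, ContDiffAt ℝ 1 f 0 → ContinuousAt (deriv f) 0 ∧
        ∀ᶠ t in 𝓝 (0 : ℝ), HasDerivAt f (deriv f t) t := by
      intro f hf
      have h3 : ContinuousAt (fun t => fderiv ℝ f t 1) 0 :=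
        (hf.fderiv_right (m := 0) (by norm_num)).continuousAt.clm_apply continuousAt_const
      exact ⟨h3, (hf.eventually (by simp)).mono
        fun t ht => (ht.differentiableAt one_ne_zero).hasDerivAt⟩
    have horth := hF.eventually_bil_unitGrad_deriv h0 h1 h2
    have ht := tendsto_of_hasDerivAt_coe h0 h1
    have hone : ∀ᶠ t in 𝓝 (0 : ℝ), bil S (G t) (G t) = 1 := by
      have h3 : Tendsto g (𝓝 0) (𝓝 (p : Ambient n)) :=
        (continuous_subtype_val.tendsto p).comp ht
      exact h3.eventually hF.eventually_bil_unitGrad_self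
    have hrad : ∀ᶠ t in 𝓝 (0 : ℝ), curv S * bil S (g t) (G t) = 0 := by
      filter_upwards [ht.eventually hF.toIsFrontierFun.eventually] with t h3
      exact curv_mul_bil_eq_zero h3.rad_unitGrad
    refine ⟨G, g, hF.hasDerivAt_unitGrad_comp h0 h1, h1, by simp [hG, h0, hN], by simp [hg, h0],
      (hcd G hG1).1, (hcd g hg1).1, ?_, ?_, ?_⟩
    · filter_upwards [(hcd G hG1).2, (hcd g hg1).2, horth] with t h3 h4 h5
      exact hasDerivAt_gap_normal h3 h4 (h5 _ h4)
    · filter_upwards [ht.eventually hmin, h2] with t h3 h4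
      have := h3 h4
      simpa only [hG, hg, h0] using this
    · filter_upwards [(hcd G hG1).2, (hcd g hg1).2, horth, hone.eventually_nhds,
        hrad.eventually_nhds] with t h3 h4 h5 h6 h7
      have h8 := h5 _ h4
      have h9 := (hasDerivAt_bil (S := S) h3 h3).unique
        ((hasDerivAt_const t (1 : ℝ)).congr_of_eventuallyEq h6)
      have h10 := ((hasDerivAt_bil (S := S) h4 h3).const_mul (curv S)).unique
        ((hasDerivAt_const t (0 : ℝ)).congr_of_eventuallyEq h7)
      have h11 : curv S * bil S (g t) (deriv g t) = 0 :=
        curv_mul_bil_eq_zero (rad_deriv_eq_zero h4)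
      rw [bil_symm (G t)] at h9
      have h8' : bil S (G t) (deriv g t) = 0 := h8
      rw [bil_symm] at h8'
      rw [bil_symm] at h11
      rw [h8', zero_add, bil_symm] at h10
      constructor
      · rw [bil_add_left, bil_smul_left, h8']
        linarith
      · rw [bil_add_left, bil_smul_left]
        linear_combination h10 + mu * h11
  have hrx := rad_sub_add x.2 p.2
  rw [← hσdef] at hrx
  -- first order
  set w := (x : Ambient n) - p + (curv S * σ) • (p : Ambient n) - s • N with hw
  have hwT : w ∈ tangentPlane S (p : Ambient n) N := by
    refine mem_tangentPlane.2 ⟨?_, ?_⟩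
    · rw [hw, map_sub, hrx, (rad S (p : Ambient n)).map_smul, hF.rad_unitGrad, smul_zero, sub_zero]
    · rw [hw, bil_sub_right, bil_add_right, bil_smul_right, bil_smul_right, hNN, ← hsdef,
        bil_symm N p]
      linear_combination σ * hpN
  have hxp : (x : Ambient n) - p = w + s • N - (curv S * σ) • (p : Ambient n) := by
    rw [hw]; abel
  have hw0 : w = 0 := by
    obtain ⟨G, g, hG, hg, hG0, hg0, -, -, hd, hm, ho⟩ := key w hwT
    have h1 : IsLocalMin (fun t => gap S mu (G t) (g t) x) 0 := hm
    have h2 := h1.hasDerivAt_eq_zero hd.self_of_nhds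
    have h3 := ho.self_of_nhds
    rw [hG.deriv, hg.deriv, hG0, hg0] at h3
    rw [hG.deriv, hg.deriv, hg0, hxp, bil_sub_right, bil_add_right, bil_smul_right, bil_smul_right,
      h3.1, bil_add_left, bil_smul_left, map_neg, FunLike.coe_neg, Pi.neg_apply] at h2
    have h4 := hQ w hwT
    have h5 := h3.2
    by_contra hne
    have h6 := bil_self_pos p.2 hwT.1 hne
    -- Criticality annihilates the tangential part `w` against `shape - mu`, which is positive
    -- definite because `mu < lam`. Hence `w = 0`: the chord to `x` lies in the span of the normal
    -- and `p`.
    have h7 : -bil S (shape S F p w) w + mu * bil S w w = 0 := by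
      linear_combination h2 + σ * h5
    nlinarith
  rw [hw0, zero_add] at hxp
  have hsq : s ^ 2 = 2 * σ - curv S * σ ^ 2 := by
    have h1 : 2 * σ = bil S ((x : Ambient n) - (p : Ambient n)) (x - p) := by rw [hσdef]; ring
    rw [hxp] at h1
    simp only [bil_sub_left, bil_sub_right, bil_smul_left, bil_smul_right, hNN,
      bil_symm N p] at h1
    have := curv_pow_three (S := S)
    linear_combination (-1 : ℝ) * h1 + 2 * s * σ * hpN - curv S * σ ^ 2 * hpp - σ ^ 2 * this
  refine ⟨hsq, ?_⟩
  -- second order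
  obtain ⟨Y, hY0, hY1, hY2⟩ := exists_tangent_ne_zero (S := S) hn (p : Ambient n) N
  obtain ⟨κ, ⟨X, hX, hX0, hAX⟩, -⟩ := exists_least_eigenvalue p.2 (L := shape S F p)
    (fun X hX => hF.shape_mem hX) (fun X hX Y hY => hF.bil_shape_symm hX.2 hY.2)
    ⟨Y, ⟨hY1, hY2⟩, hY0⟩
  have hXX := bil_self_pos p.2 hX.1 hX0
  have hκ : lam ≤ κ := by
    have := hQ X hX
    rw [hAX, bil_smul_left] at this
    exact le_of_mul_le_mul_right this hXX
  obtain ⟨G, g, hG, hg, hG0, hg0, hGc, hgc, hd, hm, ho⟩ := key X hX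
  set Z : ℝ → Ambient n := fun t => deriv G t + mu • deriv g t with hZ
  -- `Z` is only continuous, but it is orthogonal to the normal and, after multiplication by `curv
  -- S`, to the position. So `x - g t` may be replaced by `W`, which vanishes at 0.
  set W : ℝ → Ambient n := fun t => (x - g t) - s • G t + (curv S * σ) • g t with hW
  have hW0 : W 0 = 0 := by
    rw [hW]
    simp only [hG0, hg0, hxp]
    abel
  have hWd : HasDerivAt W ((s * κ - (1 - curv S * σ)) • X) 0 := by
    refine (((hg.const_sub (x : Ambient n)).sub (hG.const_smul s)).add
      (hg.const_smul (curv S * σ))).congr_deriv ?_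
    rw [hAX]
    module
  have hZc : ContinuousAt Z 0 := hGc.add (hgc.const_smul mu)
  have hk := hasDerivAt_bil_of_zero (S := S) hZc hW0 hWd
  have hh : ∀ᶠ t in 𝓝 (0 : ℝ), HasDerivAt (fun s => gap S mu (G s) (g s) x)
      (bil S (Z t) (W t)) t := by
    filter_upwards [hd, ho] with t h1 h2
    refine h1.congr_deriv ?_
    have h3 : bil S (Z t) (G t) = 0 := h2.1
    have h4 : curv S * bil S (Z t) (g t) = 0 := h2.2
    show bil S (Z t) _ = _
    simp only [hW, bil_add_right, bil_sub_right, bil_smul_right, h3]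
    linear_combination (-σ) * h4
  have h1 := nonneg_of_deriv_test hh (by rw [hW0, map_zero]) hk
    (hm.filter_mono nhdsWithin_le_nhds)
  have h2 : Z 0 = (mu - κ) • X := by
    simp only [hZ, hG.deriv, hg.deriv, hAX]
    module
  rw [h2, bil_smul_left, bil_smul_right] at h1
  -- This is the focal condition: the second derivative carries the factor `mu - κ < 0`, so the
  -- other factor cannot be positive.
  have h3 : s * κ - (1 - curv S * σ) ≤ 0 := by
    by_contra! h
    have := mul_pos (mul_pos (sub_pos.2 (hmu.trans_le hκ)) h) hXX
    nlinarith
  have h4 := mul_le_mul_of_nonneg_left hκ (hsdef ▸ hs)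
  linarith

end IsDefFun

/-- `K` lies on the mean curvature sides of all totally umbilic hypersurfaces which are tangent to
its boundary. -/
lemma gap_nonneg (hn : 1 ≤ n) {K : Set (Space S n)} (hK : IsCompact K)
    {ν : Space S n → Ambient n} {lam : ℝ} (hlam : 0 < lam)
    (hdef : ∀ p ∈ frontier K, ∃ F, IsDefFun K p F) (hν : IsInwardUnitNormal K ν)
    (hQ : ∀ p ∈ frontier K, ∀ F, IsDefFun K p F →
      ∀ X ∈ tangentPlane S (p : Ambient n) (unitGrad S F p),
        lam * bil S X X ≤ bil S (shape S F p X) X)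
    (hconv : ∀ p ∈ frontier K, ∀ x ∈ K, 0 ≤ bil S (ν p) ((x : Ambient n) - p))
    {p : Space S n} (hp : p ∈ frontier K) {x : Space S n} (hx : x ∈ K) :
    0 ≤ gap S lam (ν p) p x := by
  -- For `mu < lam` critical points over the boundary are nondegenerate in the sense used by
  -- `gap_critical`; the value `lam` is reached in the limit.
  have hmain : ∀ mu, 0 ≤ mu → mu < lam → 0 ≤ gap S mu (ν p) p x := by
    intro mu hmu0 hmu
    have hcpt : IsCompact (frontier K) := hK.of_isClosed_subset isClosed_frontier
      hK.isClosed.frontier_subset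
    have hνc := continuousOn_normal hdef hν
    have hc : ContinuousOn (fun q : Space S n => gap S mu (ν q) q x) (frontier K) := by
      have h1 : ContinuousOn (fun q : Space S n => (x : Ambient n) - q) (frontier K) :=
        (continuous_const.sub continuous_subtype_val).continuousOn
      have h2 : ∀ f g : Space S n → Ambient n, ContinuousOn f (frontier K) →
          ContinuousOn g (frontier K) → ContinuousOn (fun q => bil S (f q) (g q)) (frontier K) :=
        fun f g hf hg => ((bil S).continuous.comp_continuousOn hf).clm_apply hg
      exact (h2 _ _ hνc h1).sub (continuousOn_const.mul (h2 _ _ h1 h1))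
    obtain ⟨q, hq, hmin⟩ := hcpt.exists_isMinOn ⟨p, hp⟩ hc
    refine le_trans ?_ (hmin hp)
    obtain ⟨F, hF⟩ := hdef q hq
    have hνq := hF.normal_eq hν hq
    have hs := hconv q hq x hx
    rw [hνq] at hs
    have hσ := bil_sub_self_nonneg x q
    obtain ⟨h1, h2⟩ := hF.gap_critical hn hq hmu x (hQ q hq F hF) hs (by
      filter_upwards [hF.eventually_normal_eq hν] with r h3 h4
      rw [← hνq, h3 h4]
      exact hmin h4) rfl rfl
    show 0 ≤ gap S mu (ν q) q x
    rw [hνq, gap]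
    set s := bil S (unitGrad S F q) ((x : Ambient n) - q)
    set σ := bil S ((x : Ambient n) - (q : Ambient n)) (x - q) / 2 with hσdef
    have hσ0 : 0 ≤ σ := by positivity
    have h3 : mu / 2 * bil S ((x : Ambient n) - (q : Ambient n)) (x - q) = mu * σ := by
      rw [hσdef]; ring
    rw [h3]
    -- A negative minimum means `s < mu * σ`. With the focal inequality this gives `lam * s ^ 2 ≤
    -- lam * σ * (1 - curv S * σ)`, contradicting `s ^ 2 = 2 * σ - curv S * σ ^ 2` when `σ > 0`.
    by_contra! h4
    have hσ1 : 0 < σ := by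
      rcases hσ0.eq_or_lt with h5 | h5
      · rw [← h5] at h4
        linarith
      · exact h5
    have h5 : 0 ≤ 1 - curv S * σ := le_trans (mul_nonneg hs hlam.le) h2
    have h6 : s ^ 2 ≤ mu * σ * s := by nlinarith
    have h7 : lam * s ^ 2 ≤ mu * σ * (1 - curv S * σ) := by
      have := mul_le_mul_of_nonneg_left h2 (mul_nonneg hmu0 hσ0)
      nlinarith
    have h8 : mu * σ * (1 - curv S * σ) ≤ lam * σ * (1 - curv S * σ) := by gcongr
    have h9 : lam * σ * (1 - curv S * σ) < lam * s ^ 2 := by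
      rw [h1]
      have := mul_pos hlam hσ1
      nlinarith
    linarith
  have ht : Tendsto (fun mu => gap S mu (ν p) (p : Ambient n) x) (𝓝[<] lam)
      (𝓝 (gap S lam (ν p) p x)) := by
    have : Continuous fun mu => gap S mu (ν p) (p : Ambient n) x := by
      unfold gap; fun_prop
    exact this.continuousAt.tendsto.mono_left nhdsWithin_le_nhds
  refine ge_of_tendsto ht ?_
  filter_upwards [Ioo_mem_nhdsLT hlam] with mu hmu using hmain mu hmu.1.le hmu.2

/-! ### Finding a boundary point more curved than `lam`. -/

lemma pos_of_bil_neg {p q : Ambient n} (hp : bil hyperbolic p p < 0) (hp0 : 0 < p 0)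
    (hq : bil hyperbolic q q < 0) (hpq : bil hyperbolic p q < 0) : 0 < q 0 := by
  by_contra! h
  rcases h.lt_or_eq with h | h
  · have h1 := bil_neg_of_timelike hp hp0 (q := -q) (by simpa using hq) (by simpa using h)
    rw [map_neg] at h1
    linarith
  · rw [bil_hyperbolic, h] at hq
    have : 0 ≤ ∑ i : Fin (n + 1), q i.succ * q i.succ :=
      Finset.sum_nonneg fun i _ => mul_self_nonneg _
    linarith

/-- The centre of the geodesic sphere of curvature `lam` through `p` with normal `v`. -/
lemma center_mem {lam : ℝ} (hlam : 0 < lam) (hρ : 0 < lam ^ 2 + curv S) {p v : Ambient n}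
    (hp : p ∈ carrier S n) (hv : rad S p v = 0) (hvv : bil S v v = 1) :
    (√(lam ^ 2 + curv S))⁻¹ • (v + lam • p) ∈ carrier S n := by
  have hsq := Real.sq_sqrt hρ.le
  have hk := Real.sqrt_pos.2 hρ
  cases S
  · have h1 : p 0 = 1 := hp
    have h2 : v 0 = 0 := hv
    have h3 : √(lam ^ 2 + curv euclidean) = lam := by
      rw [curv, add_zero, Real.sqrt_sq hlam.le]
    show ((√(lam ^ 2 + curv euclidean))⁻¹ • (v + lam • p)) 0 = 1
    rw [h3]
    simp [h1, h2, hlam.ne']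
  · have h1 : bil spherical p p = 1 := by rw [bil_apply]; exact hp
    have h2 : bil spherical p v = 0 := hv
    show form spherical _ _ = 1
    rw [form_eq]
    simp only [bil_smul_left, bil_smul_right, bil_add_left, bil_add_right, h1, h2, hvv,
      bil_symm v p]
    simp only [curv] at hsq hk ⊢
    field_simp
    linarith
  · have h1 : bil hyperbolic p p = -1 := by rw [bil_apply]; exact hp.1
    have h2 : bil hyperbolic p v = 0 := hv
    set c := (√(lam ^ 2 + curv hyperbolic))⁻¹ • (v + lam • p) with hc
    have h3 : bil hyperbolic c c = -1 := by
      simp only [hc, bil_smul_left, bil_smul_right, bil_add_left, bil_add_right, h1, h2, hvv,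
        bil_symm v p]
      simp only [curv] at hsq hk ⊢
      field_simp
      linarith
    refine ⟨by rw [form_eq, h3], pos_of_bil_neg (p := p) (by rw [h1]; norm_num) hp.2
      (by rw [h3]; norm_num) ?_⟩
    simp only [hc, bil_smul_right, bil_add_right, h1, h2]
    have := mul_pos (inv_pos.2 hk) hlam
    linarith

lemma bil_carrier_neg {p q : Ambient n} (hp : p ∈ carrier hyperbolic n)
    (hq : q ∈ carrier hyperbolic n) : bil hyperbolic p q < 0 := by
  have h1 : form hyperbolic p p = -1 := hp.1
  have h2 : form hyperbolic q q = -1 := hq.1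
  rw [form_eq] at h1 h2
  exact bil_neg_of_timelike (by rw [h1]; norm_num) hp.2 (by rw [h2]; norm_num) hq.2

/-- The tangential component of `v + lam • p - lam • z` at `z`. -/
lemma rad_center_sub {lam : ℝ} {p z v : Ambient n} (hp : p ∈ carrier S n) (hz : z ∈ carrier S n)
    (hv : rad S p v = 0) :
    rad S z (v + lam • p - lam • z - (curv S * gap S lam v p z) • z) = 0 := by
  have h1 : rad S z (v - (curv S * bil S v (z - p)) • z) = 0 := by
    cases S
    · have : v 0 = 0 := hv
      simp [rad, curv, this]
    · have h2 : bil spherical z z = 1 := by rw [bil_apply]; exact hz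
      have h3 : bil spherical p v = 0 := hv
      rw [bil_symm] at h3
      simp [rad, curv, h2, h3, bil_symm v z]
    · have h2 : bil hyperbolic z z = -1 := by rw [bil_apply]; exact hz.1
      have h3 : bil hyperbolic p v = 0 := hv
      rw [bil_symm] at h3
      simp [rad, curv, h2, h3, bil_symm v z]
  have h2 := rad_sub_add hp hz
  have h3 : v + lam • p - lam • z - (curv S * gap S lam v p z) • z =
      (v - (curv S * bil S v (z - p)) • z) +
        lam • (p - z + (curv S * (bil S (p - z) (p - z) / 2)) • z) := by
    have : bil S (z - p) (z - p) = bil S (p - z) (p - z) := by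
      simp only [bil_sub_left, bil_sub_right]; ring
    rw [gap, this]
    module
  rw [h3, map_add, h1, (rad S z).map_smul, h2, smul_zero, add_zero]

/-- Both sides are the same quadratic polynomial in `x`, expanded at `p` and at `z`; the linear
coefficient at `z` is again centre minus `lam • z`. -/
lemma gap_eq_gap_add (lam : ℝ) (v p z x : Ambient n) :
    gap S lam v p x = gap S lam v p z + gap S lam (v + lam • p - lam • z) z x := by
  simp only [gap, bil_add_left, bil_sub_left, bil_sub_right, bil_smul_left, bil_symm z p,
    bil_symm z x, bil_symm p x]
  ring

/-- At a minimum over `K` of a function of the form `gap S τ b z`, the boundary of `K` is more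
curved than `lam`, under numerical assumptions on the data. -/
lemma exists_lt_shape_of_min (hn : 1 ≤ n) {K : Set (Space S n)} (hK : IsClosed K)
    (hdef : ∀ p ∈ frontier K, ∃ F, IsDefFun K p F) {lam : ℝ} {z : Space S n} (hz : z ∈ K)
    {b : Ambient n} {α τ : ℝ}
    (hb : rad S (z : Ambient n) (b - (curv S * α) • (z : Ambient n)) = 0)
    (hmin : ∀ x ∈ K, 0 ≤ gap S τ b z x) (hpos : 0 < curv S * α + τ)
    (hlt : ∀ β, 0 ≤ β → bil S b b = β ^ 2 + curv S * α ^ 2 → lam * β < curv S * α + τ) :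
    ∃ p ∈ frontier K, ∃ F, IsDefFun K p F ∧
      ∀ X ∈ tangentPlane S (p : Ambient n) (unitGrad S F p), X ≠ 0 →
        lam * bil S X X < bil S (shape S F p X) X := by
  have hzf : z ∈ frontier K := by
    by_contra h
    have h1 := touch_interior hn hb (by
      filter_upwards [isOpen_interior.mem_nhds (mem_interior_of_not_mem_frontier hz h)]
        with x hx using hmin x (interior_subset hx))
    linarith
  obtain ⟨F, hF⟩ := hdef z hzf
  -- Touching bounds `β` times the normal curvatures below by `curv S * α + τ`, and `hlt` says that
  -- this exceeds `lam * β`; the square of `b` is what determines `β`.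
  obtain ⟨β, hβ, hbeq, hX⟩ := hF.touch hzf hb hK (Eventually.of_forall hmin)
  refine ⟨z, hzf, F, hF, fun X hXT hX0 => ?_⟩
  have hXX := bil_self_pos z.2 hXT.1 hX0
  have h1 : bil S b b = β ^ 2 + curv S * α ^ 2 := by
    have h2 := curv_mul_bil_eq_zero hF.rad_unitGrad
    have h3 := curv_mul_bil_self z.2
    have h4 := curv_pow_three (S := S)
    rw [hbeq]
    simp only [bil_add_left, bil_add_right, bil_smul_left, bil_smul_right, hF.bil_unitGrad_self,
      bil_symm (unitGrad S F z) z]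
    linear_combination 2 * α * β * h2 + curv S * α ^ 2 * h3 + α ^ 2 * h4
  have h2 := hlt β hβ h1
  have h3 := hX X hXT
  have h4 : 0 < β := by
    rcases hβ.eq_or_lt with h5 | h5
    · rw [← h5] at h3
      have := mul_pos hpos hXX
      linarith
    · exact h5
  have h5 := mul_lt_mul_of_pos_right h2 hXX
  refine lt_of_mul_lt_mul_left (a := β) ?_ hβ
  linarith

/-- A compact subset of hyperbolic space with boundary of class `C²` has a boundary point at which
all principal curvatures are larger than `1`. -/
lemma exists_lt_shape_hyperbolic (hn : 1 ≤ n) {K : Set (Space hyperbolic n)} (hK : IsCompact K)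
    (hne : K.Nonempty) (hdef : ∀ p ∈ frontier K, ∃ F, IsDefFun K p F) {lam : ℝ} (hlam : lam ≤ 1) :
    ∃ p ∈ frontier K, ∃ F, IsDefFun K p F ∧
      ∀ X ∈ tangentPlane hyperbolic (p : Ambient n) (unitGrad hyperbolic F p), X ≠ 0 →
        lam * bil hyperbolic X X < bil hyperbolic (shape hyperbolic F p X) X := by
  have ho : basePoint n ∈ carrier hyperbolic n := basePoint_mem
  have hc : Continuous fun x : Space hyperbolic n => bil hyperbolic (basePoint n) (x : Ambient n) :=
    (bil hyperbolic (basePoint n)).continuous.comp continuous_subtype_val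
  -- Minimising `bil` against the base point means maximising the distance from it. The sphere
  -- through `z` has curvature `-α / √(α ^ 2 - 1)` when `α < -1`; the proof compares numerator and
  -- denominator, so `α = -1` needs no separate case.
  obtain ⟨z, hz, hmin⟩ := hK.exists_isMinOn hne hc.continuousOn
  set α := bil hyperbolic (basePoint n) (z : Ambient n) with hα
  have hα0 : α < 0 := bil_carrier_neg ho z.2
  have hzz : bil hyperbolic (z : Ambient n) z = -1 := by rw [bil_apply]; exact z.2.1
  have hoo : bil hyperbolic (basePoint n) (basePoint n) = -1 := by rw [bil_apply]; exact ho.1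
  refine exists_lt_shape_of_min hn hK.isClosed hdef hz (b := basePoint n) (α := α) (τ := 0)
    ?_ ?_ ?_ ?_
  · show bil hyperbolic (z : Ambient n) _ = 0
    rw [bil_sub_right, bil_smul_right, hzz, bil_symm (z : Ambient n), ← hα]
    simp only [curv]
    ring
  · intro x hx
    have h1 : α ≤ bil hyperbolic (basePoint n) (x : Ambient n) := hmin hx
    rw [gap, bil_sub_right, ← hα]
    linarith
  · simp only [curv]; linarith
  · intro β hβ h
    rw [hoo] at h
    simp only [curv] at h ⊢
    have h1 : β < -α := lt_of_pow_lt_pow_left₀ 2 (by linarith) (by linarith [neg_sq α])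
    have h2 := mul_le_mul_of_nonneg_right hlam hβ
    linarith

/-- If the centres of the osculating spheres of curvature `lam` at two boundary points differ, some
boundary point is more curved than `lam`. -/
lemma exists_lt_shape_of_center_ne (hn : 1 ≤ n) {K : Set (Space S n)} (hK : IsCompact K)
    (hdef : ∀ p ∈ frontier K, ∃ F, IsDefFun K p F) {lam : ℝ} (hlam : 0 < lam)
    (hρ : 0 < lam ^ 2 + curv S) {p q : Space S n} {v w : Ambient n}
    (hv : rad S (p : Ambient n) v = 0) (hvv : bil S v v = 1)
    (hw : rad S (q : Ambient n) w = 0) (hww : bil S w w = 1)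
    (hp : p ∈ K) (hgv : ∀ x ∈ K, 0 ≤ gap S lam v p x) (hgw : ∀ x ∈ K, 0 ≤ gap S lam w q x)
    (hne : v + lam • (p : Ambient n) ≠ w + lam • (q : Ambient n)) :
    ∃ p ∈ frontier K, ∃ F, IsDefFun K p F ∧
      ∀ X ∈ tangentPlane S (p : Ambient n) (unitGrad S F p), X ≠ 0 →
        lam * bil S X X < bil S (shape S F p X) X := by
  have hgc : ∀ v p : Ambient n, Continuous fun x : Space S n => gap S lam v p x := by
    intro v p
    have h1 : Continuous fun x : Space S n => (x : Ambient n) - p :=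
      continuous_subtype_val.sub continuous_const
    have h2 : ∀ f g : Space S n → Ambient n, Continuous f → Continuous g →
        Continuous (fun q => bil S (f q) (g q)) :=
      fun f g hf hg => ((bil S).continuous.comp hf).clm_apply hg
    exact (h2 _ _ continuous_const h1).sub (continuous_const.mul (h2 _ _ h1 h1))
  -- A minimum of the sum of the two gaps is a point of `K` farthest from the midpoint of the two
  -- centres.
  obtain ⟨z, hz, hmin⟩ := hK.exists_isMinOn ⟨p, hp⟩ ((hgc v p).add (hgc w q)).continuousOn
  set c := v + lam • (p : Ambient n) with hc
  set c' := w + lam • (q : Ambient n) with hc'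
  set α := gap S lam v p z + gap S lam w q z with hα
  have hα0 : 0 ≤ α := add_nonneg (hgv z hz) (hgw z hz)
  -- The normalised centres are points of the model, and distinct points of the model differ by a
  -- spacelike vector.
  have hD : 0 < bil S (c - c') (c - c') := by
    set k := √(lam ^ 2 + curv S) with hk
    have hk0 : 0 < k := Real.sqrt_pos.2 hρ
    have h1 := bil_sub_self_pos (center_mem hlam hρ p.2 hv hvv) (center_mem hlam hρ q.2 hw hww)
      (fun h => hne (smul_right_injective (Ambient n) (inv_ne_zero hk0.ne') h))
    rw [← hk, ← smul_sub, bil_smul_left, bil_smul_right, ← mul_assoc] at h1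
    exact (pos_iff_pos_of_mul_pos h1).1 (mul_pos (inv_pos.2 hk0) (inv_pos.2 hk0))
  -- In the hyperbolic model each gap at `z` equals `lam` plus the product of centre and `z`, which
  -- is negative. The bound keeps `2 * lam - α` positive.
  have hαlt : curv S = -1 → α < 2 * lam := by
    intro hS
    cases S
    · norm_num [curv] at hS
    · norm_num [curv] at hS
    have h1 : ∀ v p : Ambient n, p ∈ carrier hyperbolic n → rad hyperbolic p v = 0 →
        bil hyperbolic v v = 1 → gap hyperbolic lam v p z < lam := by
      intro v p hp hv hvv
      have h2 := bil_carrier_neg (center_mem hlam hρ hp hv hvv) z.2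
      have hk0 := inv_pos.2 (Real.sqrt_pos.2 hρ)
      rw [bil_smul_left] at h2
      have h3 := neg_of_mul_neg_right h2 hk0.le
      have hzz : bil hyperbolic (z : Ambient n) z = -1 := by rw [bil_apply]; exact z.2.1
      have hpp : bil hyperbolic p p = -1 := by rw [bil_apply]; exact hp.1
      have hpv : bil hyperbolic p v = 0 := hv
      rw [bil_symm] at hpv
      rw [bil_add_left, bil_smul_left] at h3
      simp only [gap, bil_sub_left, bil_sub_right, hzz, hpp, hpv, bil_symm (z : Ambient n) p]
      linarith
    have h2 := h1 v p p.2 hv hvv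
    have h3 := h1 w q q.2 hw hww
    linarith
  refine exists_lt_shape_of_min hn hK.isClosed hdef hz
    (b := c - lam • (z : Ambient n) + (c' - lam • (z : Ambient n))) (α := α) (τ := 2 * lam)
    ?_ ?_ ?_ ?_
  · have h1 := rad_center_sub (lam := lam) p.2 z.2 hv
    have h2 := rad_center_sub (lam := lam) q.2 z.2 hw
    have h3 : c - lam • (z : Ambient n) + (c' - lam • (z : Ambient n)) -
        (curv S * α) • (z : Ambient n) =
        (c - lam • (z : Ambient n) - (curv S * gap S lam v p z) • (z : Ambient n)) +
        (c' - lam • (z : Ambient n) - (curv S * gap S lam w q z) • (z : Ambient n)) := by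
      rw [hα]; module
    rw [h3, map_add, h1, h2, add_zero]
  · intro x hx
    have h1 : gap S lam v p z + gap S lam w q z ≤ gap S lam v p x + gap S lam w q x := hmin hx
    rw [gap_eq_gap_add lam v p z x, gap_eq_gap_add lam w q z x] at h1
    have h2 : gap S (2 * lam) (c - lam • (z : Ambient n) + (c' - lam • (z : Ambient n))) z x =
        gap S lam (c - lam • (z : Ambient n)) z x + gap S lam (c' - lam • (z : Ambient n)) z x := by
      simp only [gap, bil_add_left]; ring
    rw [h2]
    linarith
  · cases S
    · simp only [curv]; linarith
    · simp only [curv]; linarith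
    · have := hαlt rfl
      simp only [curv]; linarith
  · intro β hβ h
    have h1 := one_sub_bil_self_eq (S := S) (lam := lam) (p := p) hvv (z : Ambient n)
    have h2 := one_sub_bil_self_eq (S := S) (lam := lam) (p := q) hww (z : Ambient n)
    -- Parallelogram law. The term `-bil S (c - c') (c - c')`, strictly negative, is the gain that
    -- makes the touching sphere more curved than `lam`.
    have h3 : bil S (c - lam • (z : Ambient n) + (c' - lam • (z : Ambient n)))
        (c - lam • (z : Ambient n) + (c' - lam • (z : Ambient n))) =
        4 - 4 * lam * α - bil S (c - c') (c - c') := by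
      have h4 : bil S (c - c') (c - c') =
          bil S (c - lam • (z : Ambient n) - (c' - lam • (z : Ambient n)))
          (c - lam • (z : Ambient n) - (c' - lam • (z : Ambient n))) := by
        rw [sub_sub_sub_cancel_right]
      rw [h4]
      set e := c - lam • (z : Ambient n)
      set e' := c' - lam • (z : Ambient n)
      simp only [bil_add_left, bil_add_right, bil_sub_left, bil_sub_right, bil_symm e' e]
      rw [hα]
      linarith
    rw [h3] at h
    set D := bil S (c - c') (c - c')
    have hLD : 0 < lam ^ 2 * D := by positivity
    refine lt_of_pow_lt_pow_left₀ 2 ?_ ?_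
    · cases S
      · simp only [curv]; linarith
      · simp only [curv]; linarith
      · have := hαlt rfl
        simp only [curv]; linarith
    · have h4 : (lam * β) ^ 2 = lam ^ 2 * (4 - 4 * lam * α - D - curv S * α ^ 2) := by
        rw [mul_pow]; congr 1; linarith
      rw [h4]
      cases S
      · simp only [curv] at *
        have : 0 ≤ lam ^ 3 * α := by positivity
        nlinarith
      · simp only [curv] at *
        have h5 : 0 ≤ lam ^ 3 * α := by positivity
        have h6 : 0 ≤ lam * α := by positivity
        have h7 : 0 ≤ (lam * α) ^ 2 := by positivity
        nlinarith [sq_nonneg α]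
      · have h5 := hαlt rfl
        simp only [curv] at *
        have h6 : 0 ≤ α * (lam ^ 2 + -1) * (4 * lam - α) :=
          mul_nonneg (mul_nonneg hα0 hρ.le) (by linarith)
        nlinarith

/-! ### Geodesic balls and the case of a common centre. -/

/-- A function which is positive inside, and zero on, the totally umbilic hypersurface of
curvature `lam` with centre `c`. -/
noncomputable def sphereFun (S : SpaceForm) {n : ℕ} (lam : ℝ) (c y : Ambient n) : ℝ :=
  1 - bil S (c - lam • y) (c - lam • y)

lemma contDiff_sphereFun (lam : ℝ) (c : Ambient n) {k : WithTop ℕ∞} :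
    ContDiff ℝ k (sphereFun S lam c) := by
  have h1 : ContDiff ℝ k fun y : Ambient n => c - lam • y := by fun_prop
  exact contDiff_const.sub (((bil S).contDiff.comp h1).clm_apply h1)

lemma hasDerivAt_sphereFun {lam t : ℝ} {c X : Ambient n} {γ : ℝ → Ambient n}
    (hγ : HasDerivAt γ X t) :
    HasDerivAt (fun s => sphereFun S lam c (γ s)) (2 * lam * bil S (c - lam • γ t) X) t := by
  have h1 := (hγ.const_smul lam).const_sub c
  refine ((hasDerivAt_bil (S := S) h1 h1).const_sub 1).congr_deriv ?_
  simp only [Pi.smul_apply, map_neg, FunLike.coe_neg, Pi.neg_apply, bil_smul_left, bil_smul_right,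
    bil_symm X]
  ring

/-- On the sphere and the hyperboloid the quadratic terms are constant, so the ball is cut out by an
affine function of the product with the centre. -/
lemma sphereFun_of_curv_sq_eq_one {lam k : ℝ} (hk : k ^ 2 = lam ^ 2 + curv S)
    (hS : curv S ^ 2 = 1) {o x : Ambient n} (ho : o ∈ carrier S n) (hx : x ∈ carrier S n) :
    sphereFun S lam (k • o) x = 2 * lam * (k * bil S o x - curv S * lam) := by
  have h1 := curv_mul_bil_self ho
  have h2 := curv_mul_bil_self hx
  have h3 : bil S o o = curv S := by linear_combination curv S * h1 - bil S o o * hS + curv S * hS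
  have h4 : bil S x x = curv S := by linear_combination curv S * h2 - bil S x x * hS + curv S * hS
  simp only [sphereFun, bil_sub_left, bil_sub_right, bil_smul_left, bil_smul_right, h3, h4,
    bil_symm x o]
  linear_combination (-curv S) * hk - hS

lemma sphereFun_euclidean {lam k : ℝ} (hk : k = lam) (o x : Ambient n) :
    sphereFun euclidean lam (k • o) x = 1 - lam ^ 2 * bil euclidean (x - o) (x - o) := by
  simp only [sphereFun, hk, bil_sub_left, bil_sub_right, bil_smul_left, bil_smul_right,
    bil_symm x o]
  ring

lemma eq_of_sq_eq_euclidean {lam k : ℝ} (hlam : 0 < lam) (hk0 : 0 < k)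
    (hk : k ^ 2 = lam ^ 2 + curv euclidean) : k = lam := by
  rw [curv, add_zero] at hk
  exact (pow_left_inj₀ hk0.le hlam.le two_ne_zero).1 hk

/-- The geodesic sphere is a round sphere of radius `k⁻¹` in the affine hyperplane through `(lam /
k) • o` parallel to the tangent space at `o`. -/
lemma of_sphereFun_eq_zero {lam k : ℝ} (hlam : 0 < lam) (hk0 : 0 < k)
    (hk : k ^ 2 = lam ^ 2 + curv S) {o x : Ambient n} (ho : o ∈ carrier S n)
    (hx : x ∈ carrier S n) (h : sphereFun S lam (k • o) x = 0) :
    rad S o (x - (lam / k) • o) = 0 ∧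
      bil S (x - (lam / k) • o) (x - (lam / k) • o) = (k⁻¹) ^ 2 := by
  have hmain : curv S ^ 2 = 1 → bil S o o = curv S → bil S x x = curv S →
      bil S o (x - (lam / k) • o) = 0 ∧
      bil S (x - (lam / k) • o) (x - (lam / k) • o) = (k⁻¹) ^ 2 := by
    intro hS h1 h2
    rw [sphereFun_of_curv_sq_eq_one hk hS ho hx] at h
    have h3 : bil S o x = curv S * lam / k := by
      rw [eq_div_iff hk0.ne']
      have := (mul_eq_zero.1 h).resolve_left (by positivity)
      linarith
    simp only [bil_sub_left, bil_sub_right, bil_smul_left, bil_smul_right, bil_symm x o, h1, h2, h3]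
    constructor
    · field_simp; ring
    · field_simp
      linear_combination curv S * hk + hS
  cases S
  · have h1 : o 0 = 1 := ho
    have h2 : x 0 = 1 := hx
    have h3 := eq_of_sq_eq_euclidean hlam hk0 hk
    subst h3
    rw [sphereFun_euclidean rfl] at h
    rw [div_self hk0.ne', one_smul]
    refine ⟨by simp [rad, h1, h2], ?_⟩
    field_simp
    linarith
  · exact hmain (by simp [curv]) (by rw [bil_apply]; exact ho) (by rw [bil_apply]; exact hx)
  · exact hmain (by simp [curv]) (by rw [bil_apply]; exact ho.1) (by rw [bil_apply]; exact hx.1)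

lemma mem_carrier_of_bil_eq {lam k : ℝ} (hlam : 0 < lam) (hk0 : 0 < k)
    (hk : k ^ 2 = lam ^ 2 + curv S) {o w : Ambient n} (ho : o ∈ carrier S n) (hw : rad S o w = 0)
    (hww : bil S w w = (k⁻¹) ^ 2) :
    (lam / k) • o + w ∈ carrier S n ∧ sphereFun S lam (k • o) ((lam / k) • o + w) = 0 := by
  constructor
  · have hmain : bil S o o = curv S → bil S o w = 0 → curv S ^ 2 = 1 →
        bil S ((lam / k) • o + w) ((lam / k) • o + w) = curv S := by
      intro h1 h2 h3
      simp only [bil_add_left, bil_add_right, bil_smul_left, bil_smul_right, bil_symm w o, h1, h2,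
        hww]
      field_simp
      linear_combination (-curv S) * hk - h3
    cases S
    · have h1 : o 0 = 1 := ho
      have h2 : w 0 = 0 := hw
      have h3 := eq_of_sq_eq_euclidean hlam hk0 hk
      subst h3
      rw [div_self hk0.ne', one_smul]
      show (o + w) 0 = 1
      simp [h1, h2]
    · show form spherical _ _ = 1
      rw [form_eq]
      exact hmain (by rw [bil_apply]; exact ho) hw (by simp [curv])
    · have h1 : bil hyperbolic o o = -1 := by rw [bil_apply]; exact ho.1
      have h2 : bil hyperbolic o w = 0 := hw
      have h3 := hmain h1 h2 (by simp [curv])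
      simp only [curv] at h3
      refine ⟨by rw [form_eq, h3], pos_of_bil_neg (p := o) (by rw [h1]; norm_num) ho.2
        (by rw [h3]; norm_num) ?_⟩
      rw [bil_add_right, bil_smul_right, h1, h2]
      have : 0 < lam / k := by positivity
      linarith
  · have h1 : k • o - lam • ((lam / k) • o + w) = (curv S / k) • o - lam • w := by
      rw [smul_add, smul_smul, sub_add_eq_sub_sub, ← sub_smul]
      congr 2
      field_simp
      linarith
    have h2 := curv_mul_bil_eq_zero hw
    have h3 := curv_mul_bil_self ho
    have h4 := curv_pow_three (S := S)
    rw [sphereFun, h1]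
    simp only [bil_sub_left, bil_sub_right, bil_smul_left, bil_smul_right, bil_symm w o, hww]
    field_simp
    linear_combination hk + 2 * lam * k * h2 - curv S * h3 - h4

lemma ne_neg_of_bil_pos {o x : Space S n} (h : S = spherical → 0 < bil S (o : Ambient n) x) :
    (x : Ambient n) ≠ -o := by
  intro hx
  cases S
  · have h1 : (o : Ambient n) 0 = 1 := o.2
    have h2 : (x : Ambient n) 0 = 1 := x.2
    rw [hx] at h2
    simp [h1] at h2
    norm_num at h2
  · have h1 := h rfl
    have h2 : bil spherical (o : Ambient n) o = 1 := by rw [bil_apply]; exact o.2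
    rw [hx, map_neg, h2] at h1
    norm_num at h1
  · have h1 : 0 < (o : Ambient n) 0 := o.2.2
    have h2 : 0 < (x : Ambient n) 0 := x.2.2
    rw [hx] at h2
    simp at h2
    linarith

/-- A geodesic ball is star-shaped. -/
lemma sphereFun_chord_pos {lam k : ℝ} (hlam : 0 < lam) (hk0 : 0 < k)
    (hk : k ^ 2 = lam ^ 2 + curv S) {o x : Space S n}
    (h : 0 < sphereFun S lam (k • (o : Ambient n)) x) :
    (x : Ambient n) ≠ -o ∧ ∀ t ∈ Icc (0 : ℝ) 1,
      0 < sphereFun S lam (k • (o : Ambient n)) (proj S (chord (o : Ambient n) x t)) := by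
  have hox := bil_sub_self_nonneg x o
  have hb : ∀ t, bil S (o : Ambient n) (chord (o : Ambient n) x t) =
      (1 - t) * bil S (o : Ambient n) o + t * bil S (o : Ambient n) x := by
    intro t
    simp only [chord, bil_add_right, bil_smul_right, bil_sub_right]
    ring
  have hbb : ∀ t, bil S (chord (o : Ambient n) x t) (chord (o : Ambient n) x t) =
      (1 - t) ^ 2 * bil S (o : Ambient n) o + t ^ 2 * bil S (x : Ambient n) x +
        2 * t * (1 - t) * bil S (o : Ambient n) x := by
    intro t
    simp only [chord, bil_add_left, bil_add_right, bil_smul_left, bil_smul_right, bil_sub_left,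
      bil_sub_right, bil_symm (x : Ambient n) o]
    ring
  have hne : (x : Ambient n) ≠ -o := by
    refine ne_neg_of_bil_pos fun hS => ?_
    subst hS
    rw [sphereFun_of_curv_sq_eq_one hk (by simp [curv]) o.2 x.2] at h
    simp only [curv] at h
    have h1 := (pos_iff_pos_of_mul_pos h).1 (by positivity)
    exact (pos_iff_pos_of_mul_pos (show 0 < k * _ by linarith)).1 hk0
  refine ⟨hne, fun t ht => ?_⟩
  have hdom := chord_mem_domain o.2 x.2 hne ht
  have ht1 : 0 ≤ 1 - t := by linarith [ht.2]
  have htt : 0 ≤ t * (1 - t) := mul_nonneg ht.1 ht1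
  cases S
  · have h1 : (o : Ambient n) 0 = 1 := o.2
    have h2 : (x : Ambient n) 0 = 1 := x.2
    have h3 := eq_of_sq_eq_euclidean hlam hk0 hk
    rw [sphereFun_euclidean h3] at h
    have h4 : chord (o : Ambient n) x t - o = t • ((x : Ambient n) - o) := by
      rw [chord]; abel
    rw [coe_proj hdom, ambProj_self (by show chord (o : Ambient n) x t 0 = 1; simp [chord, h1, h2]),
      sphereFun_euclidean h3, h4, bil_smul_left, bil_smul_right]
    have h5 : t * t ≤ 1 := by nlinarith [ht.1, ht.2]
    have h6 : 0 ≤ lam ^ 2 * bil euclidean ((x : Ambient n) - (o : Ambient n)) (x - o) := by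
      positivity
    nlinarith
  · have h1 : bil spherical (o : Ambient n) o = 1 := by rw [bil_apply]; exact o.2
    have h2 : bil spherical (x : Ambient n) x = 1 := by rw [bil_apply]; exact x.2
    simp only [h1, h2] at hb hbb
    simp only [bil_sub_left, bil_sub_right, h1, h2, bil_symm (x : Ambient n) o] at hox
    rw [sphereFun_of_curv_sq_eq_one hk (by simp [curv]) o.2 x.2] at h
    rw [sphereFun_of_curv_sq_eq_one hk (by simp [curv]) o.2 (proj spherical _).2]
    simp only [curv, one_mul] at h hk ⊢
    have h3 := (pos_iff_pos_of_mul_pos h).1 (by positivity)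
    refine mul_pos (by positivity) ?_
    have hpos : 0 < bil spherical (chord (o : Ambient n) x t) (chord (o : Ambient n) x t) := hdom
    rw [coe_proj hdom, ambProj, bil_smul_right, hb]
    -- A spherical chord lies in the unit ball, so projecting it multiplies the product with `o` by
    -- at least 1, which preserves a lower bound by a positive number.
    have h4 : 1 ≤ (√(bil spherical (chord (o : Ambient n) x t) (chord (o : Ambient n) x t)))⁻¹ := by
      refine (one_le_inv₀ (Real.sqrt_pos.2 hpos)).2 (Real.sqrt_le_one.2 ?_)
      rw [hbb]
      nlinarith
    have h5 : lam < k := lt_of_pow_lt_pow_left₀ 2 hk0.le (by linarith)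
    have h6 : lam < k * ((1 - t) * 1 + t * bil spherical (o : Ambient n) x) := by
      rcases ht.1.eq_or_lt with h7 | h7
      · rw [← h7]; linarith
      · nlinarith
    nlinarith
  · have h1 : bil hyperbolic (o : Ambient n) o = -1 := by rw [bil_apply]; exact o.2.1
    have h2 : bil hyperbolic (x : Ambient n) x = -1 := by rw [bil_apply]; exact x.2.1
    simp only [h1, h2] at hb hbb
    simp only [bil_sub_left, bil_sub_right, h1, h2, bil_symm (x : Ambient n) o] at hox
    rw [sphereFun_of_curv_sq_eq_one hk (by simp [curv]) o.2 x.2] at h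
    rw [sphereFun_of_curv_sq_eq_one hk (by simp [curv]) o.2 (proj hyperbolic _).2]
    simp only [curv] at h hk ⊢
    have h3 := (pos_iff_pos_of_mul_pos h).1 (by positivity)
    refine mul_pos (by positivity) ?_
    have hneg : bil hyperbolic (chord (o : Ambient n) x t) (chord (o : Ambient n) x t) < 0 := hdom.1
    rw [coe_proj hdom, ambProj, bil_smul_right, hb]
    -- A hyperbolic chord lies above the hyperboloid, so projecting it scales by a factor in `(0,
    -- 1]`; this preserves a lower bound by the negative number `-lam`.
    have h4 : (√(-bil hyperbolic (chord (o : Ambient n) x t) (chord (o : Ambient n) x t)))⁻¹ ≤ 1 := by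
      refine inv_le_one_of_one_le₀ (Real.one_le_sqrt.2 ?_)
      rw [hbb]
      nlinarith
    have h4' : 0 < (√(-bil hyperbolic (chord (o : Ambient n) x t)
        (chord (o : Ambient n) x t)))⁻¹ := inv_pos.2 (Real.sqrt_pos.2 (by linarith))
    have h5 : k < lam := lt_of_pow_lt_pow_left₀ 2 hlam.le (by linarith)
    have h6 : 0 < k * ((1 - t) * -1 + t * bil hyperbolic (o : Ambient n) x) + lam := by
      rcases ht.1.eq_or_lt with h7 | h7
      · rw [← h7]; linarith
      · nlinarith
    nlinarith

lemma isPreconnected_sphereFun_pos {lam k : ℝ} (hlam : 0 < lam) (hk0 : 0 < k)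
    (hk : k ^ 2 = lam ^ 2 + curv S) (o : Space S n) :
    IsPreconnected {x : Space S n | 0 < sphereFun S lam (k • (o : Ambient n)) x} := by
  refine isPreconnected_of_forall o fun x hx => ?_
  obtain ⟨h1, h2⟩ := sphereFun_chord_pos hlam hk0 hk hx
  refine ⟨(fun t => proj S (chord (o : Ambient n) x t)) '' Icc 0 1, ?_, ⟨0, by simp, ?_⟩,
    ⟨1, by simp, ?_⟩, isPreconnected_Icc.image _ fun t ht => ?_⟩
  · rintro _ ⟨t, ht, rfl⟩
    exact h2 t ht
  · simp [chord, proj_coe]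
  · simp [chord, proj_coe]
  · have h3 : Continuous fun t : ℝ => chord (o : Ambient n) x t := by unfold chord; fun_prop
    exact (ContinuousAt.comp (g := proj S) (continuousAt_proj (chord_mem_domain o.2 x.2 h1 ht))
      h3.continuousAt).continuousWithinAt

/-- Normalisation maps the punctured tangent space at the centre onto the geodesic sphere; that
space is connected because its dimension is at least 2. -/
lemma isConnected_sphereFun_eq_zero (hn : 1 ≤ n) {lam k : ℝ} (hlam : 0 < lam) (hk0 : 0 < k)
    (hk : k ^ 2 = lam ^ 2 + curv S) (o : Space S n) :
    IsConnected {x : Space S n | sphereFun S lam (k • (o : Ambient n)) x = 0} := by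
  set W := LinearMap.ker (rad S (o : Ambient n) : Ambient n →ₗ[ℝ] ℝ) with hW
  have hWc : IsConnected ({0}ᶜ : Set W) := by
    refine isConnected_compl_singleton_of_one_lt_rank ?_ 0
    have h1 := LinearMap.finrank_range_add_finrank_ker
      (rad S (o : Ambient n) : Ambient n →ₗ[ℝ] ℝ)
    have h2 := Submodule.finrank_le (LinearMap.range
      (rad S (o : Ambient n) : Ambient n →ₗ[ℝ] ℝ))
    simp only [finrank_euclideanSpace, Fintype.card_fin, Module.finrank_self] at h1 h2
    rw [← Module.finrank_eq_rank]
    have h3 : 1 < Module.finrank ℝ W := by rw [hW]; omega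
    exact_mod_cast h3
  have hpos : ∀ w : W, w ≠ 0 → 0 < bil S (w : Ambient n) w := fun w hw =>
    bil_self_pos o.2 w.2 fun h => hw (Subtype.ext h)
  set f : W → Ambient n := fun w => (lam / k) • (o : Ambient n) +
    (k⁻¹ * (√(bil S (w : Ambient n) w))⁻¹) • (w : Ambient n) with hf
  have hfc : ContinuousOn f {0}ᶜ := by
    have h1 : Continuous fun w : W => bil S (w : Ambient n) w :=
      ((bil S).continuous.comp continuous_subtype_val).clm_apply continuous_subtype_val
    intro w hw
    refine ContinuousAt.continuousWithinAt ?_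
    exact continuousAt_const.add ((continuousAt_const.mul
      ((h1.sqrt.continuousAt).inv₀ (Real.sqrt_ne_zero'.2 (hpos w hw)))).smul
      continuous_subtype_val.continuousAt)
  have himg : (Subtype.val '' {x : Space S n | sphereFun S lam (k • (o : Ambient n)) x = 0}) =
      f '' {0}ᶜ := by
    ext y
    constructor
    · rintro ⟨x, hx, rfl⟩
      obtain ⟨h1, h2⟩ := of_sphereFun_eq_zero hlam hk0 hk o.2 x.2 hx
      refine ⟨⟨(x : Ambient n) - (lam / k) • (o : Ambient n), h1⟩, ?_, ?_⟩
      · intro h3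
        have h4 : (x : Ambient n) - (lam / k) • (o : Ambient n) = 0 := congrArg Subtype.val h3
        rw [h4, map_zero] at h2
        exact (pow_pos (inv_pos.2 hk0) 2).ne h2
      · simp only [hf, h2]
        rw [Real.sqrt_sq (inv_pos.2 hk0).le, mul_inv_cancel₀ (inv_pos.2 hk0).ne', one_smul]
        abel
    · rintro ⟨w, hw, rfl⟩
      obtain ⟨h1, h2⟩ := mem_carrier_of_bil_eq hlam hk0 hk o.2
        (w := (k⁻¹ * (√(bil S (w : Ambient n) w))⁻¹) • (w : Ambient n))
        (by rw [(rad S (o : Ambient n)).map_smul, show rad S (o : Ambient n) w = 0 from w.2,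
          smul_zero]) (by
          have h3 := Real.sqrt_pos.2 (hpos w hw)
          have h4 := Real.sq_sqrt (hpos w hw).le
          rw [bil_smul_left, bil_smul_right]
          nth_rewrite 3 [← h4]
          field_simp)
      exact ⟨⟨_, h1⟩, h2, rfl⟩
  have h1 := hWc.image f hfc
  rw [← himg] at h1
  exact ⟨h1.nonempty.of_image, IsInducing.subtypeVal.isPreconnected_image.1 h1.isPreconnected⟩

/-- If the osculating spheres of curvature `lam` at all boundary points have the same centre, then
`K` is the region bounded by this sphere. -/
lemma isUmbilicSide_of_center_eq (hn : 1 ≤ n) {K : Set (Space S n)} (hK : IsClosed K)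
    (hint : (interior K).Nonempty) (hfr : (frontier K).Nonempty) {ν : Space S n → Ambient n}
    (hν : IsInwardUnitNormal K ν) {lam : ℝ} (hlam : 0 < lam) (hρ : 0 < lam ^ 2 + curv S)
    (hg : ∀ p ∈ frontier K, ∀ x ∈ K, 0 ≤ gap S lam (ν p) p x) {c : Ambient n}
    (hc : ∀ p ∈ frontier K, ν p + lam • (p : Ambient n) = c) : IsUmbilicSide lam K := by
  have hrad : ∀ p ∈ frontier K, rad S (p : Ambient n) (ν p) = 0 := fun p hp =>
    isTangent_univ_iff.1 (hν.1 p hp).1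
  have hone : ∀ p ∈ frontier K, bil S (ν p) (ν p) = 1 := fun p hp => by
    rw [← form_eq]; exact (hν.1 p hp).2.1
  obtain ⟨p₀, hp₀⟩ := hfr
  set k := √(lam ^ 2 + curv S) with hk
  have hk0 : 0 < k := Real.sqrt_pos.2 hρ
  have hk2 : k ^ 2 = lam ^ 2 + curv S := Real.sq_sqrt hρ.le
  obtain ⟨o, ho⟩ : ∃ o : Space S n, c = k • (o : Ambient n) :=
    ⟨⟨k⁻¹ • c, hc p₀ hp₀ ▸ center_mem hlam hρ p₀.2 (hrad p₀ hp₀) (hone p₀ hp₀)⟩, by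
      rw [smul_inv_smul₀ hk0.ne']⟩
  set u : Ambient n → ℝ := sphereFun S lam c with hu
  have hug : ∀ x, u x = 2 * lam * gap S lam (ν p₀) p₀ x := fun x => by
    rw [hu, sphereFun, ← hc p₀ hp₀]
    exact one_sub_bil_self_eq (hone p₀ hp₀) x
  have hK0 : ∀ x ∈ K, 0 ≤ u x := fun x hx => by
    rw [hug]; have := hg p₀ hp₀ x hx; positivity
  have hνc : ∀ p ∈ frontier K, ν p = c - lam • (p : Ambient n) := fun p hp => by
    rw [← hc p hp, add_sub_cancel_right]
  have hfr0 : ∀ p ∈ frontier K, u p = 0 := fun p hp => by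
    rw [hu, sphereFun, ← hνc p hp, hone p hp, sub_self]
  have hgap0 : ∀ x, u x = 0 → gap S lam (ν p₀) p₀ x = 0 := fun x hx =>
    (mul_eq_zero.1 ((hug x).symm.trans hx)).resolve_left (by positivity)
  have htan : ∀ x : Space S n, u x = 0 → rad S (x : Ambient n) (c - lam • (x : Ambient n)) = 0 := by
    intro x hx
    have h1 := rad_center_sub (lam := lam) p₀.2 x.2 (hrad p₀ hp₀)
    rwa [hgap0 x hx, mul_zero, zero_smul, sub_zero, hc p₀ hp₀] at h1
  have hunit : ∀ x : Ambient n, u x = 0 → bil S (c - lam • x) (c - lam • x) = 1 := fun x hx => by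
    rw [hu, sphereFun] at hx; linarith
  -- A zero of `u` in the interior would be a local minimum of a `gap` of curvature `lam > 0` with
  -- tangent linear part, against `touch_interior`.
  have hint0 : ∀ x ∈ interior K, 0 < u x := by
    intro x hx
    refine lt_of_le_of_ne (hK0 x (interior_subset hx)) fun h => ?_
    have h1 := touch_interior hn (z := x) (b := c - lam • (x : Ambient n)) (α := 0) (τ := lam)
      (by simpa using htan x h.symm) (by
        filter_upwards [isOpen_interior.mem_nhds hx] with y hy
        have h2 := hg p₀ hp₀ y (interior_subset hy)
        rwa [gap_eq_gap_add lam (ν p₀) p₀ x y, hgap0 x h.symm, zero_add, hc p₀ hp₀] at h2)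
    linarith
  -- The open ball is connected, meets the interior of `K` and misses its frontier, where `u`
  -- vanishes.
  have hposK : ∀ x : Space S n, 0 < u x → x ∈ K := by
    intro x hx
    by_contra hxK
    obtain ⟨y, hy⟩ := hint
    have hpre := isPreconnected_sphereFun_pos hlam hk0 hk2 o
    rw [← ho] at hpre
    obtain ⟨z, hz1, hz2⟩ := exists_mem_frontier_of_isPreconnected hpre (hint0 y hy)
      (interior_subset hy) hx hxK
    exact (ne_of_gt hz1) (hfr0 z hz2)
  have hfrK : frontier K = {x : Space S n | u x = 0} := by
    refine Subset.antisymm (fun p hp => hfr0 p hp) fun x hx => ?_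
    have hx0 : u x = 0 := hx
    rw [hK.frontier_eq]
    refine ⟨?_, fun h => (hint0 x h).ne' hx0⟩
    -- A point of the geodesic sphere is a limit of points of the open ball, reached along the
    -- direction towards the centre.
    obtain ⟨γ, h0, h1, -⟩ := isTangent_univ_iff.2 (htan x hx0)
    have h2 := hasDerivAt_sphereFun (S := S) (lam := lam) (c := c) h1
    rw [h0, hunit x hx0] at h2
    have h3 := eventually_pos_of_hasDerivAt h2 (by rw [h0]; exact hx0) (by positivity)
    refine hK.mem_of_tendsto ((tendsto_of_hasDerivAt_coe h0 h1).mono_left nhdsWithin_le_nhds)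
      (h3.mono fun t ht => hposK _ ht)
  refine ⟨hK, ?_, ?_, ν, hν, ?_⟩
  · rw [hfrK, hu, ho]
    exact isConnected_sphereFun_eq_zero hn hlam hk0 hk2 o
  · intro p hp
    refine ⟨u, (contDiff_sphereFun lam c).contDiffAt, Eventually.of_forall fun x => ?_,
      c - lam • (p : Ambient n), isTangent_univ_iff.2 (htan p (hfr0 p hp)), ?_⟩
    · rw [hfrK]; rfl
    · have h1 := hasDerivAt_sphereFun (S := S) (lam := lam) (c := c)
        (hasDerivAt_line (p : Ambient n) (c - lam • (p : Ambient n)) 0)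
      have hd : HasFDerivAt u (fderiv ℝ u p) (p : Ambient n) :=
        ((contDiff_sphereFun lam c (k := 1)).differentiable one_ne_zero p).hasFDerivAt
      have h2 : HasDerivAt (fun t : ℝ => u ((p : Ambient n) + t • (c - lam • (p : Ambient n))))
          (fderiv ℝ u p (c - lam • (p : Ambient n))) 0 :=
        HasFDerivAt.comp_hasDerivAt_of_eq 0 hd
          (hasDerivAt_line (p : Ambient n) (c - lam • (p : Ambient n)) 0) (by simp)
      rw [h2.unique h1]
      simp only [zero_smul, add_zero]
      rw [hunit p (hfr0 p hp)]
      simp [hlam.ne']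
  · intro p hp X hX
    refine ⟨hX, fun y => c - lam • y, by fun_prop, ?_, ?_⟩
    · filter_upwards [self_mem_nhdsWithin] with q hq using (hνc q hq).symm
    · have h1 : HasFDerivAt (fun y : Ambient n => c - lam • y)
          (-(lam • ContinuousLinearMap.id ℝ (Ambient n))) (p : Ambient n) :=
        ((hasFDerivAt_id (p : Ambient n)).const_smul lam).const_sub c
      rw [h1.fderiv]
      simp

/-! ### Assembling the argument. -/

/-- The quadratic term of `gap` is strictly positive off `p`, because chords of the model are
spacelike; so `0 ≤ gap` forces strict support. -/
lemma isLocallyStrictlyConvex_of_lambdaConvex {K : Set (Space S n)} (hK : IsClosed K)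
    (hdef : ∀ p ∈ frontier K, ∃ F, IsDefFun K p F) {lam : ℝ} (hlam : 0 < lam)
    (hconv : IsLambdaConvex lam K) : IsLocallyStrictlyConvex K := by
  intro p hp
  obtain ⟨F, hF⟩ := hdef p hp
  refine ⟨F, hF, ?_⟩
  filter_upwards [(hF.lambdaConvex hp hK hlam hconv).1] with x hx hxK hxp
  have h1 := hx hxK
  have h2 := bil_sub_self_pos x.2 p.2 fun h => hxp (Subtype.ext h)
  rw [gap] at h1
  have := mul_pos (half_pos hlam) h2
  linarith

lemma exists_lt_shape (hn : 1 ≤ n) {lam : ℝ} (hlam : 0 < lam) {K : Set (Space S n)}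
    (hbody : IsLambdaConvexBody lam K) (hconn : IsConnected K) (hproper : K ≠ univ)
    (hnontrivial : IsNontrivial lam K) (hC2 : IsHypersurface 2 (frontier K))
    (hdef : ∀ p ∈ frontier K, ∃ F, IsDefFun K p F) {ν : Space S n → Ambient n}
    (hν : IsInwardUnitNormal K ν) :
    ∃ p ∈ frontier K, ∃ F, IsDefFun K p F ∧
      ∀ X ∈ tangentPlane S (p : Ambient n) (unitGrad S F p), X ≠ 0 →
        lam * bil S X X < bil S (shape S F p X) X := by
  obtain ⟨hcpt, hconv, hint⟩ := hbody
  have hK := hcpt.isClosed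
  have hloc := isLocallyStrictlyConvex_of_lambdaConvex hK hdef hlam hconv
  have hcl := closure_interior_eq hK hconn hint hC2
  have hg : ∀ p ∈ frontier K, ∀ x ∈ K, 0 ≤ gap S lam (ν p) p x := by
    intro p hp x hx
    refine gap_nonneg hn hcpt hlam hdef hν
      (fun q hq F hF => (hF.lambdaConvex hq hK hlam hconv).2) ?_ hp hx
    intro q hq y hy
    obtain ⟨F, hF⟩ := hdef q hq
    rw [hF.normal_eq hν hq]
    exact bil_sub_nonneg hn hK hconn hproper hloc hcl hq hF hy
  have hfr : (frontier K).Nonempty := nonempty_frontier_iff.2 ⟨hconn.nonempty, hproper⟩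
  -- The first case is hyperbolic with `lam ≤ 1`: horospheres and equidistant hypersurfaces, which
  -- have no centre in the model.
  rcases le_or_gt (lam ^ 2 + curv S) 0 with hρ | hρ
  · cases S
    · simp only [curv] at hρ
      nlinarith
    · simp only [curv] at hρ
      nlinarith
    · simp only [curv] at hρ
      exact exists_lt_shape_hyperbolic hn hcpt hconn.nonempty hdef (by nlinarith)
  obtain ⟨p, hp⟩ := hfr
  by_cases hc : ∀ q ∈ frontier K, ν q + lam • (q : Ambient n) = ν p + lam • (p : Ambient n)
  · exact absurd (isUmbilicSide_of_center_eq hn hK hint ⟨p, hp⟩ hν hlam hρ hg hc) hnontrivial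
  · push Not at hc
    obtain ⟨q, hq, hne⟩ := hc
    have hrad : ∀ p ∈ frontier K, rad S (p : Ambient n) (ν p) = 0 := fun p hp =>
      isTangent_univ_iff.1 (hν.1 p hp).1
    have hone : ∀ p ∈ frontier K, bil S (ν p) (ν p) = 1 := fun p hp => by
      rw [← form_eq]; exact (hν.1 p hp).2.1
    exact exists_lt_shape_of_center_ne hn hcpt hdef hlam hρ (hrad q hq) (hone q hq) (hrad p hp)
      (hone p hp) (hK.frontier_subset hq) (hg q hq) (hg p hp) hne

end SpaceForm

theorem mainTheorem3 (S : SpaceForm) (n : ℕ) (hn : 1 ≤ n) (lam : ℝ) (hlam : 0 < lam)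
    (K : Set (SpaceForm.Space S n))
    (hbody : SpaceForm.IsLambdaConvexBody lam K)
    (hconn : IsConnected K) (hproper : K ≠ Set.univ)
    (hnontrivial : SpaceForm.IsNontrivial lam K)
    (hC2 : SpaceForm.IsHypersurface 2 (frontier K)) :
    ∃ ν : SpaceForm.Space S n → SpaceForm.Ambient n,
      SpaceForm.IsInwardUnitNormal K ν ∧
      (∃ p ∈ frontier K, ∃ κ : ℝ,
        IsLeast (SpaceForm.principalCurvatures (frontier K) ν p) κ ∧ lam < κ) ∧
      (∃ U : Set (SpaceForm.Space S n), IsOpen U ∧ (U ∩ frontier K).Nonempty ∧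
        SpaceForm.IsStrictlyLambdaConvex lam (U ∩ frontier K) ν) := by
  classical
  have hK := hbody.1.isClosed
  have hcl := SpaceForm.closure_interior_eq hK hconn hbody.2.2 hC2
  have hdef : ∀ p ∈ frontier K, ∃ F, SpaceForm.IsDefFun K p F := fun p hp =>
    SpaceForm.exists_isDefFun_of_mem_closure hK hC2 hp (hcl.symm ▸ hK.frontier_subset hp)
  have hex : ∀ p, ∃ v, p ∈ frontier K → SpaceForm.IsInwardUnitNormalAt K p v := by
    intro p
    by_cases hp : p ∈ frontier K
    · obtain ⟨F, hF⟩ := hdef p hp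
      exact ⟨_, fun _ => hF.isInwardUnitNormalAt hp⟩
    · exact ⟨0, fun h => absurd h hp⟩
  choose ν hν' using hex
  have hν : SpaceForm.IsInwardUnitNormal K ν := SpaceForm.isInwardUnitNormal_iff.2 hν'
  obtain ⟨p, hp, F, hF, hpos⟩ := SpaceForm.exists_lt_shape hn hlam hbody hconn hproper hnontrivial
    hC2 hdef hν
  rw [← hF.normal_eq hν hp] at hpos
  obtain ⟨h1, h2⟩ := SpaceForm.exists_isStrictlyLambdaConvex hn hF hC2 hν hp hpos
  exact ⟨ν, hν, ⟨p, hp, h1⟩, h2⟩
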